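/- Fix nonnegative radial functions $\varrho,\varphi\in C^\infty(\mathbb R^3)$, supported in $\{|\xi|\le\frac43\}$ and $\{\frac34\le|\xi|\le\frac83\}$ respectively, with $\varrho(\xi)+\sum_{j\ge0}\varphi(2^{-j}\xi)=1$ for all $\xi$ and $\sum_{j\in\mathbb Z}\varphi(2^{-j}\xi)=1$ for all $\xi\ne0$. For a tempered distribution $f$ on $\mathbb R^3$ put $\Delta_jf=0$ for $j\le-2$, $\Delta_{-1}f=\varrho(D)f$ and $\Delta_jf=\varphi(2^{-j}D)f$ for $j\ge0$, where $m(D)$ is the Fourier multiplier with symbol $m$. For $s\in\mathbb R$, $B^s_{3,\infty}(\mathbb R^3)$ is the space of all $f$ with $\|f\|_{B^s_{3,\infty}}=\sup_{j\in\mathbb Z}2^{js}\|\Delta_jf\|_{L^3}<\infty$, and $B^s_{3,c(\mathbb N)}(\mathbb R^3)$ is the space of those $f\in B^s_{3,\infty}(\mathbb R^3)$ for which $2^{js}\|\Delta_jf\|_{L^3}\to0$ as $j\to\infty$. Both spaces carry the norm $\|\cdot\|_{B^s_{3,\infty}}$, and $L^3(0,T;X)$ is the set of measurable $f:(0,T)\to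 X$ with $\|f\|_X\in L^3(0,T)$. Let $0<T<\infty$. A weak solution on $[0,T]$ of the incompressible Euler equations on $\mathbb R^3$, $$u_t+u\cdot\nabla u+\nabla\Pi=0,\qquad \operatorname{div}u=0,\qquad u|_{t=0}=u_0,$$ with $u_0\in L^2(\mathbb R^3)^3$, is a weakly continuous function $u:[0,T]\to L^2(\mathbb R^3)^3$ with $u(0)=u_0$ such that $\operatorname{div}u(t)=0$ in the sense of distributions for every $t\in[0,T]$ and, for every $\psi\in C_c^\infty(\mathbb R\times\mathbb R^3;\mathbb R^3)$ with $\operatorname{div}_x\psi=0$ and every $t\in[0,T]$, $$\int u(t)\cdot\psi(t)\,dx-\int u_0\cdot\psi(0)\,dx-\int_0^t\!\int u\cdot\partial_s\psi\,dx\,ds=\int_0^t\!\int u\cdot\big((u\cdot\nabla)\psi\big)\,dx\,ds.$$ **Theorem 1.1.** Let $u=(u_1,u_2,u_3)$ be a weak solution on $[0,T]$ of the incompressible Euler equations on $\mathbb R^3$ with initial datum $u_0$, and write $u_h=(u_1,u_2)$. Suppose that $$u_h\in L^3\big(0,T;B^\alpha_{3,c(\mathbb N)}(\mathbb R^3)\big),\qquad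 u_3\in L^3\big(0,T;B^\beta_{3,\infty}(\mathbb R^3)\big),\qquad \tfrac13\le\alpha<1,\quad \beta\ge\tfrac{1-\alpha}2 .$$ Then the kinetic energy is conserved: $$\frac12\int_{\mathbb R^3}|u(x,t)|^2\,dx=\frac12\int_{\mathbb R^3}|u_0(x)|^2\,dx\qquad\text{for every }t\in[0,T].$$ In particular (take $\alpha=\beta=\frac13$), $u_3$ may lie in the critical space $L^3(0,T;B^{1/3}_{3,\infty}(\mathbb R^3))$ when $u_h\in L^3(0,T;B^{1/3}_{3,c(\mathbb N)}(\mathbb R^3))$. -/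

import Mathlib

open MeasureTheory Set Filter Topology TemperedDistribution
open scoped ENNReal ContDiff SchwartzMap

/-- Three-dimensional Euclidean space, used both for points and for velocities. -/
abbrev E3 : Type := EuclideanSpace ℝ (Fin 3)

instance fact_one_le_three_ennreal : Fact ((1 : ℝ≥0∞) ≤ 3) := ⟨by norm_num⟩

/-- A dyadic partition of unity `(ϱ, φ)` on the frequency space `ℝ³`. -/
structure DyadicPartition where
  /-- the low-frequency cut-off -/
  low : E3 → ℝ
  /-- the cut-off to a dyadic shell -/
  shell : E3 → ℝ
  low_smooth : ContDiff ℝ ∞ low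
  shell_smooth : ContDiff ℝ ∞ shell
  low_nonneg : ∀ ξ, 0 ≤ low ξ
  shell_nonneg : ∀ ξ, 0 ≤ shell ξ
  low_radial : ∀ ξ η : E3, ‖ξ‖ = ‖η‖ → low ξ = low η
  shell_radial : ∀ ξ η : E3, ‖ξ‖ = ‖η‖ → shell ξ = shell η
  low_support : Function.support low ⊆ {ξ | ‖ξ‖ ≤ 4 / 3}
  shell_support : Function.support shell ⊆ {ξ | 3 / 4 ≤ ‖ξ‖ ∧ ‖ξ‖ ≤ 8 / 3}
  sum_inhomogeneous :
    ∀ ξ, HasSum (fun j : ℕ => shell ((2 : ℝ) ^ (-(j : ℤ)) • ξ)) (1 - low ξ)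
  sum_homogeneous :
    ∀ ξ, ξ ≠ 0 → HasSum (fun j : ℤ => shell ((2 : ℝ) ^ (-j) • ξ)) 1

noncomputable section

/-- The inhomogeneous dyadic block `Δ_j` acting on tempered distributions:
`Δ_j = 0` for `j ≤ -2`, `Δ_{-1} = ϱ(D)`, and `Δ_j = φ(2^{-j} D)` for `j ≥ 0`. -/
def DyadicPartition.block (P : DyadicPartition) (j : ℤ) (f : 𝓢'(E3, ℂ)) : 𝓢'(E3, ℂ) :=
  if j ≤ -2 then 0
  else if j = -1 then fourierMultiplierCLM ℂ (fun ξ : E3 => (P.low ξ : ℂ)) f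
  else fourierMultiplierCLM ℂ (fun ξ : E3 => (P.shell ((2 : ℝ) ^ (-j) • ξ) : ℂ)) f

/-- The `L^p(ℝ³)` norm of a tempered distribution: the norm of the (unique) `L^p` function that
represents it, and `∞` when there is none. -/
def distLpNorm (p : ℝ≥0∞) [Fact (1 ≤ p)] (f : 𝓢'(E3, ℂ)) : ℝ≥0∞ :=
  ⨅ (g : Lp ℂ p (volume : Measure E3)) (_ : (g : 𝓢'(E3, ℂ)) = f), ‖g‖ₑ

/-- The quantity `2^{js} ‖Δ_j f‖_{L^p}`. -/
def DyadicPartition.weightedBlock (P : DyadicPartition) (s : ℝ) (p : ℝ≥0∞) [Fact (1 ≤ p)]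
    (f : 𝓢'(E3, ℂ)) (j : ℤ) : ℝ≥0∞ :=
  ENNReal.ofReal ((2 : ℝ) ^ ((j : ℝ) * s)) * distLpNorm p (P.block j f)

/-- The inhomogeneous Besov norm `‖f‖_{B^s_{p,∞}(ℝ³)}`, with values in `[0, ∞]`. -/
def DyadicPartition.besovNorm (P : DyadicPartition) (s : ℝ) (p : ℝ≥0∞) [Fact (1 ≤ p)]
    (f : 𝓢'(E3, ℂ)) : ℝ≥0∞ :=
  ⨆ j : ℤ, P.weightedBlock s p f j

/-- The Besov space `B^s_{p,∞}(ℝ³)`. -/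
def DyadicPartition.besov (P : DyadicPartition) (s : ℝ) (p : ℝ≥0∞) [Fact (1 ≤ p)] :
    Set 𝓢'(E3, ℂ) :=
  {f | P.besovNorm s p f < ⊤}

/-- The space `B^s_{p,c(ℕ)}(ℝ³)` of those `f` in `B^s_{p,∞}(ℝ³)` for which
`2^{js} ‖Δ_j f‖_{L^p} → 0` as `j → ∞`. -/
def DyadicPartition.besovC (P : DyadicPartition) (s : ℝ) (p : ℝ≥0∞) [Fact (1 ≤ p)] :
    Set 𝓢'(E3, ℂ) :=
  {f | P.besovNorm s p f < ⊤ ∧ Tendsto (P.weightedBlock s p f) atTop (𝓝 0)}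

/-- `f ∈ L^q(0,T;X)`, for a set `X` of tempered distributions and a norm `N` on it: `f` is
measurable (tested against Schwartz functions), takes values in `X` at almost every time of
`(0,T)`, and `t ↦ N (f t)` belongs to `L^q(0,T)`. -/
def MemBochner (q : ℝ≥0∞) (T : ℝ) (X : Set 𝓢'(E3, ℂ)) (N : 𝓢'(E3, ℂ) → ℝ≥0∞)
    (f : ℝ → 𝓢'(E3, ℂ)) : Prop :=
  (∀ η : 𝓢(E3, ℂ), AEMeasurable (fun t => f t η) (volume.restrict (Ioo 0 T))) ∧
  (∀ᵐ t ∂volume.restrict (Ioo 0 T), f t ∈ X) ∧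
  MemLp (fun t => N (f t)) q (volume.restrict (Ioo 0 T))

/-- The `i`-th component of a square-integrable vector field, as a tempered distribution. -/
def component (i : Fin 3) (v : Lp E3 2 (volume : Measure E3)) : 𝓢'(E3, ℂ) :=
  (((Complex.ofRealCLM.comp (EuclideanSpace.proj i : E3 →L[ℝ] ℝ)).compLp v :
    Lp ℂ 2 (volume : Measure E3)) : 𝓢'(E3, ℂ))

/-- The divergence of a differentiable vector field. -/
def divergence (w : E3 → E3) (x : E3) : ℝ :=
  ∑ i : Fin 3, fderiv ℝ w x (EuclideanSpace.single i 1) i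

/-- `u` is a weak solution on `[0,T]` of the incompressible Euler equations
`∂ₜu + u·∇u + ∇Π = 0`, `div u = 0`, `u|_{t=0} = u₀` on `ℝ³`: `u ∈ C_w([0,T]; L²(ℝ³))`, and the
equations hold in the sense of distributions. The momentum equation is tested against
divergence-free fields, so that the pressure drops out. -/
structure IsWeakEulerSolution (T : ℝ) (u₀ : Lp E3 2 (volume : Measure E3))
    (u : ℝ → Lp E3 2 (volume : Measure E3)) : Prop where
  /-- weak continuity in time with values in `L²` -/
  weakly_continuous : ∀ v : Lp E3 2 (volume : Measure E3),
    ContinuousOn (fun t => inner ℝ (u t) v) (Icc 0 T)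
  /-- the initial condition -/
  initial : u 0 = u₀
  /-- incompressibility at every time, in the sense of distributions -/
  divergence_free : ∀ t ∈ Icc 0 T, ∀ η : E3 → ℝ, ContDiff ℝ ∞ η → HasCompactSupport η →
    ∫ x, fderiv ℝ η x (u t x) = 0
  /-- the momentum equation, in the sense of distributions -/
  momentum : ∀ ψ : ℝ → E3 → E3, ContDiff ℝ ∞ (Function.uncurry ψ) →
    HasCompactSupport (Function.uncurry ψ) → (∀ t x, divergence (ψ t) x = 0) →
    ∀ t ∈ Icc 0 T,
      (∫ x, inner ℝ (u t x) (ψ t x)) - (∫ x, inner ℝ (u₀ x) (ψ 0 x))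
        - (∫ s in (0 : ℝ)..t, ∫ x, inner ℝ (u s x) (deriv (fun r => ψ r x) s))
      = ∫ s in (0 : ℝ)..t, ∫ x, inner ℝ (u s x) (fderiv ℝ (ψ s) x (u s x))

/-- The kinetic energy `½ ∫ |v|² dx`. -/
def kineticEnergy (v : Lp E3 2 (volume : Measure E3)) : ℝ :=
  1 / 2 * ∫ x, ‖v x‖ ^ 2

end

/-! This is the Constantin–E–Titi commutator argument, refined so that only the horizontal velocity
needs more than critical boundedness. Write `φ_n` for the even mollifier at scale `2⁻ⁿ` and `v = φ_n
⋆ u`. The energy of `v` changes by twice the time integral of the flux `∑ ∫ R_ij ∂_i v_j`, where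
`R_ij = φ_n ⋆ (u_i u_j) - v_i v_j`, and it suffices that this integral tends to zero.

The stress `R_ij` is quadratic in increments of `u` over distances at most `2⁻ⁿ`, and `∂_i v_j` is
`2ⁿ` times an average of such increments, because `∂_i φ_n` has mean zero. Hölder's inequality with
`1/3 + 1/3 + 1/3` bounds each term by `2ⁿ δ_i δ_j δ_j`, where `δ_i` bounds the `L³` increments of
`u_i`. The only term free of horizontal factors is `R_33 ∂_3 v_3`; incompressibility replaces `∂_3
v_3` by `-∂_1 v_1 - ∂_2 v_2`, after which every term contains `δ_1` or `δ_2`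
(`integral_stress_mul_vertical`, `enorm_fluxForm_le`).

Littlewood–Paley theory bounds `δ_i` by `2^{-ns}` times a weighted average of the quantities `2^{js}
‖Δ_j u_i‖` centred at `j = n` (`exists_eLpNorm_increment_coord_le`, `besovTail`). That average is
bounded by the Besov norm, and tends to zero when the blocks do. With `γ = (1 - α)/2` in place of
`β`, the powers of two cancel because `3α`, `α + 2γ` and `2α + γ` are all at least `1`. One
horizontal average then forces the flux to zero at almost every time, and the cubes of the norms
dominate it in time (`tendsto_lintegral_enorm_flux`).

The mollified balance is itself delicate, since `u` is only weakly continuous and the doubly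
mollified `u` is not an admissible test field. The equation is tested with that field frozen at a
time `τ`, admissible by density of compactly supported solenoidal fields
(`mem_closure_solenoidalTests`, `weak_form_frozen`); a telescoping sum over a time partition, using
symmetry of the energy form, then removes the freezing (`energy_balance_of_weaklyContinuous`). -/

/-! ### Minkowski's integral inequality -/

/-- Minkowski's integral inequality for an average with weight `k`. -/
theorem lintegral_rpow_lintegral_le {X Y : Type*} [MeasurableSpace X] [MeasurableSpace Y]
    {μ : Measure X} {ν : Measure Y} [SFinite μ] [SFinite ν] {p : ℝ} (hp : 1 ≤ p)
    {k : Y → ℝ≥0∞} {G : X → Y → ℝ≥0∞} (hk : AEMeasurable k ν)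
    (hG : AEMeasurable (Function.uncurry G) (μ.prod ν)) {A : ℝ≥0∞}
    (hA : ∀ y, k y ≠ 0 → ∫⁻ x, G x y ^ p ∂μ ≤ A) :
    ∫⁻ x, (∫⁻ y, k y * G x y ∂ν) ^ p ∂μ ≤ (∫⁻ y, k y ∂ν) ^ p * A := by
  have hp0 : 0 < p := by linarith
  have hGx : ∀ᵐ x ∂μ, AEMeasurable (G x) ν := by
    filter_upwards [hG.aestronglyMeasurable.prodMk_left] with x hx using hx.aemeasurable
  have hkG : AEMeasurable (Function.uncurry fun x y => k y * G x y ^ p) (μ.prod ν) :=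
    (hk.comp_snd).mul (hG.pow_const p)
  have key : ∀ᵐ x ∂μ, (∫⁻ y, k y * G x y ∂ν) ^ p
      ≤ (∫⁻ y, k y ∂ν) ^ (p - 1) * ∫⁻ y, k y * G x y ^ p ∂ν := by
    filter_upwards [hGx] with x hx
    have h := ENNReal.lintegral_mul_norm_pow_le (μ := ν) (f := fun y => k y * G x y ^ p)
      (g := k) (hk.mul (hx.pow_const p)) hk (p := 1 / p) (q := 1 - 1 / p) (by positivity)
      (by rw [sub_nonneg, div_le_one hp0]; exact hp) (by ring)
    -- Split `k G = (k G^p)^{1/p} k^{1-1/p}`, so that Hölder's inequality leaves the `p`-th power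
    -- under the weight `k`.
    have e : ∀ y, (k y * G x y ^ p) ^ (1 / p) * k y ^ (1 - 1 / p) = k y * G x y := by
      intro y
      have h1 : (1 : ℝ) / p + (1 - 1 / p) = 1 := by ring
      rw [ENNReal.mul_rpow_of_nonneg _ _ (by positivity), ← ENNReal.rpow_mul,
        mul_one_div_cancel hp0.ne', ENNReal.rpow_one, mul_right_comm,
        ← ENNReal.rpow_add_of_nonneg _ _ (by positivity)
          (by rw [sub_nonneg, div_le_one hp0]; exact hp), h1, ENNReal.rpow_one]
    simp only [e] at h
    calc (∫⁻ y, k y * G x y ∂ν) ^ p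
        ≤ ((∫⁻ y, k y * G x y ^ p ∂ν) ^ (1 / p) * (∫⁻ y, k y ∂ν) ^ (1 - 1 / p)) ^ p := by
          gcongr
      _ = _ := by
          have h2 : (1 - 1 / p) * p = p - 1 := by field_simp
          rw [ENNReal.mul_rpow_of_nonneg _ _ hp0.le, ← ENNReal.rpow_mul, ← ENNReal.rpow_mul,
            one_div_mul_cancel hp0.ne', ENNReal.rpow_one, h2, mul_comm]
  calc ∫⁻ x, (∫⁻ y, k y * G x y ∂ν) ^ p ∂μ
      ≤ ∫⁻ x, (∫⁻ y, k y ∂ν) ^ (p - 1) * ∫⁻ y, k y * G x y ^ p ∂ν ∂μ := lintegral_mono_ae key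
    _ = (∫⁻ y, k y ∂ν) ^ (p - 1) * ∫⁻ x, ∫⁻ y, k y * G x y ^ p ∂ν ∂μ :=
        lintegral_const_mul'' _ hkG.lintegral_prod_right'
    _ = (∫⁻ y, k y ∂ν) ^ (p - 1) * ∫⁻ y, ∫⁻ x, k y * G x y ^ p ∂μ ∂ν := by
        rw [lintegral_lintegral_swap hkG]
    _ ≤ (∫⁻ y, k y ∂ν) ^ (p - 1) * ∫⁻ y, k y * A ∂ν := by
        have hGy : ∀ᵐ y ∂ν, AEMeasurable (fun x => G x y) μ := by
          filter_upwards [hG.aestronglyMeasurable.prod_swap.prodMk_left] with y hy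
            using hy.aemeasurable
        refine mul_le_mul_right ?_ _
        refine lintegral_mono_ae ?_
        filter_upwards [hGy] with y hy
        rw [lintegral_const_mul'' _ (hy.pow_const p)]
        by_cases h0 : k y = 0
        · simp [h0]
        · gcongr
          exact hA y h0
    _ = (∫⁻ y, k y ∂ν) ^ p * A := by
        rw [lintegral_mul_const'' _ hk, ← mul_assoc]
        congr 1
        conv_lhs => rw [← ENNReal.rpow_one (∫⁻ y, k y ∂ν), ← ENNReal.rpow_mul]
        rw [← ENNReal.rpow_add_of_nonneg _ _ (by linarith) (by norm_num)]
        congr 1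
        ring

/-- The bound on the slices is required only where the kernel is nonzero; this is what lets
compactly supported kernels see increments at small distances only. -/
theorem eLpNorm_integral_smul_le {X Y 𝕜 F : Type*} [MeasurableSpace X] [MeasurableSpace Y]
    {μ : Measure X} {ν : Measure Y} [SFinite μ] [SFinite ν] [RCLike 𝕜]
    [NormedAddCommGroup F] [NormedSpace 𝕜 F] [NormedSpace ℝ F] {p : ℝ≥0∞} (hp : 1 ≤ p)
    (hp' : p ≠ ⊤) {K : Y → 𝕜} {G : X → Y → F} (hK : AEStronglyMeasurable K ν)
    (hG : AEStronglyMeasurable (Function.uncurry G) (μ.prod ν)) {A : ℝ≥0∞}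
    (hA : ∀ y, K y ≠ 0 → eLpNorm (fun x => G x y) p μ ≤ A) :
    eLpNorm (fun x => ∫ y, K y • G x y ∂ν) p μ ≤ eLpNorm K 1 ν * A := by
  have hp0 : p ≠ 0 := (zero_lt_one.trans_le hp).ne'
  have hpr : 1 ≤ p.toReal := by
    rw [← ENNReal.toReal_one]; exact ENNReal.toReal_mono hp' hp
  have hpr0 : 0 < p.toReal := by linarith
  rw [eLpNorm_eq_lintegral_rpow_enorm_toReal hp0 hp', eLpNorm_one_eq_lintegral_enorm,
    one_div, ENNReal.rpow_inv_le_iff hpr0, ENNReal.mul_rpow_of_nonneg _ _ hpr0.le]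
  refine le_trans (lintegral_mono fun x => ?_)
    (lintegral_rpow_lintegral_le (k := fun y => ‖K y‖ₑ) (G := fun x y => ‖G x y‖ₑ) hpr
      hK.enorm hG.enorm ?_)
  · gcongr
    refine (enorm_integral_le_lintegral_enorm _).trans_eq ?_
    simp [enorm_smul]
  · intro y hy
    have h := hA y (by simpa using hy)
    rwa [eLpNorm_eq_lintegral_rpow_enorm_toReal hp0 hp', one_div,
      ENNReal.rpow_inv_le_iff hpr0] at h

/-! ### Convolution with smooth kernels -/

/-- The convolution of a kernel `K` with a function `g`. -/
noncomputable def mollify (K g : E3 → ℝ) (x : E3) : ℝ := ∫ y, K y * g (x - y)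

theorem mollify_eq_convolution (K g : E3 → ℝ) :
    mollify K g = convolution K g (ContinuousLinearMap.lsmul ℝ ℝ) volume := by
  ext x
  simp [mollify, convolution_def]

theorem mollify_eq_swap (K g : E3 → ℝ) (x : E3) : mollify K g x = ∫ y, K (x - y) * g y := by
  rw [mollify_eq_convolution, convolution_lsmul_swap]
  rfl

theorem mollify_congr_ae {K g g' : E3 → ℝ} (h : g =ᵐ[volume] g') : mollify K g = mollify K g' := by
  ext x
  rw [mollify_eq_swap, mollify_eq_swap]
  refine integral_congr_ae ?_
  filter_upwards [h] with y hy
  rw [hy]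

theorem aestronglyMeasurable_shift {F : Type*} [TopologicalSpace F]
    {g : E3 → F} (hg : AEStronglyMeasurable g volume) :
    AEStronglyMeasurable (fun z : E3 × E3 => g (z.1 - z.2)) (volume.prod volume) :=
  hg.comp_quasiMeasurePreserving (quasiMeasurePreserving_sub_of_right_invariant volume volume)

section Kernel

variable {K : E3 → ℝ}

theorem integrable_mollify_integrand (hK : Continuous K) (hKc : HasCompactSupport K) {g : E3 → ℝ}
    (hg : LocallyIntegrable g volume) (x : E3) : Integrable (fun y => K y * g (x - y)) := by
  have := (hKc.convolutionExists_left (ContinuousLinearMap.lsmul ℝ ℝ) hK hg x).integrable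
  simpa using this

theorem integrable_mollify_integrand_swap (hK : Continuous K) (hKc : HasCompactSupport K)
    {g : E3 → ℝ} (hg : LocallyIntegrable g volume) (x : E3) :
    Integrable (fun y => K (x - y) * g y) := by
  have := (hKc.convolutionExists_left (ContinuousLinearMap.lsmul ℝ ℝ) hK hg x).integrable_swap
  simpa using this

theorem contDiff_mollify (hK : ContDiff ℝ ∞ K) (hKc : HasCompactSupport K) {g : E3 → ℝ}
    (hg : LocallyIntegrable g volume) : ContDiff ℝ ∞ (mollify K g) := by
  rw [mollify_eq_convolution]
  exact hKc.contDiff_convolution_left _ hK hg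

theorem hasCompactSupport_mollify (hKc : HasCompactSupport K) {g : E3 → ℝ}
    (hgc : HasCompactSupport g) : HasCompactSupport (mollify K g) := by
  rw [mollify_eq_convolution]
  exact hKc.convolution _ hgc

theorem fderiv_mollify (hK : ContDiff ℝ ∞ K) (hKc : HasCompactSupport K) {g : E3 → ℝ}
    (hg : LocallyIntegrable g volume) (x e : E3) :
    fderiv ℝ (mollify K g) x e = mollify (fun y => fderiv ℝ K y e) g x := by
  have h := hKc.hasFDerivAt_convolution_left (ContinuousLinearMap.lsmul ℝ ℝ)
    (hK.of_le (by exact_mod_cast le_top)) hg x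
  rw [← mollify_eq_convolution] at h
  rw [h.fderiv, ← convolution_flip, ContinuousLinearMap.precompL]
  simp only [ContinuousLinearMap.flip_flip]
  rw [convolution_precompR_apply _ hg (hKc.fderiv ℝ)
    (hK.continuous_fderiv (by simp)), mollify_eq_convolution]
  exact congrFun (convolution_flip (μ := (volume : Measure E3))
    (ContinuousLinearMap.lsmul ℝ ℝ : ℝ →L[ℝ] ℝ →L[ℝ] ℝ)) x

theorem contDiff_fderiv_apply (hK : ContDiff ℝ ∞ K) (e : E3) :
    ContDiff ℝ ∞ (fun y => fderiv ℝ K y e) :=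
  (hK.fderiv_right (m := ∞) (by simp)).clm_apply contDiff_const

theorem hasCompactSupport_fderiv_apply (hKc : HasCompactSupport K) (e : E3) :
    HasCompactSupport (fun y => fderiv ℝ K y e) :=
  hKc.fderiv_apply ℝ e

theorem eLpNorm_mollify_le {p : ℝ≥0∞} (hp : 1 ≤ p) (hp' : p ≠ ⊤)
    (hK : AEStronglyMeasurable K volume) {g : E3 → ℝ} (hg : AEStronglyMeasurable g volume) :
    eLpNorm (mollify K g) p volume ≤ eLpNorm K 1 volume * eLpNorm g p volume := by
  refine eLpNorm_integral_smul_le (G := fun x y => g (x - y)) hp hp' hK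
    (aestronglyMeasurable_shift hg) ?_
  intro y _
  exact (eLpNorm_comp_measurePreserving hg (measurePreserving_sub_right volume y)).le

theorem memLp_mollify {p : ℝ≥0∞} (hp : 1 ≤ p) (hp' : p ≠ ⊤) (hK : ContDiff ℝ ∞ K)
    (hKc : HasCompactSupport K) {g : E3 → ℝ} (hg : MemLp g p volume) :
    MemLp (mollify K g) p volume :=
  ⟨(contDiff_mollify hK hKc (hg.locallyIntegrable hp)).continuous.aestronglyMeasurable,
    (eLpNorm_mollify_le hp hp' hK.continuous.aestronglyMeasurable hg.1).trans_lt
      (ENNReal.mul_lt_top (memLp_one_iff_integrable.2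
        (hK.continuous.integrable_of_hasCompactSupport hKc)).2 hg.2)⟩

theorem abs_integral_mul_le {f g : E3 → ℝ} (hf : MemLp f 2 volume) (hg : MemLp g 2 volume) :
    |∫ x, f x * g x| ≤ (eLpNorm f 2 volume).toReal * (eLpNorm g 2 volume).toReal := by
  have h := norm_inner_le_norm (𝕜 := ℝ) (hg.toLp g) (hf.toLp f)
  rw [L2.inner_def, Lp.norm_toLp, Lp.norm_toLp, mul_comm] at h
  refine le_trans (le_of_eq ?_) h
  rw [Real.norm_eq_abs]
  congr 1
  refine integral_congr_ae ?_
  filter_upwards [hf.coeFn_toLp, hg.coeFn_toLp] with x h1 h2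
  simp [h1, h2]

theorem abs_mollify_le (hK : MemLp K 2 volume) {g : E3 → ℝ} (hg : MemLp g 2 volume) (x : E3) :
    |mollify K g x| ≤ (eLpNorm K 2 volume).toReal * (eLpNorm g 2 volume).toReal := by
  have hmp : MeasurePreserving (fun y : E3 => x - y) volume volume :=
    Measure.measurePreserving_sub_left volume x
  have := abs_integral_mul_le hK (hg.comp_measurePreserving hmp)
  rw [eLpNorm_comp_measurePreserving hg.1 hmp] at this
  exact this

/-- An even kernel defines a symmetric operator. -/
theorem integral_mul_mollify_comm (hKe : ∀ x, K (-x) = K x) {f g : E3 → ℝ}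
    (h : Integrable (fun z : E3 × E3 => f z.1 * (K (z.1 - z.2) * g z.2)) (volume.prod volume)) :
    ∫ x, f x * mollify K g x = ∫ x, mollify K f x * g x := by
  simp_rw [mollify_eq_swap, ← integral_const_mul, ← integral_mul_const]
  rw [integral_integral_swap h]
  refine integral_congr_ae (.of_forall fun y => integral_congr_ae (.of_forall fun x => ?_))
  show f x * (K (x - y) * g y) = K (y - x) * f x * g y
  rw [← hKe (x - y), neg_sub]
  ring

theorem integrable_kernel_left (hK : Integrable K volume) {f g : E3 → ℝ}
    (hf : Integrable f volume) (hg : AEStronglyMeasurable g volume) {C : ℝ}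
    (hC : ∀ x, |g x| ≤ C) :
    Integrable (fun z : E3 × E3 => f z.1 * (K (z.1 - z.2) * g z.2)) (volume.prod volume) := by
  have h1 : Integrable (fun z : E3 × E3 => f z.1 * K (z.1 - z.2)) (volume.prod volume) := by
    have := (hf.convolution_integrand (ContinuousLinearMap.lsmul ℝ ℝ) hK.comp_neg).swap
    refine this.congr (.of_forall fun z => ?_)
    simp
  have h2 := h1.mul_bdd (g := fun z : E3 × E3 => g z.2) (c := C) hg.comp_snd
    (.of_forall fun z => by simpa using hC z.2)
  refine h2.congr (.of_forall fun z => ?_)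
  simp [mul_assoc]

/-- By `2|f g| ≤ f² + g²`, the integrand is dominated by two convolution integrands of `L¹`
functions. This justifies Fubini when both factors are only in `L²`. -/
theorem integrable_kernel_sq (hK : Integrable K volume) {f g : E3 → ℝ}
    (hf : MemLp f 2 volume) (hg : MemLp g 2 volume) :
    Integrable (fun z : E3 × E3 => f z.1 * (K (z.1 - z.2) * g z.2)) (volume.prod volume) := by
  have h1 : Integrable (fun z : E3 × E3 => f z.1 ^ 2 * K (z.1 - z.2)) (volume.prod volume) := by
    have := (hf.integrable_sq.convolution_integrand (ContinuousLinearMap.lsmul ℝ ℝ)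
      hK.comp_neg).swap
    refine this.congr (.of_forall fun z => ?_)
    simp
  have h2 : Integrable (fun z : E3 × E3 => g z.2 ^ 2 * K (z.1 - z.2)) (volume.prod volume) := by
    have := (hg.integrable_sq.convolution_integrand (ContinuousLinearMap.lsmul ℝ ℝ) hK)
    refine this.congr (.of_forall fun z => ?_)
    simp
  refine (h1.norm.add h2.norm).mono
    (hf.1.comp_fst.mul ((aestronglyMeasurable_shift hK.1).mul hg.1.comp_snd))
    (.of_forall fun z => ?_)
  have h0 := abs_nonneg (K (z.1 - z.2))
  simp only [norm_mul, Pi.add_apply, Real.norm_eq_abs, abs_pow, sq_abs]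
  rw [abs_of_nonneg (add_nonneg (mul_nonneg (sq_nonneg _) h0) (mul_nonneg (sq_nonneg _) h0))]
  nlinarith [mul_nonneg h0 (sq_nonneg (|f z.1| - |g z.2|)), sq_abs (f z.1), sq_abs (g z.2),
    mul_nonneg h0 (sq_nonneg (f z.1)), mul_nonneg h0 (sq_nonneg (g z.2))]

end Kernel

/-- Translations act continuously on `L^p`. -/
theorem tendsto_eLpNorm_shift_sub {p : ℝ≥0∞} [Fact (1 ≤ p)] (hp : p ≠ ⊤) {f : E3 → ℝ}
    (hf : MemLp f p volume) :
    Tendsto (fun y : E3 => eLpNorm (fun x => f (x - y) - f x) p volume) (𝓝 0) (𝓝 0) := by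
  let sh : C(E3, C(E3, E3)) :=
    (ContinuousMap.mk (fun a : E3 × E3 => a.2 - a.1) (by fun_prop)).curry
  have hmp : ∀ y : E3, MeasurePreserving (sh y) volume volume := fun y =>
    measurePreserving_sub_right volume y
  -- Translation is treated as a continuous family of measure preserving maps, which acts
  -- continuously on `L^p` for finite `p`.
  have hc : Continuous fun y : E3 => Lp.compMeasurePreserving (sh y) (hmp y) (hf.toLp f) :=
    continuous_const.compMeasurePreservingLp sh.continuous hmp hp
  have h0 := ((hc.sub continuous_const).enorm).tendsto 0 (f := fun y => ‖Lp.compMeasurePreserving (sh y) (hmp y) (hf.toLp f) - hf.toLp f‖ₑ)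
  have key : ∀ y : E3, ‖Lp.compMeasurePreserving (sh y) (hmp y) (hf.toLp f) - hf.toLp f‖ₑ
      = eLpNorm (fun x => f (x - y) - f x) p volume := by
    intro y
    rw [Lp.enorm_def]
    refine eLpNorm_congr_ae ?_
    filter_upwards [Lp.coeFn_sub (Lp.compMeasurePreserving (sh y) (hmp y) (hf.toLp f))
      (hf.toLp f), Lp.coeFn_compMeasurePreserving (hf.toLp f) (hmp y), hf.coeFn_toLp,
      (hmp y).quasiMeasurePreserving.ae_eq_comp hf.coeFn_toLp] with x h1 h2 h3 h4
    rw [h1, Pi.sub_apply, h2, h3, h4]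
    rfl
  simp only [key] at h0
  simpa using h0

theorem mollify_mollify {K L : E3 → ℝ} (hK : Continuous K) (hKc : HasCompactSupport K)
    (hL : Continuous L) (hLc : HasCompactSupport L) {g : E3 → ℝ}
    (hg : LocallyIntegrable g volume) :
    mollify (mollify K L) g = mollify K (mollify L g) := by
  ext x
  simp only [mollify_eq_convolution]
  have hLn := hLc.norm
  have hgn : LocallyIntegrable (fun x => ‖g x‖) volume := fun y =>
    (hg y).norm
  refine convolution_assoc (L := ContinuousLinearMap.lsmul ℝ ℝ)
    (L₂ := ContinuousLinearMap.lsmul ℝ ℝ) (L₃ := ContinuousLinearMap.lsmul ℝ ℝ)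
    (L₄ := ContinuousLinearMap.lsmul ℝ ℝ) (by intros; simp [mul_assoc])
    hK.aestronglyMeasurable hL.aestronglyMeasurable hg.aestronglyMeasurable
    (.of_forall fun y => hKc.convolutionExists_left _ hK hL.locallyIntegrable y)
    (.of_forall fun y => hLn.convolutionExists_left _ hL.norm hgn y)
    (hKc.norm.convolutionExists_left _ hK.norm ?_ x)
  exact (hLn.continuous_convolution_left _ hL.norm hgn).locallyIntegrable

theorem mollify_neg_of_even {K L : E3 → ℝ} (hK : ∀ x, K (-x) = K x) (hL : ∀ x, L (-x) = L x)
    (x : E3) : mollify K L (-x) = mollify K L x := by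
  simp only [mollify_eq_convolution]
  exact convolution_neg_of_neg_eq (ContinuousLinearMap.lsmul ℝ ℝ : ℝ →L[ℝ] ℝ →L[ℝ] ℝ)
    (.of_forall hK) (.of_forall hL)

/-- If `∫ K = 1` then `K ⋆ f - f` is an average of increments of `f`. -/
theorem mollify_sub_self {K : E3 → ℝ} (hK : Continuous K) (hKc : HasCompactSupport K)
    (hK1 : ∫ x, K x = 1) {f : E3 → ℝ} (hf : LocallyIntegrable f volume) (x : E3) :
    mollify K f x - f x = ∫ y, K y * (f (x - y) - f x) := by
  simp_rw [mul_sub]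
  rw [integral_sub (integrable_mollify_integrand hK hKc hf x)
    ((hK.integrable_of_hasCompactSupport hKc).mul_const _), integral_mul_const, hK1, one_mul]
  rfl

/-- If `∫ K = 0` then `K ⋆ f` is an average of increments of `f`. -/
theorem mollify_eq_increment {K : E3 → ℝ} (hK : Continuous K) (hKc : HasCompactSupport K)
    (hK0 : ∫ x, K x = 0) {f : E3 → ℝ} (hf : LocallyIntegrable f volume) (x : E3) :
    mollify K f x = ∫ y, K y * (f (x - y) - f x) := by
  simp_rw [mul_sub]
  rw [integral_sub (integrable_mollify_integrand hK hKc hf x)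
    ((hK.integrable_of_hasCompactSupport hKc).mul_const _), integral_mul_const, hK0, zero_mul,
    sub_zero]
  rfl

theorem aestronglyMeasurable_increment {f : E3 → ℝ} (hf : AEStronglyMeasurable f volume) :
    AEStronglyMeasurable (fun z : E3 × E3 => f (z.1 - z.2) - f z.1) (volume.prod volume) :=
  (aestronglyMeasurable_shift hf).sub hf.comp_fst

/-- An `L^p` bound for averages of increments. -/
theorem eLpNorm_integral_increment_le {p : ℝ≥0∞} (hp : 1 ≤ p) (hp' : p ≠ ⊤) {K : E3 → ℝ}
    (hK : AEStronglyMeasurable K volume) {f : E3 → ℝ} (hf : AEStronglyMeasurable f volume)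
    {A : ℝ≥0∞} (hA : ∀ y, K y ≠ 0 → eLpNorm (fun x => f (x - y) - f x) p volume ≤ A) :
    eLpNorm (fun x => ∫ y, K y * (f (x - y) - f x)) p volume ≤ eLpNorm K 1 volume * A :=
  eLpNorm_integral_smul_le (G := fun x y => f (x - y) - f x) hp hp' hK
    (aestronglyMeasurable_increment hf) hA

/-! ### Dilations and the standard mollifiers -/

/-- `ℓ`-fold `L¹`-normalized dilation in `ℝ³`. -/
noncomputable def dilate {F : Type*} [NormedAddCommGroup F] [NormedSpace ℝ F] (l : ℝ)
    (K : E3 → F) (x : E3) : F := l ^ 3 • K (l • x)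

theorem integral_dilate {F : Type*} [NormedAddCommGroup F] [NormedSpace ℝ F] {l : ℝ} (hl : 0 < l)
    (K : E3 → F) : ∫ x, dilate l K x = ∫ x, K x := by
  simp only [dilate]
  rw [integral_smul, Measure.integral_comp_smul]
  simp only [finrank_euclideanSpace, Fintype.card_fin]
  rw [abs_of_pos (by positivity), smul_smul, mul_inv_cancel₀ (by positivity), one_smul]

theorem lintegral_comp_smul_three {l : ℝ} (hl : 0 < l) (f : E3 → ℝ≥0∞) :
    ∫⁻ x, f (l • x) = ENNReal.ofReal (l ^ 3)⁻¹ * ∫⁻ x, f x := by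
  have h := lintegral_map_equiv (μ := (volume : Measure E3)) f
    (Homeomorph.smulOfNeZero l hl.ne' : E3 ≃ₜ E3).toMeasurableEquiv
  have h2 : Measure.map (Homeomorph.smulOfNeZero l hl.ne' : E3 ≃ₜ E3).toMeasurableEquiv
      (volume : Measure E3) = ENNReal.ofReal (l ^ 3)⁻¹ • volume := by
    have := Measure.map_addHaar_smul (volume : Measure E3) hl.ne'
    rw [finrank_euclideanSpace, Fintype.card_fin, abs_of_pos (by positivity)] at this
    exact this
  rw [h2, lintegral_smul_measure] at h
  exact h.symm

theorem eLpNorm_one_dilate {F : Type*} [NormedAddCommGroup F] [NormedSpace ℝ F] {l : ℝ}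
    (hl : 0 < l) (K : E3 → F) : eLpNorm (dilate l K) 1 volume = eLpNorm K 1 volume := by
  simp only [eLpNorm_one_eq_lintegral_enorm, dilate, enorm_smul]
  rw [lintegral_const_mul' _ _ (by simp), lintegral_comp_smul_three hl (fun x => ‖K x‖ₑ),
    ← mul_assoc, Real.enorm_of_nonneg (by positivity), ← ENNReal.ofReal_mul (by positivity),
    mul_inv_cancel₀ (by positivity), ENNReal.ofReal_one, one_mul]

/-- A fixed radial bump function. -/
noncomputable def baseBump : ContDiffBump (0 : E3) := ⟨1 / 4, 1 / 2, by norm_num, by norm_num⟩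

/-- The standard mollifier at scale `2⁻ⁿ`. -/
noncomputable def mollifier (n : ℕ) : E3 → ℝ := dilate (2 ^ n) (baseBump.normed volume)

theorem contDiff_mollifier (n : ℕ) : ContDiff ℝ ∞ (mollifier n) := by
  have h : ContDiff ℝ ∞ (baseBump.normed (volume : Measure E3)) := baseBump.contDiff_normed
  unfold mollifier dilate
  fun_prop

theorem hasCompactSupport_mollifier (n : ℕ) : HasCompactSupport (mollifier n) := by
  have h : HasCompactSupport (baseBump.normed (volume : Measure E3)) :=
    baseBump.hasCompactSupport_normed
  have h2 := h.comp_smul (c := (2 : ℝ) ^ n) (by positivity)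
  exact h2.smul_left (f := fun _ => ((2 : ℝ) ^ n) ^ 3)

theorem mollifier_neg (n : ℕ) (x : E3) : mollifier n (-x) = mollifier n x := by
  simp only [mollifier, dilate, smul_neg]
  rw [ContDiffBump.normed_neg]

theorem mollifier_nonneg (n : ℕ) (x : E3) : 0 ≤ mollifier n x :=
  smul_nonneg (by positivity) (baseBump.nonneg_normed _)

theorem integral_mollifier (n : ℕ) : ∫ x, mollifier n x = 1 := by
  rw [mollifier, integral_dilate (by positivity), baseBump.integral_normed]

theorem eLpNorm_one_mollifier (n : ℕ) : eLpNorm (mollifier n) 1 volume = 1 := by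
  rw [eLpNorm_one_eq_lintegral_enorm]
  simp_rw [Real.enorm_of_nonneg (mollifier_nonneg n _)]
  rw [← ofReal_integral_eq_lintegral_ofReal
    ((contDiff_mollifier n).continuous.integrable_of_hasCompactSupport
      (hasCompactSupport_mollifier n)) (.of_forall (mollifier_nonneg n)), integral_mollifier,
    ENNReal.ofReal_one]

theorem norm_le_of_mollifier_ne_zero {n : ℕ} {x : E3} (hx : mollifier n x ≠ 0) :
    ‖x‖ ≤ (2 ^ n)⁻¹ := by
  have h1 : (2 : ℝ) ^ n • x ∈ Function.support (baseBump.normed volume) := by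
    intro h
    exact hx (by simp [mollifier, dilate, h])
  rw [ContDiffBump.support_normed_eq, mem_ball_zero_iff, norm_smul] at h1
  have h2 : baseBump.rOut = 1 / 2 := rfl
  rw [h2, Real.norm_of_nonneg (by positivity)] at h1
  rw [← one_div, le_div_iff₀ (by positivity)]
  linarith

theorem fderiv_mollifier_apply (n : ℕ) (x e : E3) :
    fderiv ℝ (mollifier n) x e
      = 2 ^ n * dilate (2 ^ n) (fun y => fderiv ℝ (baseBump.normed volume) y e) x := by
  have hd : Differentiable ℝ (baseBump.normed (volume : Measure E3)) :=
    baseBump.contDiff_normed.differentiable (n := ∞) (by simp)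
  have h : HasFDerivAt (mollifier n) (((2 : ℝ) ^ n) ^ 3 •
      ((fderiv ℝ (baseBump.normed volume) ((2 : ℝ) ^ n • x)).comp
        ((2 : ℝ) ^ n • ContinuousLinearMap.id ℝ E3))) x := by
    have h1 : HasFDerivAt (fun y : E3 => (2 : ℝ) ^ n • y)
        ((2 : ℝ) ^ n • ContinuousLinearMap.id ℝ E3) x :=
      ((2 : ℝ) ^ n • ContinuousLinearMap.id ℝ E3).hasFDerivAt
    exact ((hd _).hasFDerivAt.comp x h1).const_smul (((2 : ℝ) ^ n) ^ 3)
  rw [h.fderiv]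
  simp [dilate]
  ring

theorem norm_le_of_fderiv_mollifier_ne_zero {n : ℕ} {x e : E3}
    (hx : fderiv ℝ (mollifier n) x e ≠ 0) : ‖x‖ ≤ (2 ^ n)⁻¹ := by
  have h1 : x ∈ tsupport (mollifier n) := by
    refine support_fderiv_subset ℝ ?_
    intro h
    exact hx (by simp [h])
  have h2 : tsupport (mollifier n) ⊆ Metric.closedBall 0 (2 ^ n)⁻¹ := by
    refine closure_minimal (fun y hy => ?_) Metric.isClosed_closedBall
    simpa using norm_le_of_mollifier_ne_zero hy
  simpa using h2 h1

/-- The constant in the gradient bound for the mollifiers. -/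
noncomputable def gradConst : ℝ≥0∞ :=
  ∑ i : Fin 3, eLpNorm (fun y => fderiv ℝ (baseBump.normed volume) y (EuclideanSpace.single i 1)) 1
    (volume : Measure E3)

theorem gradConst_ne_top : gradConst ≠ ⊤ := by
  refine ENNReal.sum_ne_top.2 fun i _ => ?_
  have h1 : ContDiff ℝ ∞ (baseBump.normed (volume : Measure E3)) := baseBump.contDiff_normed
  exact (memLp_one_iff_integrable.2 ((contDiff_fderiv_apply h1
    _).continuous.integrable_of_hasCompactSupport
    (hasCompactSupport_fderiv_apply baseBump.hasCompactSupport_normed _))).2.ne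

/-- Differentiating the dilated bump brings out one factor `2ⁿ`, and the remaining dilation
preserves the `L¹` norm. -/
theorem eLpNorm_one_fderiv_mollifier_le (n : ℕ) (i : Fin 3) :
    eLpNorm (fun y => fderiv ℝ (mollifier n) y (EuclideanSpace.single i 1)) 1 volume
      ≤ 2 ^ n * gradConst := by
  have : (fun y => fderiv ℝ (mollifier n) y (EuclideanSpace.single i 1)) = (2 : ℝ) ^ n •
      dilate (2 ^ n) (fun y => fderiv ℝ (baseBump.normed volume) y (EuclideanSpace.single i 1)) := by
    ext y
    rw [fderiv_mollifier_apply]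
    rfl
  rw [this, eLpNorm_const_smul, eLpNorm_one_dilate (by positivity)]
  have h2 : ‖(2 : ℝ) ^ n‖ₑ = 2 ^ n := by
    rw [enorm_pow]
    congr 1
    rw [Real.enorm_of_nonneg (by norm_num)]
    simp
  rw [h2]
  gcongr
  exact Finset.single_le_sum (f := fun i => eLpNorm (fun y => fderiv ℝ (baseBump.normed volume) y
    (EuclideanSpace.single i 1)) 1 (volume : Measure E3)) (fun _ _ => zero_le) (Finset.mem_univ i)

/-- Integration by parts against the constant `1`. The vanishing mean turns the gradient of a
mollification into an average of increments. -/
theorem integral_fderiv_eq_zero {K : E3 → ℝ} (hK : ContDiff ℝ ∞ K) (hKc : HasCompactSupport K)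
    (e : E3) : ∫ x, fderiv ℝ K x e = 0 := by
  have h1 := (contDiff_fderiv_apply hK e).continuous.integrable_of_hasCompactSupport
    (μ := (volume : Measure E3)) (hasCompactSupport_fderiv_apply hKc e)
  have h2 := hK.continuous.integrable_of_hasCompactSupport (μ := (volume : Measure E3)) hKc
  have h := integral_mul_fderiv_eq_neg_fderiv_mul_of_integrable (μ := (volume : Measure E3))
    (f := fun _ => (1 : ℝ)) (g := K) (v := e) (by simp) (by simpa using h1) (by simpa using h2)
    (by simp) (fun x _ => hK.differentiable (by simp) x)
  simpa using h

/-- The error is an average, with a kernel of unit mass, of increments over distances at most `2⁻ⁿ`;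
these are small by continuity of translations. -/
theorem tendsto_eLpNorm_mollify_sub {f : E3 → ℝ} (hf : MemLp f 2 volume) :
    Tendsto (fun n => eLpNorm (fun x => mollify (mollifier n) f x - f x) 2 volume)
      atTop (𝓝 0) := by
  have h := tendsto_eLpNorm_shift_sub (by simp) hf
  rw [ENNReal.tendsto_nhds_zero] at h ⊢
  intro ε hε
  obtain ⟨δ, hδ, hδ'⟩ := Metric.eventually_nhds_iff.1 (h ε hε)
  have ht : Tendsto (fun n : ℕ => ((2 : ℝ) ^ n)⁻¹) atTop (𝓝 0) :=
    tendsto_inv_atTop_zero.comp (tendsto_pow_atTop_atTop_of_one_lt one_lt_two)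
  filter_upwards [ht.eventually_lt_const hδ] with n hn
  have hK := contDiff_mollifier n
  have hKc := hasCompactSupport_mollifier n
  have e : (fun x => mollify (mollifier n) f x - f x)
      = fun x => ∫ y, mollifier n y * (f (x - y) - f x) := by
    ext x
    exact mollify_sub_self hK.continuous hKc (integral_mollifier n)
      (hf.locallyIntegrable (by norm_num)) x
  rw [e]
  refine (eLpNorm_integral_increment_le (by norm_num) (by simp) hK.continuous.aestronglyMeasurable
    hf.1 (A := ε) fun y hy => hδ' ?_).trans ?_
  · rw [dist_zero_right]
    exact (norm_le_of_mollifier_ne_zero hy).trans_lt hn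
  · rw [eLpNorm_one_mollifier, one_mul]

/-! ### Weakly continuous curves in a Hilbert space -/

/-- Distinct orthonormal vectors are at distance `√2`, so the balls of radius `1/2` around them are
disjoint, and a separable space holds only countably many disjoint open balls. -/
theorem countable_of_orthonormal {H : Type*} [NormedAddCommGroup H] [InnerProductSpace ℝ H]
    [TopologicalSpace.SeparableSpace H] {ι : Type*} {b : ι → H} (hb : Orthonormal ℝ b) :
    Countable ι := by
  rw [← Set.countable_univ_iff]
  refine Set.PairwiseDisjoint.countable_of_isOpen (s := fun i => Metric.ball (b i) (1 / 2)) ?_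
    (fun _ _ => Metric.isOpen_ball) (fun i _ => ⟨b i, by simp⟩)
  intro i _ j _ hij
  refine Metric.ball_disjoint_ball ?_
  rw [dist_eq_norm]
  have h1 : ‖b i - b j‖ ^ 2 = 2 := by
    rw [norm_sub_sq_real, hb.1 i, hb.1 j, hb.2 hij]
    norm_num
  nlinarith [norm_nonneg (b i - b j)]

section WeaklyContinuous

variable {H : Type*} [NormedAddCommGroup H] [InnerProductSpace ℝ H] [CompleteSpace H]
  {T : ℝ} {u : ℝ → H}

/-- Uniform boundedness for the functionals `⟨u t, ·⟩`: each orbit is continuous on a compact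
interval, hence bounded. -/
theorem exists_norm_le_of_weaklyContinuous
    (hu : ∀ v : H, ContinuousOn (fun t => inner ℝ (u t) v) (Icc 0 T)) :
    ∃ M : ℝ, 0 ≤ M ∧ ∀ t ∈ Icc 0 T, ‖u t‖ ≤ M := by
  obtain ⟨C, hC⟩ := banach_steinhaus (g := fun t : Icc (0 : ℝ) T => innerSL ℝ (u t)) (by
    intro v
    obtain ⟨C, hC⟩ := isCompact_Icc.exists_bound_of_continuousOn (hu v)
    exact ⟨C, fun t => by simpa using hC t t.2⟩)
  refine ⟨max C 0, le_max_right _ _, fun t ht => ?_⟩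
  have := hC ⟨t, ht⟩
  rw [innerSL_apply_norm] at this
  exact this.trans (le_max_left _ _)

/-- Finite partial sums of the expansion in a Hilbert basis are continuous in time and converge
pointwise in norm; separability makes the net of finite sets countably generated. -/
theorem aestronglyMeasurable_of_weaklyContinuous [TopologicalSpace.SeparableSpace H]
    (hu : ∀ v : H, ContinuousOn (fun t => inner ℝ (u t) v) (Icc 0 T)) :
    AEStronglyMeasurable u (volume.restrict (Icc 0 T)) := by
  obtain ⟨w, b, -⟩ := exists_hilbertBasis ℝ H
  have : Countable w := countable_of_orthonormal b.orthonormal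
  refine aestronglyMeasurable_of_tendsto_ae (atTop : Filter (Finset w))
    (f := fun s t => ∑ i ∈ s, inner ℝ (u t) (b i) • b i) (fun s => ?_) (.of_forall fun t => ?_)
  · refine ContinuousOn.aestronglyMeasurable ?_ measurableSet_Icc
    exact continuousOn_finsetSum _ fun i _ => (hu (b i)).smul continuousOn_const
  · have := b.hasSum_repr (u t)
    refine this.congr fun s => Finset.sum_congr rfl fun i _ => ?_
    exact congrArg (· • (b i : H)) ((b.repr_apply_apply (u t) i).trans (real_inner_comm _ _))

/-- The energy balance for a weakly continuous curve whose increments, tested against the curve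
itself, are given by a quadratic expression. -/
theorem energy_balance_of_weaklyContinuous
    (hu : ∀ v : H, ContinuousOn (fun t => inner ℝ (u t) v) (Icc 0 T))
    (hum : AEStronglyMeasurable u (volume.restrict (Icc 0 T))) {M : ℝ}
    (hM : ∀ t ∈ Icc 0 T, ‖u t‖ ≤ M) {F : H → H → ℝ} (hF : ∀ a b, F a b = F b a)
    {q : H → H →L[ℝ] ℝ} (hq : Continuous q) {C : ℝ} (hC : ∀ a, ‖q a‖ ≤ C * ‖a‖ ^ 2)
    (h : ∀ t ∈ Icc 0 T, ∀ τ ∈ Icc 0 T,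
      F (u t) (u τ) - F (u 0) (u τ) = ∫ s in (0 : ℝ)..t, q (u s) (u τ))
    {t : ℝ} (ht : t ∈ Icc 0 T) :
    F (u t) (u t) - F (u 0) (u 0) = 2 * ∫ s in (0 : ℝ)..t, q (u s) (u s) := by
  rcases eq_or_lt_of_le ht.1 with h0 | h0
  · simp [← h0]
  have hM0 : 0 ≤ M := (norm_nonneg _).trans (hM t ht)
  have hqm : AEStronglyMeasurable (fun s => q (u s)) (volume.restrict (Icc 0 T)) :=
    hq.comp_aestronglyMeasurable hum
  have hqb : ∀ s ∈ Icc 0 T, ‖q (u s)‖ ≤ |C| * M ^ 2 := fun s hs =>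
    (hC _).trans (mul_le_mul (le_abs_self C) (by gcongr; exact hM s hs) (by positivity)
      (abs_nonneg C))
  have hqa : ∀ {v : ℝ → H}, AEStronglyMeasurable v (volume.restrict (Icc 0 T)) →
      AEStronglyMeasurable (fun s => q (u s) (v s)) (volume.restrict (Icc 0 T)) := fun hv =>
    isBoundedBilinearMap_apply.continuous.comp_aestronglyMeasurable (hqm.prodMk hv)
  have hqab : ∀ s ∈ Icc 0 T, ∀ τ ∈ Icc 0 T, ‖q (u s) (u τ)‖ ≤ |C| * M ^ 2 * M :=
    fun s hs τ hτ => (ContinuousLinearMap.le_opNorm _ _).trans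
      (mul_le_mul (hqb s hs) (hM τ hτ) (norm_nonneg _) (by positivity))
  have hint : ∀ τ ∈ Icc 0 T, ∀ a ∈ Icc 0 T, ∀ b ∈ Icc 0 T,
      IntervalIntegrable (fun s => q (u s) (u τ)) volume a b := by
    intro τ hτ a ha b hb
    have h1 : IntegrableOn (fun s => q (u s) (u τ)) (Icc 0 T) :=
      Integrable.of_bound (hqa aestronglyMeasurable_const) (|C| * M ^ 2 * M)
        ((ae_restrict_iff' measurableSet_Icc).2 (.of_forall fun s hs => hqab s hs τ hτ))
    exact (h1.mono_set (uIcc_subset_Icc ha hb)).intervalIntegrable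
  have hstep : ∀ τ ∈ Icc 0 T, ∀ a ∈ Icc 0 T, ∀ b ∈ Icc 0 T,
      ∫ s in a..b, q (u s) (u τ) = F (u b) (u τ) - F (u a) (u τ) := by
    intro τ hτ a ha b hb
    have h00 : (0 : ℝ) ∈ Icc 0 T := ⟨le_rfl, ht.1.trans ht.2⟩
    rw [← intervalIntegral.integral_interval_sub_left (hint τ hτ 0 h00 b hb)
      (hint τ hτ 0 h00 a ha), ← h b hb τ hτ, ← h a ha τ hτ]
    ring
  -- `lo N s` and `hi N s` are the nodes on either side of `s` in the partition of `[0, t]` into `N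
  -- + 1` equal cells. `G` tests the equation at time `s` against the curve frozen at both nodes.
  let lo : ℕ → ℝ → ℝ := fun N s => ⌊s * (N + 1) / t⌋ * (t / (N + 1))
  let hi : ℕ → ℝ → ℝ := fun N s => (⌊s * (N + 1) / t⌋ + 1) * (t / (N + 1))
  let G : ℕ → ℝ → ℝ := fun N s => q (u s) (u (lo N s)) + q (u s) (u (hi N s))
  have hlo : ∀ N : ℕ, ∀ s, lo N s ≤ s := by
    intro N s
    have h1 := Int.floor_le (s * (N + 1) / t)
    calc lo N s ≤ s * (N + 1) / t * (t / (N + 1)) := by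
          exact mul_le_mul_of_nonneg_right h1 (by positivity)
      _ = s := by field_simp
  have hlo' : ∀ N : ℕ, ∀ s, s - t / (N + 1) ≤ lo N s := by
    intro N s
    have h1 := (Int.lt_floor_add_one (s * (N + 1) / t)).le
    have h2 : s = s * (N + 1) / t * (t / (N + 1)) := by field_simp
    have h3 := mul_le_mul_of_nonneg_right h1 (by positivity : 0 ≤ t / ((N : ℝ) + 1))
    rw [← h2, add_mul, one_mul] at h3
    simp only [lo]
    linarith
  have hhi : ∀ N s, hi N s = lo N s + t / (N + 1) := fun N s => by simp only [lo, hi]; ring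
  have hlo0 : ∀ N : ℕ, ∀ s, 0 ≤ s → 0 ≤ lo N s := fun N s hs =>
    mul_nonneg (by exact_mod_cast Int.floor_nonneg.2 (by positivity)) (by positivity)
  have hhi1 : ∀ N : ℕ, ∀ s, s < t → hi N s ≤ t := by
    intro N s hs
    have h1 : ⌊s * (N + 1) / t⌋ < (N + 1 : ℤ) := by
      rw [Int.floor_lt, div_lt_iff₀ h0]
      push_cast
      nlinarith [(by positivity : (0 : ℝ) < N + 1)]
    have h2 : ((⌊s * (N + 1) / t⌋ : ℤ) : ℝ) + 1 ≤ N + 1 := by exact_mod_cast h1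
    calc hi N s ≤ (N + 1) * (t / (N + 1)) := mul_le_mul_of_nonneg_right h2 (by positivity)
      _ = t := by field_simp
  have hloI : ∀ N s, 0 ≤ s → s < t → lo N s ∈ Icc 0 T := fun N s hs hs' =>
    ⟨hlo0 N s hs, (hlo N s).trans (hs'.le.trans ht.2)⟩
  have hhiI : ∀ N s, 0 ≤ s → s < t → hi N s ∈ Icc 0 T := fun N s hs hs' =>
    ⟨by rw [hhi]; have := hlo0 N s hs; positivity, (hhi1 N s hs').trans ht.2⟩
  have hsub : Ioc 0 t ⊆ Icc 0 T := fun s hs => ⟨hs.1.le, hs.2.trans ht.2⟩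
  have hfm : ∀ N : ℕ, Measurable fun s : ℝ => ⌊s * (N + 1) / t⌋ := fun N =>
    Int.measurable_floor.comp (by fun_prop)
  -- As functions of `s` these factor through an integer-valued floor, so they are measurable
  -- whatever `u` is.
  have hlom : ∀ N : ℕ, AEStronglyMeasurable (fun s => u (lo N s)) (volume.restrict (Icc 0 T)) :=
    fun N => ((StronglyMeasurable.of_discrete (f := fun k : ℤ => u (k * (t / (N + 1)))
      )).comp_measurable (hfm N)).aestronglyMeasurable
  have hhim : ∀ N : ℕ, AEStronglyMeasurable (fun s => u (hi N s)) (volume.restrict (Icc 0 T)) :=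
    fun N => ((StronglyMeasurable.of_discrete (f := fun k : ℤ => u ((k + 1) * (t / (N + 1)))
      )).comp_measurable (hfm N)).aestronglyMeasurable
  have hGm : ∀ N, AEStronglyMeasurable (G N) (volume.restrict (Icc 0 T)) := fun N =>
    (hqa (hlom N)).add (hqa (hhim N))
  have hGb : ∀ N, ∀ s ∈ Ioo 0 t, ‖G N s‖ ≤ |C| * M ^ 2 * M + |C| * M ^ 2 * M := fun N s hs =>
    (norm_add_le _ _).trans (add_le_add
      (hqab s (hsub (Ioo_subset_Ioc_self hs)) _ (hloI N s hs.1.le hs.2))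
      (hqab s (hsub (Ioo_subset_Ioc_self hs)) _ (hhiI N s hs.1.le hs.2)))
  -- At `s = t` the node `hi N s` lies beyond `t`; this single point is discarded.
  have hae : ∀ᵐ s : ℝ, s ≠ t := by simp [ae_iff, measure_singleton]
  have hGi : ∀ N, IntegrableOn (G N) (Ioc 0 t) := fun N =>
    Integrable.of_bound ((hGm N).mono_measure (Measure.restrict_mono hsub le_rfl))
      (|C| * M ^ 2 * M + |C| * M ^ 2 * M)
      ((ae_restrict_iff' measurableSet_Ioc).2 (by
        filter_upwards [hae] with s hs hs' using hGb N s ⟨hs'.1, lt_of_le_of_ne hs'.2 hs⟩))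
  -- The value does not depend on `N`. Over a cell with end values `a`, `b`, symmetry of `F` gives
  -- `F b b - F a a = (F b b - F a b) + (F b a - F a a)`; the two brackets are the integrals with
  -- the curve frozen at the right and left node, and the cells telescope.
  have hsum : ∀ N, ∫ s in (0 : ℝ)..t, G N s = F (u t) (u t) - F (u 0) (u 0) := by
    intro N
    let a : ℕ → ℝ := fun k => k * (t / (N + 1))
    have ha : ∀ k, k ≤ N + 1 → a k ∈ Icc 0 t := by
      intro k hk
      have hk' : (k : ℝ) ≤ N + 1 := by exact_mod_cast hk
      refine ⟨by positivity, ?_⟩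
      calc a k ≤ (N + 1) * (t / (N + 1)) := mul_le_mul_of_nonneg_right hk' (by positivity)
        _ = t := by field_simp
    have haT : ∀ k, k ≤ N + 1 → a k ∈ Icc 0 T := fun k hk =>
      ⟨(ha k hk).1, (ha k hk).2.trans ht.2⟩
    have hastep : ∀ k, a k ≤ a (k + 1) := fun k =>
      mul_le_mul_of_nonneg_right (by push_cast; linarith) (by positivity)
    have e1 : a 0 = 0 := by simp [a]
    have e2 : a (N + 1) = t := by simp only [a]; push_cast; field_simp
    have hii : ∀ k < N + 1, IntervalIntegrable (G N) volume (a k) (a (k + 1)) := by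
      intro k hk
      rw [intervalIntegrable_iff_integrableOn_Ioc_of_le (hastep k)]
      exact (hGi N).mono_set (Ioc_subset_Ioc (ha k hk.le).1 (ha (k + 1) hk).2)
    have hs := intervalIntegral.sum_integral_adjacent_intervals hii
    rw [e1, e2] at hs
    rw [← hs]
    have hk : ∀ k ∈ Finset.range (N + 1), ∫ s in a k..a (k + 1), G N s
        = F (u (a (k + 1))) (u (a (k + 1))) - F (u (a k)) (u (a k)) := by
      intro k hk
      have hk' : k < N + 1 := Finset.mem_range.1 hk
      have hT1 := haT k hk'.le
      have hT2 := haT (k + 1) hk'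
      have : ∫ s in a k..a (k + 1), G N s
          = ∫ s in a k..a (k + 1), (q (u s) (u (a k)) + q (u s) (u (a (k + 1)))) := by
        refine intervalIntegral.integral_congr_ae ?_
        have hne : ∀ᵐ s : ℝ, s ≠ a (k + 1) := by simp [ae_iff, measure_singleton]
        filter_upwards [hne] with s hs hs'
        rw [uIoc_of_le (hastep k)] at hs'
        have hlt := lt_of_le_of_ne hs'.2 hs
        -- Inside the `k`-th cell the two nodes are constant, equal to its endpoints.
        have hfl : ⌊s * (N + 1) / t⌋ = (k : ℤ) := by
          rw [Int.floor_eq_iff]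
          have p1 : (0 : ℝ) < t / (N + 1) := by positivity
          have p2 : s = s * (N + 1) / t * (t / (N + 1)) := by field_simp
          have p3 : a k < s := hs'.1
          have p4 := hlt
          rw [p2] at p3 p4
          have p5 := lt_of_mul_lt_mul_right p3 p1.le
          have p6 := lt_of_mul_lt_mul_right p4 p1.le
          push_cast at p6 ⊢
          exact ⟨p5.le, p6⟩
        simp only [G, lo, hi, hfl, a]
        push_cast
        rfl
      rw [this, intervalIntegral.integral_add (hint _ hT1 _ hT1 _ hT2) (hint _ hT2 _ hT1 _ hT2),
        hstep _ hT1 _ hT1 _ hT2, hstep _ hT2 _ hT1 _ hT2, hF (u (a (k + 1))) (u (a k))]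
      ring
    rw [Finset.sum_congr rfl hk, Finset.sum_range_sub (fun k => F (u (a k)) (u (a k))), e1, e2]
  have hlim : Tendsto (fun N => ∫ s in (0 : ℝ)..t, G N s) atTop
      (𝓝 (∫ s in (0 : ℝ)..t, (q (u s) (u s) + q (u s) (u s)))) := by
    refine intervalIntegral.tendsto_integral_filter_of_dominated_convergence
      (fun _ => |C| * M ^ 2 * M + |C| * M ^ 2 * M) (.of_forall fun N => ?_)
      (.of_forall fun N => ?_) intervalIntegrable_const ?_
    · rw [uIoc_of_le h0.le]
      exact (hGm N).mono_measure (Measure.restrict_mono hsub le_rfl)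
    · filter_upwards [hae] with s hs hs'
      rw [uIoc_of_le h0.le] at hs'
      exact hGb N s ⟨hs'.1, lt_of_le_of_ne hs'.2 hs⟩
    · filter_upwards [hae] with s hs hs'
      rw [uIoc_of_le h0.le] at hs'
      have hs1 := lt_of_le_of_ne hs'.2 hs
      -- The Riesz representative of `q (u s)` is a fixed vector, so weak continuity is enough here.
      have hcont : ContinuousWithinAt (fun τ => q (u s) (u τ)) (Icc 0 T) s := by
        have h1 := hu ((InnerProductSpace.toDual ℝ H).symm (q (u s))) s (hsub hs')
        refine h1.congr (fun τ _ => ?_) ?_ <;>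
          rw [real_inner_comm, InnerProductSpace.toDual_symm_apply]
      have hinv : Tendsto (fun N : ℕ => t / ((N : ℝ) + 1)) atTop (𝓝 0) := by
        have := (tendsto_one_div_add_atTop_nhds_zero_nat (𝕜 := ℝ)).const_mul t
        simpa [div_eq_mul_inv] using this
      have hl : Tendsto (fun N => lo N s) atTop (𝓝 s) :=
        tendsto_of_tendsto_of_tendsto_of_le_of_le (by simpa using tendsto_const_nhds.sub hinv)
          tendsto_const_nhds (fun N => hlo' N s) (fun N => hlo N s)
      have hh : Tendsto (fun N => hi N s) atTop (𝓝 s) := by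
        simp_rw [hhi]
        simpa using hl.add hinv
      exact (hcont.tendsto.comp (tendsto_nhdsWithin_iff.2
          ⟨hl, .of_forall fun N => hloI N s hs'.1.le hs1⟩)).add
        (hcont.tendsto.comp (tendsto_nhdsWithin_iff.2
          ⟨hh, .of_forall fun N => hhiI N s hs'.1.le hs1⟩))
  simp_rw [hsum] at hlim
  rw [tendsto_nhds_unique tendsto_const_nhds hlim, ← intervalIntegral.integral_const_mul]
  simp_rw [two_mul]

end WeaklyContinuous

/-! ### Divergence-free test fields and their density -/

/-- The `i`-th partial derivative of a scalar function. -/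
noncomputable def partialD (i : Fin 3) (f : E3 → ℝ) (x : E3) : ℝ :=
  fderiv ℝ f x (EuclideanSpace.single i 1)

theorem contDiff_partialD {f : E3 → ℝ} (hf : ContDiff ℝ ∞ f) (i : Fin 3) :
    ContDiff ℝ ∞ (partialD i f) :=
  contDiff_fderiv_apply hf _

theorem hasCompactSupport_partialD {f : E3 → ℝ} (hf : HasCompactSupport f) (i : Fin 3) :
    HasCompactSupport (partialD i f) :=
  hasCompactSupport_fderiv_apply hf _

theorem partialD_comm {f : E3 → ℝ} (hf : ContDiff ℝ ∞ f) (i j : Fin 3) :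
    partialD i (partialD j f) = partialD j (partialD i f) := by
  ext x
  have hd : DifferentiableAt ℝ (fderiv ℝ f) x :=
    (hf.fderiv_right (m := ∞) (by simp)).differentiable (by simp) x
  have h : ∀ v w : E3, fderiv ℝ (fun y => fderiv ℝ f y v) x w = fderiv ℝ (fderiv ℝ f) x w v := by
    intro v w
    have := hd.hasFDerivAt.clm_apply (hasFDerivAt_const v x)
    rw [this.fderiv]
    simp
  have hs : IsSymmSndFDerivAt ℝ f x :=
    hf.contDiffAt.isSymmSndFDerivAt (by simpa using ENat.LEInfty.out)
  unfold partialD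
  rw [h, h]
  exact hs _ _

theorem fderiv_apply_eq_sum {f : E3 → ℝ} (x v : E3) :
    fderiv ℝ f x v = ∑ i, partialD i f x * v i := by
  have hv : v = ∑ i, v i • EuclideanSpace.single i (1 : ℝ) := by
    ext j
    simp [Finset.sum_apply, Pi.single_apply]
  conv_lhs => rw [hv]
  simp [partialD, mul_comm]

theorem partialD_mollify {K : E3 → ℝ} (hK : ContDiff ℝ ∞ K) (hKc : HasCompactSupport K)
    {g : E3 → ℝ} (hg : LocallyIntegrable g volume) (i : Fin 3) :
    partialD i (mollify K g) = mollify (partialD i K) g := by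
  ext x
  exact fderiv_mollify hK hKc hg x _

/-- The field with prescribed components. -/
noncomputable def ofCoords (W : Fin 3 → E3 → ℝ) (x : E3) : E3 := WithLp.toLp 2 fun i => W i x

theorem contDiff_ofCoords {W : Fin 3 → E3 → ℝ} (hW : ∀ i, ContDiff ℝ ∞ (W i)) :
    ContDiff ℝ ∞ (ofCoords W) :=
  contDiff_euclidean.2 hW

theorem hasCompactSupport_ofCoords {W : Fin 3 → E3 → ℝ} (hW : ∀ i, HasCompactSupport (W i)) :
    HasCompactSupport (ofCoords W) := by
  refine HasCompactSupport.of_support_subset_isCompact (isCompact_iUnion hW) fun x hx => ?_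
  by_contra hx'
  simp only [mem_iUnion, not_exists] at hx'
  refine hx (PiLp.ext fun i => ?_)
  exact image_eq_zero_of_notMem_tsupport (f := W i) (hx' i)

theorem fderiv_field_apply {w : E3 → E3} (hw : Differentiable ℝ w) (x v : E3) (i : Fin 3) :
    fderiv ℝ w x v i = fderiv ℝ (fun y => w y i) x v := by
  have h : HasFDerivAt (fun y => w y i)
      ((EuclideanSpace.proj i : E3 →L[ℝ] ℝ).comp (fderiv ℝ w x)) x :=
    (EuclideanSpace.proj i : E3 →L[ℝ] ℝ).hasFDerivAt.comp x (hw x).hasFDerivAt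
  rw [h.fderiv]
  rfl

theorem divergence_eq_sum {w : E3 → E3} (hw : Differentiable ℝ w) (x : E3) :
    divergence w x = ∑ i, partialD i (fun y => w y i) x :=
  Finset.sum_congr rfl fun i _ => fderiv_field_apply hw x _ i

/-- Divergence-free test fields. -/
structure IsSolenoidalTest (w : E3 → E3) : Prop where
  contDiff : ContDiff ℝ ∞ w
  hasCompactSupport : HasCompactSupport w
  divergence_eq_zero : ∀ x, divergence w x = 0

theorem IsSolenoidalTest.contDiff_coord {w : E3 → E3} (hw : IsSolenoidalTest w) (i : Fin 3) :
    ContDiff ℝ ∞ (fun x => w x i) :=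
  contDiff_euclidean.1 hw.contDiff i

theorem IsSolenoidalTest.hasCompactSupport_coord {w : E3 → E3} (hw : IsSolenoidalTest w)
    (i : Fin 3) : HasCompactSupport (fun x => w x i) :=
  hw.hasCompactSupport.comp_left (g := fun v : E3 => v i) rfl

theorem IsSolenoidalTest.memLp {w : E3 → E3} (hw : IsSolenoidalTest w) : MemLp w 2 volume :=
  hw.contDiff.continuous.memLp_of_hasCompactSupport hw.hasCompactSupport

theorem IsSolenoidalTest.add {w w' : E3 → E3} (hw : IsSolenoidalTest w)
    (hw' : IsSolenoidalTest w') : IsSolenoidalTest (w + w') where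
  contDiff := hw.contDiff.add hw'.contDiff
  hasCompactSupport := hw.hasCompactSupport.add hw'.hasCompactSupport
  divergence_eq_zero x := by
    have h1 := hw.contDiff.differentiable (by simp) x
    have h2 := hw'.contDiff.differentiable (by simp) x
    have := hw.divergence_eq_zero x
    have := hw'.divergence_eq_zero x
    simp only [divergence] at *
    rw [fderiv_add h1 h2]
    simp only [add_apply, PiLp.add_apply, Finset.sum_add_distrib, *, add_zero]

theorem IsSolenoidalTest.smul {w : E3 → E3} (hw : IsSolenoidalTest w) (c : ℝ) :
    IsSolenoidalTest (c • w) where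
  contDiff := contDiff_const.smul hw.contDiff
  hasCompactSupport := hw.hasCompactSupport.smul_left (f := fun _ => c)
  divergence_eq_zero x := by
    have h1 := hw.contDiff.differentiable (by simp) x
    have := hw.divergence_eq_zero x
    simp only [divergence] at *
    rw [fderiv_const_smul h1]
    simp only [smul_apply, PiLp.smul_apply, ← Finset.smul_sum, *, smul_zero]

theorem isSolenoidalTest_zero : IsSolenoidalTest 0 where
  contDiff := contDiff_const
  hasCompactSupport := HasCompactSupport.zero
  divergence_eq_zero x := by simp [divergence, fderiv_zero]

/-- Divergence-free test fields, as a subspace of `L²`. -/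
noncomputable def solenoidalTests : Submodule ℝ (Lp E3 2 (volume : Measure E3)) where
  carrier := {a | ∃ w, IsSolenoidalTest w ∧ a =ᵐ[volume] w}
  add_mem' := by
    rintro a b ⟨w, hw, ha⟩ ⟨w', hw', hb⟩
    exact ⟨w + w', hw.add hw', (Lp.coeFn_add a b).trans (ha.add hb)⟩
  zero_mem' := ⟨0, isSolenoidalTest_zero, Lp.coeFn_zero _ _ _⟩
  smul_mem' := by
    rintro c a ⟨w, hw, ha⟩
    exact ⟨c • w, hw.smul c, (Lp.coeFn_smul c a).trans (ha.const_smul c)⟩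

/-- The `curl curl` of `η` times the `k`-th basis vector. -/
noncomputable def curlCurl (k : Fin 3) (η : E3 → ℝ) : E3 → E3 :=
  ofCoords fun i x => partialD i (partialD k η) x
    - if i = k then ∑ l, partialD l (partialD l η) x else 0

theorem partialD_sub {f g : E3 → ℝ} (hf : ContDiff ℝ ∞ f) (hg : ContDiff ℝ ∞ g) (i : Fin 3)
    (x : E3) : partialD i (fun y => f y - g y) x = partialD i f x - partialD i g x := by
  unfold partialD
  rw [fderiv_fun_sub (hf.differentiable (by simp) x) (hg.differentiable (by simp) x)]
  rfl

/-- The field is `∇∂_k η - (Δη) e_k`; its divergence is `Δ∂_k η - ∂_k Δη`, which vanishes as partial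
derivatives commute. -/
theorem isSolenoidalTest_curlCurl {η : E3 → ℝ} (hη : ContDiff ℝ ∞ η) (hηc : HasCompactSupport η)
    (k : Fin 3) : IsSolenoidalTest (curlCurl k η) := by
  have hl : ∀ l, ContDiff ℝ ∞ (partialD l (partialD l η)) := fun l =>
    contDiff_partialD (contDiff_partialD hη l) l
  have hL : ContDiff ℝ ∞ (fun x => ∑ l, partialD l (partialD l η) x) :=
    ContDiff.sum fun l _ => hl l
  have hLi : ∀ i, ContDiff ℝ ∞ (fun x => if i = k then ∑ l, partialD l (partialD l η) x else 0) := by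
    intro i
    split_ifs
    exacts [hL, contDiff_const]
  have hc : ContDiff ℝ ∞ (curlCurl k η) := contDiff_ofCoords fun i =>
    (contDiff_partialD (contDiff_partialD hη k) i).sub (hLi i)
  refine ⟨hc, hasCompactSupport_ofCoords fun i => ?_, fun x => ?_⟩
  · refine (hasCompactSupport_partialD (hasCompactSupport_partialD hηc k) i).sub ?_
    split_ifs
    · refine HasCompactSupport.of_support_subset_isCompact
        (isCompact_iUnion fun l => hasCompactSupport_partialD (hasCompactSupport_partialD hηc l) l)
        fun x hx => ?_
      by_contra hx'
      simp only [mem_iUnion, not_exists] at hx'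
      exact hx (Finset.sum_eq_zero fun l _ => image_eq_zero_of_notMem_tsupport (hx' l))
    · exact HasCompactSupport.zero
  · rw [divergence_eq_sum (hc.differentiable (by simp))]
    have e1 : ∀ i, partialD i (fun y => curlCurl k η y i) x = partialD i (partialD i (partialD k η)) x
        - partialD i (fun y => if i = k then ∑ l, partialD l (partialD l η) y else 0) x := fun i =>
      partialD_sub (contDiff_partialD (contDiff_partialD hη k) i) (hLi i) i x
    have e2 : ∀ i, partialD i (fun y => if i = k then ∑ l, partialD l (partialD l η) y else 0) x
        = if i = k then ∑ l, partialD k (partialD l (partialD l η)) x else 0 := by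
      intro i
      split_ifs with h
      · subst h
        have := fderiv_fun_sum (u := Finset.univ) fun l _ => (hl l).differentiable (by simp) x
        change fderiv ℝ (fun y => ∑ l, partialD l (partialD l η) y) x _ = _
        rw [this, sum_apply]
        rfl
      · simp [partialD]
    simp only [e1, e2, Finset.sum_sub_distrib, Finset.sum_ite_eq', Finset.mem_univ, if_true]
    refine sub_eq_zero.2 (Finset.sum_congr rfl fun l _ => ?_)
    rw [partialD_comm hη l k, partialD_comm (contDiff_partialD hη l) l k]

/-- A component of a square-integrable field. -/
noncomputable def coord (i : Fin 3) (a : Lp E3 2 (volume : Measure E3)) (x : E3) : ℝ := a x i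

theorem memLp_coord (i : Fin 3) (a : Lp E3 2 (volume : Measure E3)) : MemLp (coord i a) 2 volume :=
  (EuclideanSpace.proj i : E3 →L[ℝ] ℝ).comp_memLp a

theorem locallyIntegrable_coord (i : Fin 3) (a : Lp E3 2 (volume : Measure E3)) :
    LocallyIntegrable (coord i a) volume :=
  (memLp_coord i a).locallyIntegrable (by norm_num)

theorem inner_toLp_eq {w : E3 → E3} (hw : MemLp w 2 volume) (a : Lp E3 2 (volume : Measure E3)) :
    inner ℝ (hw.toLp w) a = ∫ x, ∑ i, w x i * coord i a x := by
  rw [L2.inner_def]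
  refine integral_congr_ae ?_
  filter_upwards [hw.coeFn_toLp] with x hx
  rw [hx, PiLp.inner_apply]
  exact Finset.sum_congr rfl fun i _ => by simp [coord, mul_comm]

theorem integrable_mul_of_smooth {f g : E3 → ℝ} (hf : Continuous f) (hfc : HasCompactSupport f)
    (hg : Continuous g) : Integrable (fun x => f x * g x) volume :=
  (hf.mul hg).integrable_of_hasCompactSupport hfc.mul_right

theorem integrable_mul_of_memLp {f g : E3 → ℝ} (hf : MemLp f 2 volume) (hg : MemLp g 2 volume) :
    Integrable (fun x => f x * g x) volume :=
  hf.integrable_mul hg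

theorem integral_partialD_mul {f g : E3 → ℝ} (hf : ContDiff ℝ ∞ f) (hfc : HasCompactSupport f)
    (hg : ContDiff ℝ ∞ g) (i : Fin 3) :
    ∫ x, partialD i f x * g x = -∫ x, f x * partialD i g x := by
  have h := integral_mul_fderiv_eq_neg_fderiv_mul_of_integrable (μ := (volume : Measure E3))
    (f := f) (g := g) (v := EuclideanSpace.single i 1)
    (integrable_mul_of_smooth (contDiff_partialD hf i).continuous
      (hasCompactSupport_partialD hfc i) hg.continuous)
    (integrable_mul_of_smooth hf.continuous hfc (contDiff_partialD hg i).continuous)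
    (integrable_mul_of_smooth hf.continuous hfc hg.continuous)
    (fun x _ => hf.differentiable (by simp) x) (fun x _ => hg.differentiable (by simp) x)
  exact (neg_eq_iff_eq_neg.2 h).symm

/-- The gradient of a test function, in `L²`. -/
theorem memLp_gradient {η : E3 → ℝ} (hη : ContDiff ℝ ∞ η) (hηc : HasCompactSupport η) :
    MemLp (ofCoords fun i => partialD i η) 2 (volume : Measure E3) :=
  (contDiff_ofCoords fun i => contDiff_partialD hη i).continuous.memLp_of_hasCompactSupport
    (hasCompactSupport_ofCoords fun i => hasCompactSupport_partialD hηc i)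

theorem integral_sum_gradient_mul_eq_zero {η : E3 → ℝ} (hη : ContDiff ℝ ∞ η)
    (hηc : HasCompactSupport η) {w : E3 → E3} (hw : IsSolenoidalTest w) :
    ∫ x, ∑ i, partialD i η x * w x i = 0 := by
  rw [integral_finsetSum _ fun i _ => integrable_mul_of_smooth
    (contDiff_partialD hη i).continuous (hasCompactSupport_partialD hηc i)
    (hw.contDiff_coord i).continuous]
  simp_rw [integral_partialD_mul hη hηc (hw.contDiff_coord _)]
  rw [Finset.sum_neg_distrib, ← integral_finsetSum _ fun i _ => integrable_mul_of_smooth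
    hη.continuous hηc (contDiff_partialD (hw.contDiff_coord i) i).continuous]
  simp_rw [← Finset.mul_sum, ← divergence_eq_sum (hw.contDiff.differentiable (by simp)),
    hw.divergence_eq_zero]
  simp

theorem partialD_comp_sub {K : E3 → ℝ} (hK : ContDiff ℝ ∞ K) (x y : E3) (i : Fin 3) :
    partialD i (fun z => K (x - z)) y = -partialD i K (x - y) := by
  have h1 : HasFDerivAt (fun z : E3 => x - z) (-ContinuousLinearMap.id ℝ E3) y := by
    simpa using (hasFDerivAt_id y).const_sub x
  have h := (hK.differentiable (by simp) (x - y)).hasFDerivAt.comp y h1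
  unfold partialD
  change fderiv ℝ (K ∘ fun z => x - z) y _ = _
  rw [h.fderiv]
  simp

theorem contDiff_comp_const_sub {K : E3 → ℝ} (hK : ContDiff ℝ ∞ K) (x : E3) :
    ContDiff ℝ ∞ (fun z => K (x - z)) :=
  hK.comp (contDiff_const.sub contDiff_id)

theorem hasCompactSupport_comp_const_sub {K : E3 → ℝ} (hK : HasCompactSupport K) (x : E3) :
    HasCompactSupport (fun z => K (x - z)) :=
  hK.comp_homeomorph (Homeomorph.subLeft x)

/-- Weyl's lemma and Liouville's theorem for square-integrable functions. -/
theorem ae_eq_zero_of_weakly_harmonic {f : E3 → ℝ} (hf : MemLp f 2 volume)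
    (h : ∀ η : E3 → ℝ, ContDiff ℝ ∞ η → HasCompactSupport η →
      ∫ x, (∑ l, partialD l (partialD l η) x) * f x = 0) : f =ᵐ[volume] 0 := by
  have hfl := hf.locallyIntegrable (by norm_num)
  have hz : ∀ n, mollify (mollifier n) f = 0 := by
    intro n
    have hK := contDiff_mollifier n
    have hKc := hasCompactSupport_mollifier n
    have hK1 := fun l => contDiff_partialD hK l
    have hKc1 := fun l => hasCompactSupport_partialD hKc l
    have hK2 := fun l => contDiff_partialD (hK1 l) l
    have hKc2 := fun l => hasCompactSupport_partialD (hKc1 l) l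
    have hm := contDiff_mollify hK hKc hfl
    have e1 : ∀ l, partialD l (mollify (mollifier n) f) = mollify (partialD l (mollifier n)) f :=
      fun l => partialD_mollify hK hKc hfl l
    have e2 : ∀ l, partialD l (partialD l (mollify (mollifier n) f))
        = mollify (partialD l (partialD l (mollifier n))) f := fun l => by
      rw [e1, partialD_mollify (hK1 l) (hKc1 l) hfl l]
    have hL0 : MemLp (mollify (mollifier n) f) 2 volume :=
      memLp_mollify (by norm_num) (by simp) hK hKc hf
    have hL1 : ∀ l, MemLp (partialD l (mollify (mollifier n) f)) 2 volume := fun l => by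
      rw [e1]
      exact memLp_mollify (by norm_num) (by simp) (hK1 l) (hKc1 l) hf
    have hL2 : ∀ l, MemLp (partialD l (partialD l (mollify (mollifier n) f))) 2 volume :=
      fun l => by
        rw [e2]
        exact memLp_mollify (by norm_num) (by simp) (hK2 l) (hKc2 l) hf
    -- The hypothesis is applied to the translated kernel `φ_n(x - ·)`. The two sign changes from
    -- differentiating it twice cancel.
    have hharm : ∀ x, ∑ l, partialD l (partialD l (mollify (mollifier n) f)) x = 0 := by
      intro x
      have hx := h (fun z => mollifier n (x - z)) (contDiff_comp_const_sub hK x)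
        (hasCompactSupport_comp_const_sub hKc x)
      have e3 : ∀ l y, partialD l (partialD l (fun z => mollifier n (x - z))) y
          = partialD l (partialD l (mollifier n)) (x - y) := by
        intro l y
        have : partialD l (fun z => mollifier n (x - z))
            = fun z => -partialD l (mollifier n) (x - z) := by
          ext z
          exact partialD_comp_sub hK x z l
        rw [this]
        have h2 := partialD_comp_sub (hK1 l) x y l
        unfold partialD at h2 ⊢
        rw [fderiv_fun_neg, neg_apply, h2, neg_neg]
      simp_rw [e3, Finset.sum_mul] at hx
      rw [integral_finsetSum _ fun l _ => integrable_mollify_integrand_swap (hK2 l).continuous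
        (hKc2 l) hfl x] at hx
      simp_rw [e2, mollify_eq_swap]
      exact hx
    -- All derivatives of the mollification lie in `L²`, so there is no boundary term in `∫ h Δh =
    -- -∫ |∇h|²`, and harmonicity forces `∇h = 0`.
    have hparts : ∀ l, ∫ x, mollify (mollifier n) f x
        * partialD l (partialD l (mollify (mollifier n) f)) x
        = -∫ x, partialD l (mollify (mollifier n) f) x * partialD l (mollify (mollifier n) f) x :=
      fun l => integral_mul_fderiv_eq_neg_fderiv_mul_of_integrable
        ((hL1 l).integrable_mul (hL1 l)) (hL0.integrable_mul (hL2 l))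
        (hL0.integrable_mul (hL1 l)) (fun x _ => hm.differentiable (by simp) x)
        (fun x _ => (contDiff_partialD hm l).differentiable (by simp) x)
    have hsum : ∑ l, ∫ x, partialD l (mollify (mollifier n) f) x
        * partialD l (mollify (mollifier n) f) x = 0 := by
      rw [← neg_eq_zero, ← Finset.sum_neg_distrib]
      simp_rw [← hparts]
      rw [← integral_finsetSum _ fun l _ => integrable_mul_of_memLp hL0 (hL2 l)]
      simp_rw [← Finset.mul_sum, hharm]
      simp
    have hzero : ∀ l, partialD l (mollify (mollifier n) f) = 0 := by
      intro l
      have h0 := (Finset.sum_eq_zero_iff_of_nonneg fun l _ => integral_nonneg fun x =>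
        mul_self_nonneg _).1 hsum l (Finset.mem_univ l)
      rw [integral_eq_zero_iff_of_nonneg (fun x => mul_self_nonneg _)
        ((hL1 l).integrable_mul (hL1 l))] at h0
      refine (contDiff_partialD hm l).continuous.ae_eq_iff_eq volume continuous_const |>.1 ?_
      filter_upwards [h0] with x hx using mul_self_eq_zero.1 hx
    have hfd : ∀ x, fderiv ℝ (mollify (mollifier n) f) x = 0 := by
      intro x
      ext v
      rw [fderiv_apply_eq_sum]
      simp [hzero]
    have hconst : mollify (mollifier n) f = fun _ => mollify (mollifier n) f 0 := by
      ext x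
      exact is_const_of_fderiv_eq_zero (hm.differentiable (by simp)) hfd x 0
    rw [hconst] at hL0
    -- A constant in `L²` of a space of infinite volume is zero.
    have := (memLp_const_iff (by norm_num) (by simp)).1 hL0
    rcases this with h0 | h0
    · rw [hconst, h0]
      rfl
    · simp at h0
  have ht := tendsto_eLpNorm_mollify_sub hf
  simp only [hz, Pi.zero_apply, zero_sub] at ht
  have h0 : eLpNorm (fun x => -f x) 2 volume = 0 := tendsto_nhds_unique tendsto_const_nhds ht
  rw [eLpNorm_eq_zero_iff (by exact hf.1.neg) (by norm_num)] at h0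
  filter_upwards [h0] with x hx
  simpa using hx

/-- Divergence-free test fields are dense among the weakly divergence-free `L²` fields. -/
theorem mem_closure_solenoidalTests {v : Lp E3 2 (volume : Measure E3)}
    (hv : ∀ η : E3 → ℝ, ContDiff ℝ ∞ η → HasCompactSupport η → ∫ x, fderiv ℝ η x (v x) = 0) :
    v ∈ closure (solenoidalTests : Set (Lp E3 2 (volume : Measure E3))) := by
  -- Gradients of test functions. Being weakly divergence-free is orthogonality to all of `G`, a
  -- property shared by `v` and by the closure of the solenoidal tests.
  let G : Set (Lp E3 2 (volume : Measure E3)) :=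
    {g | ∃ (η : E3 → ℝ) (hη : ContDiff ℝ ∞ η) (hηc : HasCompactSupport η),
      g = (memLp_gradient hη hηc).toLp _}
  have hvG : v ∈ (Submodule.span ℝ G)ᗮ := by
    rw [Submodule.mem_orthogonal]
    intro g hg
    induction hg using Submodule.span_induction with
    | mem g hg =>
      obtain ⟨η, hη, hηc, rfl⟩ := hg
      rw [inner_toLp_eq, ← hv η hη hηc]
      exact integral_congr_ae (.of_forall fun x => (fderiv_apply_eq_sum x (v x)).symm)
    | zero => simp
    | add g g' _ _ h h' => rw [inner_add_left, h, h', add_zero]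
    | smul c g _ h => rw [inner_smul_left, h, mul_zero]
  have hVG : solenoidalTests.topologicalClosure ≤ (Submodule.span ℝ G)ᗮ := by
    refine Submodule.topologicalClosure_minimal _ ?_ (Submodule.isClosed_orthogonal _)
    rintro a ⟨w, hw, ha⟩
    rw [Submodule.mem_orthogonal]
    intro g hg
    induction hg using Submodule.span_induction with
    | mem g hg =>
      obtain ⟨η, hη, hηc, rfl⟩ := hg
      rw [inner_toLp_eq, ← integral_sum_gradient_mul_eq_zero hη hηc hw]
      refine integral_congr_ae ?_
      filter_upwards [ha] with x hx
      simp only [coord, hx]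
      rfl
    | zero => simp
    | add g g' _ _ h h' => rw [inner_add_left, h, h', add_zero]
    | smul c g _ h => rw [inner_smul_left, h, mul_zero]
  let V := solenoidalTests.topologicalClosure
  have : CompleteSpace V :=
    (Submodule.isClosed_topologicalClosure solenoidalTests).completeSpace_coe
  -- The residual `v - p` of the orthogonal projection is orthogonal both to gradients and to
  -- solenoidal tests; the aim is that it vanishes.
  let p : Lp E3 2 (volume : Measure E3) := V.starProjection v
  have hp : p ∈ V := Submodule.starProjection_apply_mem V v
  have hr : v - p ∈ Vᗮ := Submodule.sub_starProjection_mem_orthogonal v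
  have hrG : v - p ∈ (Submodule.span ℝ G)ᗮ := Submodule.sub_mem _ hvG (hVG hp)
  have hA : ∀ η : E3 → ℝ, ContDiff ℝ ∞ η → HasCompactSupport η →
      ∫ x, ∑ i, partialD i η x * coord i (v - p) x = 0 := by
    intro η hη hηc
    have := (Submodule.mem_orthogonal _ _).1 hrG _ (Submodule.subset_span ⟨η, hη, hηc, rfl⟩)
    rw [inner_toLp_eq] at this
    exact this
  have hB : ∀ k, coord k (v - p) =ᵐ[volume] 0 := by
    intro k
    refine ae_eq_zero_of_weakly_harmonic (memLp_coord k _) fun η hη hηc => ?_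
    have hw := isSolenoidalTest_curlCurl hη hηc k
    have h1 := (Submodule.mem_orthogonal _ _).1 hr (hw.memLp.toLp _)
      (Submodule.le_topologicalClosure _ ⟨_, hw, hw.memLp.coeFn_toLp⟩)
    rw [inner_toLp_eq] at h1
    have h2 := hA (partialD k η) (contDiff_partialD hη k) (hasCompactSupport_partialD hηc k)
    -- From `(Δη) e_k = ∇∂_k η - curl curl (η e_k)`: both fields on the right are orthogonal to the
    -- residual, so each of its components is weakly harmonic.
    have e : ∀ x, (∑ l, partialD l (partialD l η) x) * coord k (v - p) x
        = (∑ i, partialD i (partialD k η) x * coord i (v - p) x)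
          - ∑ i, curlCurl k η x i * coord i (v - p) x := by
      intro x
      simp [curlCurl, ofCoords, sub_mul, ite_mul]
    have hI : ∀ {W : Fin 3 → E3 → ℝ}, (∀ i, MemLp (W i) 2 volume) →
        Integrable (fun x => ∑ i, W i x * coord i (v - p) x) volume := fun hW =>
      integrable_finsetSum _ fun i _ => integrable_mul_of_memLp (hW i) (memLp_coord i _)
    simp_rw [e]
    rw [integral_sub (hI fun i => ?_) (hI (W := fun i x => curlCurl k η x i) fun i => ?_), h1, h2,
      sub_zero]
    · exact (contDiff_partialD (contDiff_partialD hη k) i).continuous.memLp_of_hasCompactSupport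
        (hasCompactSupport_partialD (hasCompactSupport_partialD hηc k) i)
    · exact (hw.contDiff_coord i).continuous.memLp_of_hasCompactSupport
        (hw.hasCompactSupport_coord i)
  have h0 : v - p = 0 := by
    rw [Lp.eq_zero_iff_ae_eq_zero]
    filter_upwards [ae_all_iff.2 hB] with x hx
    ext k
    exact hx k
  rw [sub_eq_zero.1 h0]
  exact hp

/-! ### Mollified energy and flux as forms on `L²` -/

theorem coord_add (i : Fin 3) (a b : Lp E3 2 (volume : Measure E3)) :
    coord i (a + b) =ᵐ[volume] fun x => coord i a x + coord i b x := by
  filter_upwards [Lp.coeFn_add a b] with x hx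
  rw [coord, hx]
  rfl

theorem coord_sub (i : Fin 3) (a b : Lp E3 2 (volume : Measure E3)) :
    coord i (a - b) =ᵐ[volume] fun x => coord i a x - coord i b x := by
  filter_upwards [Lp.coeFn_sub a b] with x hx
  rw [coord, hx]
  rfl

theorem coord_smul (i : Fin 3) (c : ℝ) (a : Lp E3 2 (volume : Measure E3)) :
    coord i (c • a) =ᵐ[volume] fun x => c * coord i a x := by
  filter_upwards [Lp.coeFn_smul c a] with x hx
  simp [coord, hx]

theorem toReal_eLpNorm_coord_le (i : Fin 3) (a : Lp E3 2 (volume : Measure E3)) :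
    (eLpNorm (coord i a) 2 volume).toReal ≤ ‖a‖ := by
  rw [Lp.norm_def]
  refine ENNReal.toReal_mono (Lp.eLpNorm_ne_top a) (eLpNorm_mono fun x => ?_)
  exact PiLp.norm_apply_le (a x) i

theorem mollify_coord_add {K : E3 → ℝ} (hK : Continuous K) (hKc : HasCompactSupport K) (i : Fin 3)
    (a b : Lp E3 2 (volume : Measure E3)) (x : E3) :
    mollify K (coord i (a + b)) x = mollify K (coord i a) x + mollify K (coord i b) x := by
  rw [mollify_congr_ae (coord_add i a b)]
  simp only [mollify, mul_add]
  exact integral_add (integrable_mollify_integrand hK hKc (locallyIntegrable_coord i a) x)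
    (integrable_mollify_integrand hK hKc (locallyIntegrable_coord i b) x)

theorem mollify_coord_smul (K : E3 → ℝ) (i : Fin 3) (c : ℝ)
    (a : Lp E3 2 (volume : Measure E3)) (x : E3) :
    mollify K (coord i (c • a)) x = c * mollify K (coord i a) x := by
  rw [mollify_congr_ae (coord_smul i c a)]
  simp only [mollify, mul_left_comm _ c, integral_const_mul]

section Pairing

variable {f K : E3 → ℝ}

theorem abs_mollify_coord_le (hK : Continuous K) (hKc : HasCompactSupport K) (i : Fin 3)
    (a : Lp E3 2 (volume : Measure E3)) (x : E3) :
    |mollify K (coord i a) x| ≤ (eLpNorm K 2 volume).toReal * ‖a‖ :=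
  (abs_mollify_le (hK.memLp_of_hasCompactSupport hKc) (memLp_coord i a) x).trans
    (mul_le_mul_of_nonneg_left (toReal_eLpNorm_coord_le i a) ENNReal.toReal_nonneg)

theorem continuous_mollify_coord (hK : ContDiff ℝ ∞ K) (hKc : HasCompactSupport K) (i : Fin 3)
    (a : Lp E3 2 (volume : Measure E3)) : Continuous (mollify K (coord i a)) :=
  (contDiff_mollify hK hKc (locallyIntegrable_coord i a)).continuous

theorem integrable_mul_mollify_coord (hf : Integrable f volume) (hK : ContDiff ℝ ∞ K)
    (hKc : HasCompactSupport K) (i : Fin 3) (a : Lp E3 2 (volume : Measure E3)) :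
    Integrable (fun x => f x * mollify K (coord i a) x) volume :=
  hf.mul_bdd (continuous_mollify_coord hK hKc i a).aestronglyMeasurable
    (.of_forall fun x => abs_mollify_coord_le hK.continuous hKc i a x)

/-- Pairing of an `L¹` function with a mollified component. -/
noncomputable def pairingL1 (hf : Integrable f volume) (hK : ContDiff ℝ ∞ K)
    (hKc : HasCompactSupport K) (i : Fin 3) : Lp E3 2 (volume : Measure E3) →L[ℝ] ℝ :=
  LinearMap.mkContinuous
    { toFun := fun a => ∫ x, f x * mollify K (coord i a) x
      map_add' := fun a b => by
        simp only [mollify_coord_add hK.continuous hKc, mul_add]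
        exact integral_add (integrable_mul_mollify_coord hf hK hKc i a)
          (integrable_mul_mollify_coord hf hK hKc i b)
      map_smul' := fun c a => by
        simp only [mollify_coord_smul, mul_left_comm _ c, integral_const_mul, RingHom.id_apply,
          smul_eq_mul] }
    ((∫ x, |f x|) * (eLpNorm K 2 volume).toReal) (fun a => by
      have h : ∀ x, ‖f x * mollify K (coord i a) x‖
          ≤ |f x| * ((eLpNorm K 2 volume).toReal * ‖a‖) := fun x => by
        rw [norm_mul]
        exact mul_le_mul_of_nonneg_left (abs_mollify_coord_le hK.continuous hKc i a x)
          (abs_nonneg _)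
      refine (norm_integral_le_of_norm_le (hf.abs.mul_const _) (.of_forall h)).trans_eq ?_
      rw [integral_mul_const, mul_assoc])

theorem norm_pairingL1_le (hf : Integrable f volume) (hK : ContDiff ℝ ∞ K)
    (hKc : HasCompactSupport K) (i : Fin 3) :
    ‖pairingL1 hf hK hKc i‖ ≤ (∫ x, |f x|) * (eLpNorm K 2 volume).toReal :=
  LinearMap.mkContinuous_norm_le _
    (mul_nonneg (integral_nonneg fun _ => abs_nonneg _) ENNReal.toReal_nonneg) _

theorem memLp_mollify_coord (hK : ContDiff ℝ ∞ K)
    (hKc : HasCompactSupport K) (i : Fin 3) (a : Lp E3 2 (volume : Measure E3)) :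
    MemLp (mollify K (coord i a)) 2 volume :=
  memLp_mollify (by norm_num) (by simp) hK hKc (memLp_coord i a)

/-- Pairing of an `L²` function with a mollified component. -/
noncomputable def pairingL2 (hf : MemLp f 2 volume) (hK : ContDiff ℝ ∞ K)
    (hKc : HasCompactSupport K) (i : Fin 3) : Lp E3 2 (volume : Measure E3) →L[ℝ] ℝ :=
  LinearMap.mkContinuous
    { toFun := fun a => ∫ x, f x * mollify K (coord i a) x
      map_add' := fun a b => by
        simp only [mollify_coord_add hK.continuous hKc, mul_add]
        exact integral_add (integrable_mul_of_memLp hf (memLp_mollify_coord hK hKc i a))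
          (integrable_mul_of_memLp hf (memLp_mollify_coord hK hKc i b))
      map_smul' := fun c a => by
        simp only [mollify_coord_smul, mul_left_comm _ c, integral_const_mul, RingHom.id_apply,
          smul_eq_mul] }
    ((eLpNorm f 2 volume).toReal * (eLpNorm K 1 volume).toReal) (fun a => by
      refine (abs_integral_mul_le hf (memLp_mollify_coord hK hKc i a)).trans ?_
      rw [mul_assoc]
      refine mul_le_mul_of_nonneg_left ?_ ENNReal.toReal_nonneg
      have h1 : eLpNorm K 1 volume ≠ ⊤ := (memLp_one_iff_integrable.2
        (hK.continuous.integrable_of_hasCompactSupport hKc)).2.ne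
      refine (ENNReal.toReal_mono (ENNReal.mul_ne_top h1 (memLp_coord i a).2.ne)
        (eLpNorm_mollify_le (by norm_num) (by simp) hK.continuous.aestronglyMeasurable
          (memLp_coord i a).1)).trans ?_
      rw [ENNReal.toReal_mul]
      exact mul_le_mul_of_nonneg_left (toReal_eLpNorm_coord_le i a) ENNReal.toReal_nonneg)

end Pairing

section Forms

variable {Φ : E3 → ℝ} (hΦ : ContDiff ℝ ∞ Φ) (hΦc : HasCompactSupport Φ)

theorem integrable_coord_mul_coord (i j : Fin 3) (a b : Lp E3 2 (volume : Measure E3)) :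
    Integrable (fun x => coord i a x * coord j b x) volume :=
  integrable_mul_of_memLp (memLp_coord i a) (memLp_coord j b)

/-- The mollified energy form `∫ a · (Φ ⋆ w)`. -/
noncomputable def energyForm (a : Lp E3 2 (volume : Measure E3)) :
    Lp E3 2 (volume : Measure E3) →L[ℝ] ℝ :=
  ∑ i, pairingL2 (memLp_coord i a) hΦ hΦc i

theorem energyForm_apply (a w : Lp E3 2 (volume : Measure E3)) :
    energyForm hΦ hΦc a w = ∑ i, ∫ x, coord i a x * mollify Φ (coord i w) x := by
  simp only [energyForm, sum_apply]
  rfl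

/-- The flux form `∫ (a ⊗ b) : ∇ (Φ ⋆ w)`. -/
noncomputable def fluxForm (a b : Lp E3 2 (volume : Measure E3)) :
    Lp E3 2 (volume : Measure E3) →L[ℝ] ℝ :=
  ∑ i, ∑ j, pairingL1 (integrable_coord_mul_coord i j a b) (contDiff_partialD hΦ i)
    (hasCompactSupport_partialD hΦc i) j

theorem fluxForm_apply (a b w : Lp E3 2 (volume : Measure E3)) :
    fluxForm hΦ hΦc a b w
      = ∑ i, ∑ j, ∫ x, coord i a x * coord j b x * mollify (partialD i Φ) (coord j w) x := by
  simp only [fluxForm, sum_apply]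
  rfl

theorem energyForm_comm (hΦe : ∀ x, Φ (-x) = Φ x) (a b : Lp E3 2 (volume : Measure E3)) :
    energyForm hΦ hΦc a b = energyForm hΦ hΦc b a := by
  rw [energyForm_apply, energyForm_apply]
  refine Finset.sum_congr rfl fun i _ => ?_
  rw [integral_mul_mollify_comm hΦe (integrable_kernel_sq
    (hΦ.continuous.integrable_of_hasCompactSupport hΦc) (memLp_coord i a) (memLp_coord i b))]
  simp_rw [mul_comm]

/-- Cauchy–Schwarz puts `a_i b_j` in `L¹` and bounds the mollified gradient uniformly by `‖∂_i
Φ‖_{L²} ‖w‖`. No integrability beyond `L²` is used, so the balance at a fixed scale holds for every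
weak solution. -/
theorem exists_norm_fluxForm_le : ∃ C : ℝ, 0 ≤ C ∧ ∀ a b : Lp E3 2 (volume : Measure E3),
    ‖fluxForm hΦ hΦc a b‖ ≤ C * (‖a‖ * ‖b‖) := by
  refine ⟨∑ i : Fin 3, ∑ _j : Fin 3, (eLpNorm (partialD i Φ) 2 volume).toReal,
    Finset.sum_nonneg fun i _ => Finset.sum_nonneg fun j _ => ENNReal.toReal_nonneg,
    fun a b => ?_⟩
  rw [Finset.sum_mul]
  refine norm_sum_le_of_le _ fun i _ => ?_
  rw [Finset.sum_mul]
  refine norm_sum_le_of_le _ fun j _ => ?_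
  refine (norm_pairingL1_le _ _ _ _).trans ?_
  rw [mul_comm]
  refine mul_le_mul_of_nonneg_left ?_ ENNReal.toReal_nonneg
  have h := abs_integral_mul_le (memLp_coord i a).norm (memLp_coord j b).norm
  rw [eLpNorm_norm, eLpNorm_norm] at h
  simp_rw [abs_mul]
  exact (le_abs_self _).trans (h.trans (mul_le_mul (toReal_eLpNorm_coord_le i a)
    (toReal_eLpNorm_coord_le j b) ENNReal.toReal_nonneg (norm_nonneg a)))

/-- Polarization in the two quadratic slots, whence norm continuity of the diagonal. -/
theorem fluxForm_sub_eq (a b : Lp E3 2 (volume : Measure E3)) :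
    fluxForm hΦ hΦc a a - fluxForm hΦ hΦc b b
      = fluxForm hΦ hΦc (a - b) a + fluxForm hΦ hΦc b (a - b) := by
  ext w
  rw [sub_apply, add_apply]
  simp only [fluxForm_apply, ← Finset.sum_sub_distrib, ← Finset.sum_add_distrib]
  refine Finset.sum_congr rfl fun i _ => Finset.sum_congr rfl fun j _ => ?_
  have hI := fun a b : Lp E3 2 (volume : Measure E3) =>
    integrable_mul_mollify_coord (integrable_coord_mul_coord i j a b) (contDiff_partialD hΦ i)
      (hasCompactSupport_partialD hΦc i) j w
  rw [← integral_sub (hI a a) (hI b b), ← integral_add (hI (a - b) a) (hI b (a - b))]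
  refine integral_congr_ae ?_
  filter_upwards [coord_sub i a b, coord_sub j a b] with x h1 h2
  rw [h1, h2]
  ring

theorem continuous_fluxForm_diag : Continuous fun a => fluxForm hΦ hΦc a a := by
  obtain ⟨C, hC0, hC⟩ := exists_norm_fluxForm_le hΦ hΦc
  rw [continuous_iff_continuousAt]
  intro b
  rw [ContinuousAt, tendsto_iff_norm_sub_tendsto_zero]
  have h0 : Tendsto (fun a : Lp E3 2 (volume : Measure E3) =>
      C * (‖a - b‖ * ‖a‖) + C * (‖b‖ * ‖a - b‖)) (𝓝 b) (𝓝 0) := by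
    have : Continuous fun a : Lp E3 2 (volume : Measure E3) =>
      C * (‖a - b‖ * ‖a‖) + C * (‖b‖ * ‖a - b‖) := by fun_prop
    simpa using this.tendsto b
  refine squeeze_zero (fun _ => norm_nonneg _) (fun a => ?_) h0
  rw [fluxForm_sub_eq]
  exact (norm_add_le _ _).trans (add_le_add (hC _ _) (hC _ _))

end Forms

/-! ### The energy balance of the mollified solution -/

section WeakSolution

variable {Φ : E3 → ℝ} (hΦ : ContDiff ℝ ∞ Φ) (hΦc : HasCompactSupport Φ)

/-- The divergence of the mollified field at `x` is the weak divergence of `w` tested, up to sign,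
against `Φ(x - ·)`. -/
theorem isSolenoidalTest_mollify (hΦ : ContDiff ℝ ∞ Φ) (hΦc : HasCompactSupport Φ)
    {w : E3 → E3} (hw : IsSolenoidalTest w) :
    IsSolenoidalTest (ofCoords fun i => mollify Φ fun x => w x i) := by
  have hl := fun i => (hw.contDiff_coord i).continuous.locallyIntegrable (μ := (volume : Measure E3))
  have hc := contDiff_ofCoords fun i => contDiff_mollify hΦ hΦc (hl i)
  refine ⟨hc, hasCompactSupport_ofCoords fun i =>
    hasCompactSupport_mollify hΦc (hw.hasCompactSupport_coord i), fun x => ?_⟩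
  rw [divergence_eq_sum (hc.differentiable (by simp))]
  have h1 : ∀ i, partialD i (fun y => ofCoords (fun i => mollify Φ fun x => w x i) y i) x
      = ∫ y, partialD i Φ (x - y) * w y i := by
    intro i
    rw [← mollify_eq_swap (partialD i Φ) (fun y => w y i), ← partialD_mollify hΦ hΦc (hl i)]
    rfl
  simp_rw [h1]
  rw [← integral_finsetSum _ fun i _ => integrable_mollify_integrand_swap
    (contDiff_partialD hΦ i).continuous (hasCompactSupport_partialD hΦc i) (hl i) x]
  have h2 := integral_sum_gradient_mul_eq_zero (contDiff_comp_const_sub hΦ x)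
    (hasCompactSupport_comp_const_sub hΦc x) hw
  simp_rw [partialD_comp_sub hΦ, neg_mul, Finset.sum_neg_distrib] at h2
  rwa [integral_neg, neg_eq_zero] at h2

/-- Turns a field constant in time into one with compact support in space-time, without producing a
time derivative on `[0, T]`. -/
theorem exists_time_cutoff {T : ℝ} (hT : 0 < T) : ∃ χ : ℝ → ℝ, ContDiff ℝ ∞ χ ∧
    HasCompactSupport χ ∧ ∀ s ∈ Icc 0 T, χ s = 1 ∧ deriv χ s = 0 := by
  -- `[0, T]` lies inside the open ball of radius `T` about `T / 2`, so the bump is `1` near every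
  -- point of it, endpoints included.
  let b : ContDiffBump (T / 2) := ⟨T, 2 * T, hT, by linarith⟩
  refine ⟨b, b.contDiff, b.hasCompactSupport, fun s hs => ?_⟩
  have h : s ∈ Metric.ball (T / 2) b.rIn := by
    rw [Metric.mem_ball, Real.dist_eq, abs_lt]
    exact ⟨by show -T < _; linarith [hs.1], by show _ < T; linarith [hs.2]⟩
  have he := b.eventuallyEq_one_of_mem_ball h
  refine ⟨he.eq_of_nhds, ?_⟩
  rw [he.deriv_eq]
  exact deriv_const s (1 : ℝ)

theorem ae_eq_coord {a : Lp E3 2 (volume : Measure E3)} {w : E3 → E3} (h : a =ᵐ[volume] w)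
    (i : Fin 3) : coord i a =ᵐ[volume] fun x => w x i := by
  filter_upwards [h] with x hx
  simp [coord, hx]

/-- The momentum equation is tested with `χ(s) (Φ ⋆ w)(x)`, where the cut-off `χ` equals `1` on `[0,
T]`. -/
theorem momentum_solenoidalTest {T : ℝ} (hT : 0 < T) {u₀ : Lp E3 2 (volume : Measure E3)}
    {u : ℝ → Lp E3 2 (volume : Measure E3)} (hu : IsWeakEulerSolution T u₀ u)
    {w : E3 → E3} (hw : IsSolenoidalTest w) {a : Lp E3 2 (volume : Measure E3)}
    (ha : a =ᵐ[volume] w) {t : ℝ} (ht : t ∈ Icc 0 T) :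
    energyForm hΦ hΦc (u t) a - energyForm hΦ hΦc (u 0) a
      = ∫ s in (0 : ℝ)..t, fluxForm hΦ hΦc (u s) (u s) a := by
  obtain ⟨χ, hχ, hχc, hχ1⟩ := exists_time_cutoff hT
  let W : E3 → E3 := ofCoords fun i => mollify Φ fun x => w x i
  have hW : IsSolenoidalTest W := isSolenoidalTest_mollify hΦ hΦc hw
  have hWd : Differentiable ℝ W := hW.contDiff.differentiable (by simp)
  have hmo : ∀ (K : E3 → ℝ) i, mollify K (coord i a) = mollify K fun x => w x i :=
    fun K i => mollify_congr_ae (ae_eq_coord ha i)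
  have hl := fun i => (hw.contDiff_coord i).continuous.locallyIntegrable (μ := (volume : Measure E3))
  have h := hu.momentum (fun s x => χ s • W x)
    ((hχ.comp contDiff_fst).smul (hW.contDiff.comp contDiff_snd)) (by
      refine HasCompactSupport.of_support_subset_isCompact
        (hχc.isCompact.prod hW.hasCompactSupport.isCompact) fun z hz => ?_
      refine ⟨subset_tsupport _ fun h0 => hz ?_, subset_tsupport _ fun h0 => hz ?_⟩
      · simp [Function.uncurry, h0]
      · simp [Function.uncurry, h0])
    (fun s x => (hW.smul (χ s)).divergence_eq_zero x) t ht
  have h00 : (0 : ℝ) ∈ Icc 0 T := ⟨le_rfl, hT.le⟩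
  have hen : ∀ v : Lp E3 2 (volume : Measure E3),
      ∫ x, inner ℝ (v x) (W x) = energyForm hΦ hΦc v a := by
    intro v
    rw [energyForm_apply, ← integral_finsetSum _ fun i _ =>
      integrable_mul_of_memLp (memLp_coord i v) (memLp_mollify_coord hΦ hΦc i a)]
    refine integral_congr_ae (.of_forall fun x => ?_)
    simp only [PiLp.inner_apply, hmo]
    exact Finset.sum_congr rfl fun i _ => by simp [W, ofCoords, coord, mul_comm]
  have hfl : ∀ v : Lp E3 2 (volume : Measure E3),
      ∫ x, inner ℝ (v x) (fderiv ℝ W x (v x)) = fluxForm hΦ hΦc v v a := by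
    intro v
    have hI := fun i j => integrable_mul_mollify_coord (integrable_coord_mul_coord i j v v)
      (contDiff_partialD hΦ i) (hasCompactSupport_partialD hΦc i) j a
    rw [fluxForm_apply, Finset.sum_comm]
    simp_rw [← integral_finsetSum _ fun i _ => hI i _]
    rw [← integral_finsetSum _ fun j _ => integrable_finsetSum _ fun i _ => hI i j]
    refine integral_congr_ae (.of_forall fun x => ?_)
    simp only [PiLp.inner_apply, hmo]
    refine Finset.sum_congr rfl fun j _ => ?_
    rw [fderiv_field_apply hWd, fderiv_apply_eq_sum]
    have e : ∀ i, partialD i (fun y => W y j) x = mollify (partialD i Φ) (fun y => w y j) x :=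
      fun i => congrFun (partialD_mollify hΦ hΦc (hl j) i) x
    simp only [e, RCLike.inner_apply, conj_trivial, Finset.sum_mul, coord]
    exact Finset.sum_congr rfl fun i _ => by ring
  simp only [(hχ1 t ht).1, (hχ1 0 h00).1, one_smul] at h
  rw [hen, ← hu.initial, hen] at h
  have hz : ∫ s in (0 : ℝ)..t, ∫ x, inner ℝ (u s x) (deriv (fun r => χ r • W x) s)
      = ∫ s in (0 : ℝ)..t, (0 : ℝ) := by
    refine intervalIntegral.integral_congr fun s hs => ?_
    rw [uIcc_of_le ht.1] at hs
    have hs' := hχ1 s ⟨hs.1, hs.2.trans ht.2⟩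
    have hd : ∀ x, deriv (fun r => χ r • W x) s = 0 := fun x => by
      rw [deriv_smul_const (hχ.differentiable (by simp) s), hs'.2, zero_smul]
    simp [hd]
  have hq : ∫ s in (0 : ℝ)..t, ∫ x, inner ℝ (u s x) (fderiv ℝ (fun x => χ s • W x) x (u s x))
      = ∫ s in (0 : ℝ)..t, fluxForm hΦ hΦc (u s) (u s) a := by
    refine intervalIntegral.integral_congr fun s hs => ?_
    rw [uIcc_of_le ht.1] at hs
    have hs' := hχ1 s ⟨hs.1, hs.2.trans ht.2⟩
    simp only [hs'.1, one_smul]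
    exact hfl (u s)
  rw [hz, hq, intervalIntegral.integral_zero, sub_zero] at h
  exact h

instance separableSpace_lp_two : TopologicalSpace.SeparableSpace (Lp E3 2 (volume : Measure E3)) :=
  haveI : Fact ((2 : ℝ≥0∞) ≠ ⊤) := ⟨by simp⟩
  haveI := Lp.SecondCountableTopology (X := E3) (E := E3) (p := 2) (μ := volume)
  inferInstance

/-- The weak form of the equations tested against the mollified solution at a frozen time. -/
theorem weak_form_frozen {T : ℝ} (hT : 0 < T) {u₀ : Lp E3 2 (volume : Measure E3)}
    {u : ℝ → Lp E3 2 (volume : Measure E3)} (hu : IsWeakEulerSolution T u₀ u)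
    {t : ℝ} (ht : t ∈ Icc 0 T) {τ : ℝ} (hτ : τ ∈ Icc 0 T) :
    energyForm hΦ hΦc (u t) (u τ) - energyForm hΦ hΦc (u 0) (u τ)
      = ∫ s in (0 : ℝ)..t, fluxForm hΦ hΦc (u s) (u s) (u τ) := by
  -- `u τ` is an `L²` limit of solenoidal tests. Both forms are continuous in their last slot, and
  -- the time integrals converge by dominated convergence.
  obtain ⟨a, ha, hlim⟩ := mem_closure_iff_seq_limit.1
    (mem_closure_solenoidalTests (hu.divergence_free τ hτ))
  obtain ⟨M, hM0, hM⟩ := exists_norm_le_of_weaklyContinuous hu.weakly_continuous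
  have hum := aestronglyMeasurable_of_weaklyContinuous hu.weakly_continuous
  obtain ⟨C, hC0, hC⟩ := exists_norm_fluxForm_le hΦ hΦc
  obtain ⟨R, hR⟩ := (Metric.isBounded_range_of_tendsto a hlim).exists_norm_le
  have hsub : Ioc 0 t ⊆ Icc 0 T := fun s hs => ⟨hs.1.le, hs.2.trans ht.2⟩
  have h1 := ((energyForm hΦ hΦc (u t)).continuous.tendsto (u τ)).comp hlim
  have h2 := ((energyForm hΦ hΦc (u 0)).continuous.tendsto (u τ)).comp hlim
  have h3 : Tendsto (fun k => ∫ s in (0 : ℝ)..t, fluxForm hΦ hΦc (u s) (u s) (a k)) atTop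
      (𝓝 (∫ s in (0 : ℝ)..t, fluxForm hΦ hΦc (u s) (u s) (u τ))) := by
    refine intervalIntegral.tendsto_integral_filter_of_dominated_convergence
      (fun _ => C * (M * M) * R) (.of_forall fun k => ?_)
      (.of_forall fun k => .of_forall fun s hs => ?_) intervalIntegrable_const
      (.of_forall fun s _ => ((fluxForm hΦ hΦc (u s) (u s)).continuous.tendsto (u τ)).comp hlim)
    · rw [uIoc_of_le ht.1]
      exact ((continuous_fluxForm_diag hΦ hΦc).comp_aestronglyMeasurable
        (hum.mono_measure (Measure.restrict_mono hsub le_rfl))).apply_continuousLinearMap (a k)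
    · rw [uIoc_of_le ht.1] at hs
      have hMs := hM s (hsub hs)
      refine (ContinuousLinearMap.le_opNorm _ _).trans (mul_le_mul ((hC _ _).trans ?_)
        (hR _ (mem_range_self k)) (norm_nonneg _) (by positivity))
      gcongr
  refine tendsto_nhds_unique (h1.sub h2) (h3.congr fun k => ?_)
  obtain ⟨w, hw, haw⟩ := ha k
  exact (momentum_solenoidalTest hΦ hΦc hT hu hw haw ht).symm

theorem mollified_energy_balance (hΦe : ∀ x, Φ (-x) = Φ x) {T : ℝ} (hT : 0 < T)
    {u₀ : Lp E3 2 (volume : Measure E3)}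
    {u : ℝ → Lp E3 2 (volume : Measure E3)} (hu : IsWeakEulerSolution T u₀ u)
    {t : ℝ} (ht : t ∈ Icc 0 T) :
    energyForm hΦ hΦc (u t) (u t) - energyForm hΦ hΦc (u 0) (u 0)
      = 2 * ∫ s in (0 : ℝ)..t, fluxForm hΦ hΦc (u s) (u s) (u s) := by
  obtain ⟨M, -, hM⟩ := exists_norm_le_of_weaklyContinuous hu.weakly_continuous
  obtain ⟨C, -, hC⟩ := exists_norm_fluxForm_le hΦ hΦc
  exact energy_balance_of_weaklyContinuous hu.weakly_continuous
    (aestronglyMeasurable_of_weaklyContinuous hu.weakly_continuous) hM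
    (F := fun a b => energyForm hΦ hΦc a b) (energyForm_comm hΦ hΦc hΦe)
    (continuous_fluxForm_diag hΦ hΦc) (C := C) (fun a => by rw [sq]; exact hC a a)
    (fun t ht τ hτ => weak_form_frozen hΦ hΦc hT hu ht hτ) ht

theorem aestronglyMeasurable_flux {T : ℝ}
    {u₀ : Lp E3 2 (volume : Measure E3)}
    {u : ℝ → Lp E3 2 (volume : Measure E3)} (hu : IsWeakEulerSolution T u₀ u) :
    AEStronglyMeasurable (fun s => fluxForm hΦ hΦc (u s) (u s) (u s))
      (volume.restrict (Icc 0 T)) := by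
  have hum := aestronglyMeasurable_of_weaklyContinuous hu.weakly_continuous
  exact isBoundedBilinearMap_apply.continuous.comp_aestronglyMeasurable
    (((continuous_fluxForm_diag hΦ hΦc).comp_aestronglyMeasurable hum).prodMk hum)

end WeakSolution

/-! ### The squared mollifier and the limit of the energy -/

theorem mollify_comm (K L : E3 → ℝ) : mollify K L = mollify L K := by
  ext x
  rw [mollify_eq_swap]
  simp only [mollify, mul_comm]

/-- The squared mollifier `φₙ ⋆ φₙ`. -/
noncomputable def mollifierSq (n : ℕ) : E3 → ℝ := mollify (mollifier n) (mollifier n)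

theorem contDiff_mollifierSq (n : ℕ) : ContDiff ℝ ∞ (mollifierSq n) :=
  contDiff_mollify (contDiff_mollifier n) (hasCompactSupport_mollifier n)
    (contDiff_mollifier n).continuous.locallyIntegrable

theorem hasCompactSupport_mollifierSq (n : ℕ) : HasCompactSupport (mollifierSq n) :=
  hasCompactSupport_mollify (hasCompactSupport_mollifier n) (hasCompactSupport_mollifier n)

theorem mollifierSq_neg (n : ℕ) (x : E3) : mollifierSq n (-x) = mollifierSq n x :=
  mollify_neg_of_even (mollifier_neg n) (mollifier_neg n) x

/-- An even kernel acts symmetrically, so one of the two factors of `φ_n ⋆ φ_n` can be moved onto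
the first argument; the form becomes the squared `L²` norm of `φ_n ⋆ a`. -/
theorem energyForm_mollifierSq (n : ℕ) (a : Lp E3 2 (volume : Measure E3)) :
    energyForm (contDiff_mollifierSq n) (hasCompactSupport_mollifierSq n) a a
      = ∑ i, ∫ x, mollify (mollifier n) (coord i a) x * mollify (mollifier n) (coord i a) x := by
  rw [energyForm_apply]
  refine Finset.sum_congr rfl fun i _ => ?_
  have hK := contDiff_mollifier n
  have hKc := hasCompactSupport_mollifier n
  rw [mollifierSq, mollify_mollify hK.continuous hKc hK.continuous hKc
    (locallyIntegrable_coord i a), integral_mul_mollify_comm (mollifier_neg n)]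
  exact integrable_kernel_sq (hK.continuous.integrable_of_hasCompactSupport hKc)
    (memLp_coord i a) (memLp_mollify_coord hK hKc i a)

theorem tendsto_integral_sq_mollify {f : E3 → ℝ} (hf : MemLp f 2 volume) :
    Tendsto (fun n => ∫ x, mollify (mollifier n) f x * mollify (mollifier n) f x) atTop
      (𝓝 (∫ x, f x * f x)) := by
  have hm : ∀ n, MemLp (mollify (mollifier n) f) 2 volume := fun n =>
    memLp_mollify (by norm_num) (by simp) (contDiff_mollifier n) (hasCompactSupport_mollifier n) hf
  have h1 : Tendsto (fun n => (hm n).toLp _) atTop (𝓝 (hf.toLp f)) :=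
    (Lp.tendsto_Lp_iff_tendsto_eLpNorm'' _ hm _ hf).2 (tendsto_eLpNorm_mollify_sub hf)
  have h2 := h1.inner (𝕜 := ℝ) h1
  have key : ∀ {g : E3 → ℝ} (hg : MemLp g 2 volume),
      inner ℝ (hg.toLp g) (hg.toLp g) = ∫ x, g x * g x := by
    intro g hg
    rw [L2.inner_def]
    refine integral_congr_ae ?_
    filter_upwards [hg.coeFn_toLp] with x hx
    simp [hx, sq]
  simpa only [key] using h2

theorem tendsto_energyForm (a : Lp E3 2 (volume : Measure E3)) :
    Tendsto (fun n => energyForm (contDiff_mollifierSq n) (hasCompactSupport_mollifierSq n) a a)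
      atTop (𝓝 (∫ x, ‖a x‖ ^ 2)) := by
  have h : ∫ x, ‖a x‖ ^ 2 = ∑ i, ∫ x, coord i a x * coord i a x := by
    rw [← integral_finsetSum _ fun i _ => integrable_coord_mul_coord i i a a]
    refine integral_congr_ae (.of_forall fun x => ?_)
    simp only [EuclideanSpace.norm_sq_eq, Real.norm_eq_abs, sq_abs, coord]
    exact Finset.sum_congr rfl fun i _ => sq _
  rw [h]
  simp_rw [energyForm_mollifierSq]
  exact tendsto_finsetSum _ fun i _ => tendsto_integral_sq_mollify (memLp_coord i a)

/-! ### The flux in terms of increments -/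

section Flux

variable (n : ℕ) (a : Lp E3 2 (volume : Measure E3))

/-- The gradient of the mollified field. -/
noncomputable def mollGrad (i j : Fin 3) : E3 → ℝ :=
  mollify (partialD i (mollifier n)) (coord j a)

/-- The Reynolds stress of the mollification. -/
noncomputable def stress (i j : Fin 3) (x : E3) : ℝ :=
  mollify (mollifier n) (fun y => coord i a y * coord j a y) x
    - mollify (mollifier n) (coord i a) x * mollify (mollifier n) (coord j a) x

theorem contDiff_partialD_mollifier (i : Fin 3) : ContDiff ℝ ∞ (partialD i (mollifier n)) :=
  contDiff_partialD (contDiff_mollifier n) i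

theorem hasCompactSupport_partialD_mollifier (i : Fin 3) :
    HasCompactSupport (partialD i (mollifier n)) :=
  hasCompactSupport_partialD (hasCompactSupport_mollifier n) i

theorem exists_abs_mollGrad_le (i j : Fin 3) : ∃ C, ∀ x, |mollGrad n a i j x| ≤ C :=
  ⟨_, abs_mollify_coord_le (contDiff_partialD_mollifier n i).continuous
    (hasCompactSupport_partialD_mollifier n i) j a⟩

theorem continuous_mollGrad (i j : Fin 3) : Continuous (mollGrad n a i j) :=
  continuous_mollify_coord (contDiff_partialD_mollifier n i)
    (hasCompactSupport_partialD_mollifier n i) j a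

theorem integrable_mul_mollGrad {f : E3 → ℝ} (hf : Integrable f volume) (i j : Fin 3) :
    Integrable (fun x => f x * mollGrad n a i j x) volume :=
  integrable_mul_mollify_coord hf (contDiff_partialD_mollifier n i)
    (hasCompactSupport_partialD_mollifier n i) j a

theorem partialD_mollify_coord (i j : Fin 3) :
    partialD i (mollify (mollifier n) (coord j a)) = mollGrad n a i j :=
  partialD_mollify (contDiff_mollifier n) (hasCompactSupport_mollifier n)
    (locallyIntegrable_coord j a) i

theorem integrable_mollify_mul_mollify (i j : Fin 3) : Integrable (fun x =>
    mollify (mollifier n) (coord i a) x * mollify (mollifier n) (coord j a) x) volume :=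
  integrable_mul_of_memLp
    (memLp_mollify_coord (contDiff_mollifier n) (hasCompactSupport_mollifier n) i a)
    (memLp_mollify_coord (contDiff_mollifier n) (hasCompactSupport_mollifier n) j a)

theorem integrable_mollify_coord_mul_coord (i j : Fin 3) : Integrable
    (mollify (mollifier n) (fun y => coord i a y * coord j a y)) volume :=
  memLp_one_iff_integrable.1 (memLp_mollify (by norm_num) (by simp) (contDiff_mollifier n)
    (hasCompactSupport_mollifier n)
    (memLp_one_iff_integrable.2 (integrable_coord_mul_coord i j a a)))

theorem integrable_stress (i j : Fin 3) : Integrable (stress n a i j) volume :=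
  (integrable_mollify_coord_mul_coord n a i j).sub (integrable_mollify_mul_mollify n a i j)

theorem fluxForm_mollifierSq :
    fluxForm (contDiff_mollifierSq n) (hasCompactSupport_mollifierSq n) a a a
      = ∑ i, ∑ j, ∫ x, mollify (mollifier n) (fun y => coord i a y * coord j a y) x
        * mollGrad n a i j x := by
  rw [fluxForm_apply]
  refine Finset.sum_congr rfl fun i _ => Finset.sum_congr rfl fun j _ => ?_
  have hK := contDiff_mollifier n
  have hKc := hasCompactSupport_mollifier n
  have e : mollify (partialD i (mollifierSq n)) (coord j a)
      = mollify (mollifier n) (mollGrad n a i j) := by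
    rw [mollifierSq, partialD_mollify hK hKc hK.continuous.locallyIntegrable, mollify_comm _
      (mollifier n), mollify_mollify hK.continuous hKc (contDiff_partialD_mollifier n i).continuous
      (hasCompactSupport_partialD_mollifier n i) (locallyIntegrable_coord j a)]
    rfl
  obtain ⟨C, hC⟩ := exists_abs_mollGrad_le n a i j
  rw [e, integral_mul_mollify_comm (mollifier_neg n)]
  exact integrable_kernel_left (hK.continuous.integrable_of_hasCompactSupport hKc)
    (integrable_coord_mul_coord i j a a) (continuous_mollGrad n a i j).aestronglyMeasurable hC

variable {a}

/-- The divergence of `φ_n ⋆ a` at `x` is the weak divergence of `a` tested against `φ_n(x - ·)`, up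
to sign. -/
theorem sum_mollGrad_eq_zero (ha : ∀ η : E3 → ℝ, ContDiff ℝ ∞ η → HasCompactSupport η →
    ∫ x, fderiv ℝ η x (a x) = 0) (x : E3) : ∑ i, mollGrad n a i i x = 0 := by
  have hK := contDiff_mollifier n
  have hKc := hasCompactSupport_mollifier n
  have h := ha _ (contDiff_comp_const_sub hK x) (hasCompactSupport_comp_const_sub hKc x)
  simp_rw [fderiv_apply_eq_sum, partialD_comp_sub hK, neg_mul, Finset.sum_neg_distrib] at h
  rw [integral_neg, neg_eq_zero] at h
  simp only [mollGrad, mollify_eq_swap]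
  rw [← integral_finsetSum _ fun i _ => integrable_mollify_integrand_swap
    (contDiff_partialD_mollifier n i).continuous (hasCompactSupport_partialD_mollifier n i)
    (locallyIntegrable_coord i a) x]
  exact h

/-- The mollified field does not transport its own energy. -/
theorem sum_integral_transport_eq_zero (ha : ∀ η : E3 → ℝ, ContDiff ℝ ∞ η →
    HasCompactSupport η → ∫ x, fderiv ℝ η x (a x) = 0) :
    ∑ i, ∑ j, ∫ x, mollify (mollifier n) (coord i a) x * mollify (mollifier n) (coord j a) x
      * mollGrad n a i j x = 0 := by
  have hK := contDiff_mollifier n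
  have hKc := hasCompactSupport_mollifier n
  have hv := fun i => contDiff_mollify hK hKc (locallyIntegrable_coord i a)
  rw [Finset.sum_comm]
  refine Finset.sum_eq_zero fun j _ => ?_
  have hsq : ∀ i x, fderiv ℝ (fun y => mollify (mollifier n) (coord j a) y
        * mollify (mollifier n) (coord j a) y) x (EuclideanSpace.single i 1)
      = 2 * (mollify (mollifier n) (coord j a) x * mollGrad n a i j x) := by
    intro i x
    have hd := (hv j).differentiable (by simp) x
    rw [← partialD_mollify_coord, fderiv_fun_mul hd hd]
    simp [partialD]
    ring
  have hI3 : ∀ i, Integrable (fun x => mollify (mollifier n) (coord i a) x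
      * (mollify (mollifier n) (coord j a) x * mollify (mollifier n) (coord j a) x)) volume := by
    intro i
    have := (integrable_mollify_mul_mollify n a j j).bdd_mul
      (hv i).continuous.aestronglyMeasurable
      (.of_forall fun x => abs_mollify_coord_le hK.continuous hKc i a x)
    exact this
  have hI1 : ∀ i, Integrable (fun x => mollGrad n a i i x
      * (mollify (mollifier n) (coord j a) x * mollify (mollifier n) (coord j a) x)) volume := by
    intro i
    simpa [mul_comm] using
      integrable_mul_mollGrad n a (integrable_mollify_mul_mollify n a j j) i i
  have hI2 : ∀ i, Integrable (fun x => mollify (mollifier n) (coord i a) x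
      * mollify (mollifier n) (coord j a) x * mollGrad n a i j x) volume := fun i =>
    integrable_mul_mollGrad n a (integrable_mollify_mul_mollify n a i j) i j
  -- With `v = φ_n ⋆ a`: `∫ v_i v_j ∂_i v_j = ½ ∫ v_i ∂_i (v_j²) = -½ ∫ (∂_i v_i) v_j²`. Boundedness
  -- of `v` and of its gradient gives the integrability; the sum over `i` is then a divergence.
  have hp : ∀ i, ∫ x, mollify (mollifier n) (coord i a) x * mollify (mollifier n) (coord j a) x
      * mollGrad n a i j x = -(1 / 2) * ∫ x, mollGrad n a i i x
        * (mollify (mollifier n) (coord j a) x * mollify (mollifier n) (coord j a) x) := by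
    intro i
    have h := integral_mul_fderiv_eq_neg_fderiv_mul_of_integrable (μ := (volume : Measure E3))
      (f := mollify (mollifier n) (coord i a)) (v := EuclideanSpace.single i 1)
      (g := fun y => mollify (mollifier n) (coord j a) y * mollify (mollifier n) (coord j a) y)
      (by
        refine (hI1 i).congr (.of_forall fun x => ?_)
        simp only [← partialD_mollify_coord, partialD])
      (by
        refine ((hI2 i).const_mul 2).congr (.of_forall fun x => ?_)
        simp only [hsq]
        ring) (hI3 i) (fun x _ => (hv i).differentiable (by simp) x)
      (fun x _ => ((hv j).mul (hv j)).differentiable (by simp) x)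
    simp only [hsq] at h
    have e1 : ∫ x, mollify (mollifier n) (coord i a) x
          * (2 * (mollify (mollifier n) (coord j a) x * mollGrad n a i j x))
        = 2 * ∫ x, mollify (mollifier n) (coord i a) x * mollify (mollifier n) (coord j a) x
          * mollGrad n a i j x := by
      rw [← integral_const_mul]
      exact integral_congr_ae (.of_forall fun x => by ring)
    have e2 : ∫ x, fderiv ℝ (mollify (mollifier n) (coord i a)) x (EuclideanSpace.single i 1)
          * (mollify (mollifier n) (coord j a) x * mollify (mollifier n) (coord j a) x)
        = ∫ x, mollGrad n a i i x
          * (mollify (mollifier n) (coord j a) x * mollify (mollifier n) (coord j a) x) := by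
      simp only [← partialD_mollify_coord, partialD]
    rw [e1, e2] at h
    linarith
  simp_rw [hp]
  rw [← Finset.mul_sum, ← integral_finsetSum _ fun i _ => hI1 i]
  simp_rw [← Finset.sum_mul, sum_mollGrad_eq_zero n ha]
  simp

/-- The transport term `∑ ∫ v_i v_j ∂_i v_j` is zero, so subtracting it costs nothing and turns `φ_n
⋆ (a_i a_j)` into the stress. -/
theorem fluxForm_eq_sum_stress (ha : ∀ η : E3 → ℝ, ContDiff ℝ ∞ η →
    HasCompactSupport η → ∫ x, fderiv ℝ η x (a x) = 0) :
    fluxForm (contDiff_mollifierSq n) (hasCompactSupport_mollifierSq n) a a a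
      = ∑ i, ∑ j, ∫ x, stress n a i j x * mollGrad n a i j x := by
  rw [fluxForm_mollifierSq, ← sub_zero (∑ i, ∑ j, _), ← sum_integral_transport_eq_zero n ha]
  simp only [← Finset.sum_sub_distrib]
  refine Finset.sum_congr rfl fun i _ => Finset.sum_congr rfl fun j _ => ?_
  rw [← integral_sub
    (integrable_mul_mollGrad n a (integrable_mollify_coord_mul_coord n a i j) i j)
    (integrable_mul_mollGrad n a (integrable_mollify_mul_mollify n a i j) i j)]
  simp only [stress, sub_mul]

/-- The vertical derivative of the vertical component is traded for horizontal ones. -/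
theorem integral_stress_mul_vertical (ha : ∀ η : E3 → ℝ, ContDiff ℝ ∞ η →
    HasCompactSupport η → ∫ x, fderiv ℝ η x (a x) = 0) (i j : Fin 3) :
    ∫ x, stress n a i j x * mollGrad n a 2 2 x
      = -(∫ x, stress n a i j x * mollGrad n a 0 0 x)
        - ∫ x, stress n a i j x * mollGrad n a 1 1 x := by
  have h0 : Integrable (fun x => -(stress n a i j x * mollGrad n a 0 0 x)) volume :=
    (integrable_mul_mollGrad n a (integrable_stress n a i j) 0 0).neg
  rw [← integral_neg, ← integral_sub h0
    (integrable_mul_mollGrad n a (integrable_stress n a i j) 1 1)]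
  refine integral_congr_ae (.of_forall fun x => ?_)
  have h := sum_mollGrad_eq_zero n ha x
  rw [Fin.sum_univ_three] at h
  have h2 : mollGrad n a 2 2 x = -mollGrad n a 0 0 x - mollGrad n a 1 1 x := by linarith
  simp only [h2]
  ring

instance holderTriple_three_three : ENNReal.HolderTriple 3 3 (3 / 2) where
  inv_add_inv_eq_inv := by
    rw [ENNReal.inv_div (by simp) (by simp), ← two_mul, div_eq_mul_inv]

instance holderTriple_three_halves_three : ENNReal.HolderTriple (3 / 2) 3 1 where
  inv_add_inv_eq_inv := by
    rw [ENNReal.inv_div (by simp) (by simp), inv_one, div_eq_mul_inv, ← add_one_mul]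
    norm_num
    exact ENNReal.mul_inv_cancel (by simp) (by simp)

variable (a)

/-- The Constantin–E–Titi identity: expand the product of increments and use `∫ φ_n = 1`. It
exhibits the stress as quadratic in increments. -/
theorem stress_eq (i j : Fin 3) (x : E3) : stress n a i j x
    = (∫ y, mollifier n y * ((coord i a (x - y) - coord i a x) * (coord j a (x - y) - coord j a x)))
      - (mollify (mollifier n) (coord i a) x - coord i a x)
        * (mollify (mollifier n) (coord j a) x - coord j a x) := by
  have hK := (contDiff_mollifier n).continuous
  have hKc := hasCompactSupport_mollifier n
  have h1 := integrable_mollify_integrand hK hKc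
    (integrable_coord_mul_coord i j a a).locallyIntegrable x
  have h2 := integrable_mollify_integrand hK hKc (locallyIntegrable_coord i a) x
  have h3 := integrable_mollify_integrand hK hKc (locallyIntegrable_coord j a) x
  have h4 : Integrable (mollifier n) volume := hK.integrable_of_hasCompactSupport hKc
  have e : (fun y => mollifier n y * ((coord i a (x - y) - coord i a x)
        * (coord j a (x - y) - coord j a x)))
      = fun y => mollifier n y * (coord i a (x - y) * coord j a (x - y))
        - coord j a x * (mollifier n y * coord i a (x - y))
        - coord i a x * (mollifier n y * coord j a (x - y))
        + coord i a x * coord j a x * mollifier n y := by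
    ext y
    ring
  have h5 : Integrable (fun y => mollifier n y * (coord i a (x - y) * coord j a (x - y))
      - coord j a x * (mollifier n y * coord i a (x - y))) volume := h1.sub (h2.const_mul _)
  have h6 : Integrable (fun y => mollifier n y * (coord i a (x - y) * coord j a (x - y))
      - coord j a x * (mollifier n y * coord i a (x - y))
      - coord i a x * (mollifier n y * coord j a (x - y))) volume := h5.sub (h3.const_mul _)
  rw [e, integral_add h6 (h4.const_mul _), integral_sub h5 (h3.const_mul _),
    integral_sub h1 (h2.const_mul _),
    integral_const_mul, integral_const_mul, integral_const_mul, integral_mollifier]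
  simp only [stress, mollify]
  ring

variable {a}

/-- Each of the two terms of `stress_eq` contributes `A * B`, by Hölder's inequality and Minkowski
averaging against a kernel of mass one. -/
theorem eLpNorm_stress_le {i j : Fin 3} {A B : ℝ≥0∞}
    (hA : ∀ y : E3, ‖y‖ ≤ (2 ^ n)⁻¹ → eLpNorm (fun x => coord i a (x - y) - coord i a x) 3 volume ≤ A)
    (hB : ∀ y : E3, ‖y‖ ≤ (2 ^ n)⁻¹ → eLpNorm (fun x => coord j a (x - y) - coord j a x) 3 volume ≤ B) :
    eLpNorm (stress n a i j) (3 / 2) volume ≤ 2 * (A * B) := by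
  have hK := (contDiff_mollifier n).continuous
  have hKc := hasCompactSupport_mollifier n
  have hp1 : (1 : ℝ≥0∞) ≤ 3 / 2 := by
    rw [ENNReal.le_div_iff_mul_le (by simp) (by simp)]
    norm_num
  have hp2 : (3 / 2 : ℝ≥0∞) ≠ ⊤ := (ENNReal.div_lt_top (by simp) (by simp)).ne
  have hmi := (memLp_coord i a).1
  have hmj := (memLp_coord j a).1
  have hsi : ∀ y : E3, AEStronglyMeasurable (fun x => coord i a (x - y) - coord i a x) volume :=
    fun y => (hmi.comp_measurePreserving (measurePreserving_sub_right volume y)).sub hmi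
  have hsj : ∀ y : E3, AEStronglyMeasurable (fun x => coord j a (x - y) - coord j a x) volume :=
    fun y => (hmj.comp_measurePreserving (measurePreserving_sub_right volume y)).sub hmj
  have hP : AEStronglyMeasurable (fun z : E3 × E3 => (coord i a (z.1 - z.2) - coord i a z.1)
      * (coord j a (z.1 - z.2) - coord j a z.1)) (volume.prod volume) :=
    (aestronglyMeasurable_increment hmi).mul (aestronglyMeasurable_increment hmj)
  have h1 : eLpNorm (fun x => ∫ y, mollifier n y * ((coord i a (x - y) - coord i a x)
      * (coord j a (x - y) - coord j a x))) (3 / 2) volume ≤ A * B := by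
    refine (eLpNorm_integral_smul_le (G := fun x y => (coord i a (x - y) - coord i a x)
      * (coord j a (x - y) - coord j a x)) hp1 hp2 hK.aestronglyMeasurable hP
      (A := A * B) fun y hy => ?_).trans_eq (by rw [eLpNorm_one_mollifier, one_mul])
    have hy' := norm_le_of_mollifier_ne_zero hy
    exact (eLpNorm_smul_le_mul_eLpNorm (p := 3) (q := 3) (hsj y) (hsi y)).trans
      (mul_le_mul' (hA y hy') (hB y hy'))
  have hd : ∀ {k : Fin 3} {C : ℝ≥0∞}, (∀ y : E3, ‖y‖ ≤ (2 ^ n)⁻¹ →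
      eLpNorm (fun x => coord k a (x - y) - coord k a x) 3 volume ≤ C) →
      eLpNorm (fun x => mollify (mollifier n) (coord k a) x - coord k a x) 3 volume ≤ C := by
    intro k C hC
    simp_rw [mollify_sub_self hK hKc (integral_mollifier n) (locallyIntegrable_coord k a)]
    refine (eLpNorm_integral_increment_le (by norm_num) (by simp) hK.aestronglyMeasurable
      (memLp_coord k a).1 fun y hy => hC y (norm_le_of_mollifier_ne_zero hy)).trans_eq ?_
    rw [eLpNorm_one_mollifier, one_mul]
  have hmd : ∀ k, AEStronglyMeasurable
      (fun x => mollify (mollifier n) (coord k a) x - coord k a x) volume := fun k =>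
    (memLp_mollify_coord (contDiff_mollifier n) hKc k a).1.sub (memLp_coord k a).1
  have h2 : eLpNorm (fun x => (mollify (mollifier n) (coord i a) x - coord i a x)
      * (mollify (mollifier n) (coord j a) x - coord j a x)) (3 / 2) volume ≤ A * B :=
    (eLpNorm_smul_le_mul_eLpNorm (p := 3) (q := 3) (hmd j) (hmd i)).trans
      (mul_le_mul' (hd hA) (hd hB))
  rw [funext (stress_eq n a i j), two_mul]
  refine (eLpNorm_sub_le ?_ ((hmd i).mul (hmd j)) hp1).trans (add_le_add h1 h2)
  exact ((hK.aestronglyMeasurable.comp_snd).mul hP).integral_prod_right'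

theorem eLpNorm_mollGrad_le {k l : Fin 3} {A : ℝ≥0∞}
    (hA : ∀ y : E3, ‖y‖ ≤ (2 ^ n)⁻¹ → eLpNorm (fun x => coord l a (x - y) - coord l a x) 3 volume ≤ A) :
    eLpNorm (mollGrad n a k l) 3 volume ≤ 2 ^ n * gradConst * A := by
  have hK := (contDiff_partialD_mollifier n k).continuous
  have hKc := hasCompactSupport_partialD_mollifier n k
  rw [mollGrad, funext (mollify_eq_increment hK hKc (integral_fderiv_eq_zero
    (contDiff_mollifier n) (hasCompactSupport_mollifier n) _) (locallyIntegrable_coord l a))]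
  refine (eLpNorm_integral_increment_le (by norm_num) (by simp) hK.aestronglyMeasurable
    (memLp_coord l a).1 fun y hy => hA y (norm_le_of_fderiv_mollifier_ne_zero hy)).trans ?_
  gcongr
  exact eLpNorm_one_fderiv_mollifier_le n k

/-- The direction `k` of differentiation does not affect the bound, and `l` need not equal `j`: this
freedom is needed once `∂_3 v_3` has been replaced by horizontal terms. -/
theorem enorm_integral_stress_mul_mollGrad_le {δ : Fin 3 → ℝ≥0∞}
    (hd : ∀ i, ∀ y : E3, ‖y‖ ≤ (2 ^ n)⁻¹ →
      eLpNorm (fun x => coord i a (x - y) - coord i a x) 3 volume ≤ δ i) (i j k l : Fin 3) :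
    ‖∫ x, stress n a i j x * mollGrad n a k l x‖ₑ
      ≤ 2 * (2 ^ n * gradConst) * (δ i * δ j * δ l) := by
  refine (enorm_integral_le_lintegral_enorm _).trans ?_
  rw [← eLpNorm_one_eq_lintegral_enorm]
  refine (eLpNorm_smul_le_mul_eLpNorm (p := 3 / 2) (q := 3)
    (continuous_mollGrad n a k l).aestronglyMeasurable
    (integrable_stress n a i j).aestronglyMeasurable).trans ?_
  refine (mul_le_mul' (eLpNorm_stress_le n (hd i) (hd j))
    (eLpNorm_mollGrad_le n (hd l))).trans_eq ?_
  ring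

/-- Every term of the flux carries a horizontal increment. -/
theorem enorm_fluxForm_le (ha : ∀ η : E3 → ℝ, ContDiff ℝ ∞ η →
    HasCompactSupport η → ∫ x, fderiv ℝ η x (a x) = 0) {δ : Fin 3 → ℝ≥0∞}
    (hd : ∀ i, ∀ y : E3, ‖y‖ ≤ (2 ^ n)⁻¹ →
      eLpNorm (fun x => coord i a (x - y) - coord i a x) 3 volume ≤ δ i) :
    ‖fluxForm (contDiff_mollifierSq n) (hasCompactSupport_mollifierSq n) a a a‖ₑ
      ≤ 2 * (2 ^ n * gradConst) *
        (δ 0 * δ 0 * δ 0 + δ 0 * δ 1 * δ 1 + δ 0 * δ 2 * δ 2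
          + (δ 1 * δ 0 * δ 0 + δ 1 * δ 1 * δ 1 + δ 1 * δ 2 * δ 2)
          + (δ 2 * δ 0 * δ 0 + δ 2 * δ 1 * δ 1 + (δ 2 * δ 2 * δ 0 + δ 2 * δ 2 * δ 1))) := by
  have hb := enorm_integral_stress_mul_mollGrad_le n hd
  rw [fluxForm_eq_sum_stress n ha]
  simp only [Fin.sum_univ_three]
  -- Indices start at `0`, so `(2, 2)` is the vertical-vertical entry, the only one bounded by
  -- vertical increments alone. Nine terms become ten.
  rw [integral_stress_mul_vertical n ha 2 2]
  simp only [mul_add]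
  refine (enorm_add_le _ _).trans (add_le_add ((enorm_add_le _ _).trans (add_le_add ?_ ?_)) ?_)
  · exact (enorm_add_le _ _).trans (add_le_add ((enorm_add_le _ _).trans
      (add_le_add (hb 0 0 0 0) (hb 0 1 0 1))) (hb 0 2 0 2))
  · exact (enorm_add_le _ _).trans (add_le_add ((enorm_add_le _ _).trans
      (add_le_add (hb 1 0 1 0) (hb 1 1 1 1))) (hb 1 2 1 2))
  · refine (enorm_add_le _ _).trans (add_le_add ((enorm_add_le _ _).trans
      (add_le_add (hb 2 0 2 0) (hb 2 1 2 1))) ?_)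
    refine enorm_sub_le.trans (add_le_add ?_ (hb 2 2 1 1))
    rw [enorm_neg]
    exact hb 2 2 0 0

end Flux

/-! ### Fourier multipliers as convolutions on `L³` -/

open FourierTransform in
theorem fourier_smulLeftCLM_fourierInv (X η : 𝓢(E3, ℂ)) :
    𝓕 (SchwartzMap.smulLeftCLM ℂ (X : E3 → ℂ) (𝓕⁻ η))
      = SchwartzMap.convolution (ContinuousLinearMap.lsmul ℂ ℂ) (𝓕 X) η := by
  suffices h : SchwartzMap.smulLeftCLM ℂ (X : E3 → ℂ) (𝓕⁻ η)
      = 𝓕⁻ (SchwartzMap.convolution (ContinuousLinearMap.lsmul ℂ ℂ) (𝓕 X) η) by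
    rw [h, FourierTransform.fourier_fourierInv_eq]
  ext x
  rw [SchwartzMap.smulLeftCLM_apply_apply X.hasTemperateGrowth, SchwartzMap.fourierInv_coe,
    SchwartzMap.fourierInv_coe, Real.fourierInv_eq_fourier_neg (SchwartzMap.convolution _ _ _ : E3 → ℂ),
    ← SchwartzMap.fourier_coe (SchwartzMap.convolution _ _ _), SchwartzMap.fourier_convolution_apply,
    Real.fourier_smul_convolution_eq (SchwartzMap.integrable _) (SchwartzMap.integrable _),
    ← Real.fourierInv_eq_fourier_neg, ← Real.fourierInv_eq_fourier_neg,
    ← SchwartzMap.fourierInv_coe (𝓕 X), FourierTransform.fourierInv_fourier_eq]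

open FourierTransform in
-- By duality the multiplier acts on the test function as `𝓕 (X · 𝓕⁻ η)`; hence the kernel is `𝓕 X`,
-- not its inverse transform.
theorem fourierMultiplierCLM_apply_eq_integral (X η : 𝓢(E3, ℂ)) (g : Lp ℂ 3 (volume : Measure E3)) :
    fourierMultiplierCLM ℂ (X : E3 → ℂ) (g : 𝓢'(E3, ℂ)) η
      = ∫ x, (∫ y, (𝓕 X : 𝓢(E3, ℂ)) (x - y) * η y) * g x := by
  rw [fourierMultiplierCLM_apply, TemperedDistribution.fourierInv_apply,
    TemperedDistribution.smulLeftCLM_apply_apply, TemperedDistribution.fourier_apply,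
    fourier_smulLeftCLM_fourierInv, Lp.toTemperedDistribution_apply]
  refine integral_congr_ae (.of_forall fun x => ?_)
  simp only [smul_eq_mul]
  rw [SchwartzMap.convolution_apply, convolution_lsmul_swap]
  simp

theorem lintegral_enorm_mul_le_three {K g : E3 → ℂ} (hK : AEStronglyMeasurable K volume)
    (hg : AEStronglyMeasurable g volume) :
    ∫⁻ x, ‖K x * g x‖ₑ ≤ eLpNorm K (3 / 2) volume * eLpNorm g 3 volume := by
  have := eLpNorm_smul_le_mul_eLpNorm (p := 3 / 2) (q := 3) (r := 1) hg hK
  rwa [eLpNorm_one_eq_lintegral_enorm] at this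

theorem integrable_kernel_three {K η : 𝓢(E3, ℂ)} {g : E3 → ℂ} (hg : MemLp g 3 volume) :
    Integrable (fun z : E3 × E3 => K (z.1 - z.2) * η z.2 * g z.1) (volume.prod volume) := by
  have hm : AEStronglyMeasurable (fun z : E3 × E3 => K (z.1 - z.2) * η z.2 * g z.1)
      (volume.prod volume) := by
    refine AEStronglyMeasurable.mul ?_ hg.1.comp_fst
    have := K.continuous
    have := η.continuous
    exact Continuous.aestronglyMeasurable (by fun_prop)
  refine ⟨hm, ?_⟩
  rw [hasFiniteIntegral_iff_enorm, lintegral_prod_symm _ hm.enorm]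
  have h1 : ∀ y, ∫⁻ x, ‖K (x - y) * η y * g x‖ₑ
      ≤ ‖η y‖ₑ * (eLpNorm K (3 / 2) volume * eLpNorm g 3 volume) := fun y => by
    have h2 := lintegral_enorm_mul_le_three (K := fun x => K (x - y))
      (K.continuous.comp (by fun_prop)).aestronglyMeasurable hg.1
    have h3 : eLpNorm (fun x => K (x - y)) (3 / 2) volume = eLpNorm K (3 / 2) volume :=
      eLpNorm_comp_measurePreserving (f := fun x : E3 => x - y) K.continuous.aestronglyMeasurable
        (measurePreserving_sub_right volume y)
    rw [h3] at h2
    refine le_trans (le_of_eq ?_) (mul_le_mul_right h2 _)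
    rw [← lintegral_const_mul' _ _ enorm_ne_top]
    refine lintegral_congr fun x => ?_
    rw [← enorm_mul]
    congr 1
    ring
  refine (lintegral_mono h1).trans_lt ?_
  rw [lintegral_mul_const' _ _ (ENNReal.mul_ne_top (K.memLp _ _).2.ne hg.2.ne)]
  exact ENNReal.mul_lt_top (η.integrable).2 (ENNReal.mul_lt_top (K.memLp _ _).2 hg.2)

theorem aestronglyMeasurable_shift_add {F : Type*} [TopologicalSpace F]
    {g : E3 → F} (hg : AEStronglyMeasurable g volume) :
    AEStronglyMeasurable (fun z : E3 × E3 => g (z.1 + z.2)) (volume.prod volume) :=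
  hg.comp_quasiMeasurePreserving (Measure.quasiMeasurePreserving_fst.comp
    (measurePreserving_add_prod volume volume).quasiMeasurePreserving)

theorem eLpNorm_kernel_le {K g : E3 → ℂ} (hK : AEStronglyMeasurable K volume)
    (hg : AEStronglyMeasurable g volume) :
    eLpNorm (fun y => ∫ t, K t * g (y + t)) 3 volume ≤ eLpNorm K 1 volume * eLpNorm g 3 volume := by
  refine eLpNorm_integral_smul_le (G := fun y t => g (y + t)) (by norm_num) (by simp) hK
    (aestronglyMeasurable_shift_add hg) fun y _ => le_of_eq ?_
  exact eLpNorm_comp_measurePreserving (f := fun x : E3 => x + y) hg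
    (measurePreserving_add_right volume y)

theorem exists_schwartzMap_ofReal_eq {θ : E3 → ℝ} (hθ : ContDiff ℝ ∞ θ) (hθc : HasCompactSupport θ) :
    ∃ η : 𝓢(E3, ℂ), ∀ x, η x = θ x :=
  ⟨(hθc.comp_left (g := Complex.ofReal) (by simp)).toSchwartzMap
    (Complex.ofRealCLM.contDiff.comp hθ), fun _ => rfl⟩

open FourierTransform in
/-- A function whose spectrum lies where the symbol is `1` is reproduced by the kernel. -/
theorem ae_eq_integral_of_fourierMultiplierCLM_eq {X : 𝓢(E3, ℂ)} {g : Lp ℂ 3 (volume : Measure E3)}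
    (h : fourierMultiplierCLM ℂ (X : E3 → ℂ) (g : 𝓢'(E3, ℂ)) = g) :
    ∀ᵐ y, g y = ∫ t, (𝓕 X : 𝓢(E3, ℂ)) t * g (y + t) := by
  have hg := Lp.memLp g
  have hw := fun η => fourierMultiplierCLM_apply_eq_integral X η g
  rw [h] at hw
  generalize (𝓕 X : 𝓢(E3, ℂ)) = K at hw ⊢
  have hm : AEStronglyMeasurable (fun y => ∫ t, K t * g (y + t)) volume :=
    ((K.continuous.aestronglyMeasurable.comp_snd).mul
      (aestronglyMeasurable_shift_add hg.1)).integral_prod_right'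
  have hL : MemLp (fun y => ∫ t, K t * g (y + t)) 3 volume :=
    ⟨hm, (eLpNorm_kernel_le K.continuous.aestronglyMeasurable hg.1).trans_lt
      (ENNReal.mul_lt_top (K.memLp _ _).2 hg.2)⟩
  refine ae_eq_of_integral_contDiff_smul_eq (hg.locallyIntegrable (by norm_num))
    (hL.locallyIntegrable (by norm_num)) fun θ hθ hθc => ?_
  obtain ⟨η, hηx⟩ : ∃ η : 𝓢(E3, ℂ), ∀ x, η x = θ x := exists_schwartzMap_ofReal_eq hθ hθc
  have h1 := hw η
  rw [Lp.toTemperedDistribution_apply] at h1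
  have h2 : ∫ x, θ x • g x = ∫ x, η x • g x := by simp [hηx]
  rw [h2, h1]
  simp_rw [← integral_mul_const]
  rw [integral_integral_swap (integrable_kernel_three hg)]
  refine integral_congr_ae (.of_forall fun y => ?_)
  simp only [Complex.real_smul, ← hηx]
  -- The substitution `x = y + t` gives the form `g (y + t)` of the reproducing formula.
  rw [← integral_const_mul, ← integral_add_right_eq_self _ y]
  refine integral_congr_ae (.of_forall fun t => ?_)
  simp only [add_sub_cancel_right]
  rw [add_comm y t]
  ring

open FourierTransform in
theorem fourier_comp_inv_smul {X Y : E3 → ℂ} {l : ℝ} (hl : 0 < l) (h : ∀ ξ, Y ξ = X (l⁻¹ • ξ))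
    (t : E3) : 𝓕 Y t = dilate l (𝓕 X) t := by
  simp only [dilate, Real.fourier_eq]
  have h1 := Measure.integral_comp_smul (volume : Measure E3)
    (fun v => Real.fourierChar (-inner ℝ v (l • t)) • X v) l⁻¹
  rw [finrank_euclideanSpace, Fintype.card_fin, inv_pow, inv_inv, abs_of_pos (by positivity)] at h1
  rw [← h1]
  refine integral_congr_ae (.of_forall fun v => ?_)
  simp only [h, real_inner_smul_left, real_inner_smul_right]
  rw [mul_inv_cancel_left₀ hl.ne']

/-- The increment is the integral of the derivative along the segment from `t` to `t + z`, and
translations preserve the `L¹` norm. -/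
theorem eLpNorm_one_increment_le (K : 𝓢(E3, ℂ)) (z : E3) :
    eLpNorm (fun t => K (t + z) - K t) 1 volume ≤ ‖z‖ₑ * eLpNorm (fderiv ℝ K) 1 volume := by
  have hc : Continuous (fderiv ℝ K) := (K.smooth 1).continuous_fderiv (by simp)
  have h1 : ∀ t, K (t + z) - K t
      = ∫ s, (1 : ℝ) • fderiv ℝ K (t + s • z) z ∂(volume.restrict (Ioc (0 : ℝ) 1)) := fun t => by
    have hd : ∀ s ∈ uIcc (0 : ℝ) 1,
        HasDerivAt (fun s : ℝ => K (t + s • z)) (fderiv ℝ K (t + s • z) z) s := fun s _ => by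
      have h2 : HasDerivAt (fun s : ℝ => t + s • z) z s := by
        simpa using ((hasDerivAt_id s).smul_const z).const_add t
      exact K.differentiableAt.hasFDerivAt.comp_hasDerivAt s h2
    have := intervalIntegral.integral_eq_sub_of_hasDerivAt hd
      (Continuous.intervalIntegrable (by fun_prop) _ _)
    simp only [one_smul, zero_smul, add_zero] at this ⊢
    rw [← this, intervalIntegral.integral_of_le zero_le_one]
  simp_rw [h1]
  refine (eLpNorm_integral_smul_le (G := fun t s => fderiv ℝ K (t + s • z) z)
    (A := ‖z‖ₑ * eLpNorm (fderiv ℝ K) 1 volume) le_rfl (by simp)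
    aestronglyMeasurable_const (Continuous.aestronglyMeasurable ?_) fun s _ => ?_).trans
    (le_of_eq ?_)
  · simp only [Function.uncurry_def]
    fun_prop
  · rw [← eLpNorm_comp_measurePreserving (f := fun x : E3 => x + s • z) hc.aestronglyMeasurable
      (measurePreserving_add_right volume (s • z)), eLpNorm_one_eq_lintegral_enorm,
      eLpNorm_one_eq_lintegral_enorm, ← lintegral_const_mul' _ _ enorm_ne_top]
    refine lintegral_mono fun t => ?_
    rw [mul_comm]
    exact ContinuousLinearMap.le_opENorm _ _
  · simp [eLpNorm_one_eq_lintegral_enorm]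

theorem eLpNorm_one_increment_le_two_mul (K : 𝓢(E3, ℂ)) (z : E3) :
    eLpNorm (fun t => K (t + z) - K t) 1 volume ≤ 2 * eLpNorm K 1 volume := by
  have hm := K.continuous.aestronglyMeasurable (μ := (volume : Measure E3))
  have h := eLpNorm_sub_le (p := 1) (f := fun t => K (t + z)) (g := K) (μ := volume)
    (K.continuous.comp (by fun_prop)).aestronglyMeasurable hm le_rfl
  refine h.trans (le_of_eq ?_)
  have h3 : eLpNorm (fun x => K (x + z)) 1 volume = eLpNorm K 1 volume :=
      eLpNorm_comp_measurePreserving (f := fun x : E3 => x + z) hm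
        (measurePreserving_add_right volume z)
  rw [h3, two_mul]

theorem exists_eLpNorm_one_increment_le (K : 𝓢(E3, ℂ)) :
    ∃ C : ℝ≥0∞, C ≠ ⊤ ∧ ∀ z, eLpNorm (fun t => K (t + z) - K t) 1 volume
      ≤ C * ENNReal.ofReal (min 1 ‖z‖) := by
  have h1 : eLpNorm (fderiv ℝ K) 1 volume ≠ ⊤ :=
    ((SchwartzMap.fderivCLM ℝ E3 ℂ K).memLp 1 volume).2.ne
  refine ⟨2 * eLpNorm K 1 volume + eLpNorm (fderiv ℝ K) 1 volume,
    ENNReal.add_ne_top.2 ⟨ENNReal.mul_ne_top (by simp) (K.memLp 1 volume).2.ne, h1⟩, fun z => ?_⟩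
  rcases le_total ‖z‖ 1 with h | h
  · rw [min_eq_right h, ofReal_norm, mul_comm]
    exact (eLpNorm_one_increment_le K z).trans (mul_le_mul_right le_add_self _)
  · rw [min_eq_left h, ENNReal.ofReal_one, mul_one]
    exact (eLpNorm_one_increment_le_two_mul K z).trans le_self_add

theorem eLpNorm_one_dilate_increment {l : ℝ} (hl : 0 < l) (K : E3 → ℂ) (z : E3) :
    eLpNorm (fun t => dilate l K (t + z) - dilate l K t) 1 volume
      = eLpNorm (fun t => K (t + l • z) - K t) 1 volume := by
  rw [← eLpNorm_one_dilate hl (fun t => K (t + l • z) - K t)]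
  congr 1
  ext t
  simp only [dilate, smul_add, smul_sub]

theorem integrable_mul_three {K g : E3 → ℂ} (hK : MemLp K (3 / 2) volume) (hg : MemLp g 3 volume) :
    Integrable (fun t => K t * g t) :=
  ⟨hK.1.mul hg.1, (lintegral_enorm_mul_le_three hK.1 hg.1).trans_lt (ENNReal.mul_lt_top hK.2 hg.2)⟩

/-- Shifting the variable of integration in the reproducing formula moves the increment from `g`
onto the kernel. -/
theorem eLpNorm_increment_le_of_kernel {K : 𝓢(E3, ℂ)} {g : E3 → ℂ} (hg : MemLp g 3 volume)
    (h : ∀ᵐ y, g y = ∫ t, K t * g (y + t)) (z : E3) :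
    eLpNorm (fun y => g (y - z) - g y) 3 volume
      ≤ eLpNorm (fun t => K (t + z) - K t) 1 volume * eLpNorm g 3 volume := by
  have h1 : ∀ᵐ y, g (y - z) = ∫ t, K t * g (y - z + t) :=
    (measurePreserving_sub_right volume z).quasiMeasurePreserving.ae h
  have h2 : (fun y => g (y - z) - g y) =ᵐ[volume] fun y => ∫ t, (K (t + z) - K t) * g (y + t) := by
    filter_upwards [h, h1] with y hy hy1
    have hs : MemLp (fun t => g (y + t)) 3 volume :=
      hg.comp_measurePreserving (measurePreserving_add_left volume y)
    have hs' : MemLp (fun t => K (t + z)) (3 / 2) volume :=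
      (K.memLp (3 / 2) volume).comp_measurePreserving (measurePreserving_add_right volume z)
    simp_rw [sub_mul]
    rw [integral_sub (integrable_mul_three hs' hs)
      (integrable_mul_three (K.memLp (3 / 2) volume) hs), ← hy, hy1,
      ← integral_add_right_eq_self _ z]
    congr 1
    refine integral_congr_ae (.of_forall fun t => ?_)
    simp only
    congr 2
    abel
  rw [eLpNorm_congr_ae h2]
  refine eLpNorm_kernel_le (K := fun t => K (t + z) - K t) ?_ hg.1
  exact ((K.continuous.comp (by fun_prop)).sub K.continuous).aestronglyMeasurable

/-! ### Increments of band-limited functions -/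

noncomputable def cutoffBump : ContDiffBump (0 : E3) := ⟨3, 4, by norm_num, by norm_num⟩

/-- A smooth cut-off to the ball of radius `4 l`, equal to `1` on the ball of radius `3 l`. -/
noncomputable def cutoff (l : ℝ) (ξ : E3) : ℝ := cutoffBump (l⁻¹ • ξ)

theorem contDiff_cutoff (l : ℝ) : ContDiff ℝ ∞ (cutoff l) :=
  cutoffBump.contDiff.comp (contDiff_const_smul _)

theorem hasCompactSupport_cutoff {l : ℝ} (hl : 0 < l) : HasCompactSupport (cutoff l) :=
  cutoffBump.hasCompactSupport.comp_smul (inv_pos.2 hl).ne'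

theorem cutoff_eq_one {l : ℝ} (hl : 0 < l) {ξ : E3} (h : ‖ξ‖ ≤ 3 * l) : cutoff l ξ = 1 := by
  refine cutoffBump.one_of_mem_closedBall ?_
  rw [mem_closedBall_zero_iff, norm_smul, Real.norm_of_nonneg (by positivity), inv_mul_le_iff₀ hl]
  exact h.trans (le_of_eq (mul_comm _ _))

/-- Increments of functions with spectrum in a ball of radius `3 l`. -/
theorem exists_eLpNorm_increment_le : ∃ C : ℝ≥0∞, C ≠ ⊤ ∧ ∀ l : ℝ, 0 < l →
    ∀ g : Lp ℂ 3 (volume : Measure E3),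
      fourierMultiplierCLM ℂ (fun ξ => (cutoff l ξ : ℂ)) (g : 𝓢'(E3, ℂ)) = g → ∀ z : E3,
        eLpNorm (fun y => g (y - z) - g y) 3 volume
          ≤ C * ENNReal.ofReal (min 1 (l * ‖z‖)) * eLpNorm g 3 volume := by
  obtain ⟨X, hX⟩ := exists_schwartzMap_ofReal_eq (contDiff_cutoff 1)
    (hasCompactSupport_cutoff one_pos)
  -- The constant comes from the kernel at unit scale. The kernel for `l` is its `L¹`-normalized
  -- dilation, which turns `z` into `l • z`.
  obtain ⟨C, hC, hCz⟩ := exists_eLpNorm_one_increment_le (FourierTransform.fourier X)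
  refine ⟨C, hC, fun l hl g hg z => ?_⟩
  obtain ⟨Y, hY⟩ := exists_schwartzMap_ofReal_eq (contDiff_cutoff l) (hasCompactSupport_cutoff hl)
  have hg' : fourierMultiplierCLM ℂ (Y : E3 → ℂ) (g : 𝓢'(E3, ℂ)) = g := by
    rw [← hg]
    simp only [hg, funext hY]
  have h1 := eLpNorm_increment_le_of_kernel (Lp.memLp g) (ae_eq_integral_of_fourierMultiplierCLM_eq hg')
    z
  refine h1.trans (mul_le_mul_left ?_ _)
  have h2 : ∀ t, (FourierTransform.fourier Y : 𝓢(E3, ℂ)) t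
      = dilate l (FourierTransform.fourier X : 𝓢(E3, ℂ)) t := fun t => by
    rw [SchwartzMap.fourier_coe, SchwartzMap.fourier_coe]
    exact fourier_comp_inv_smul hl (fun ξ => by simp [hX, hY, cutoff]) t
  simp_rw [h2]
  rw [eLpNorm_one_dilate_increment hl]
  refine (hCz _).trans (le_of_eq ?_)
  rw [norm_smul, Real.norm_of_nonneg hl.le]

/-! ### Dyadic blocks, reconstruction and increments -/

namespace DyadicPartition

variable (P : DyadicPartition)

/-- The symbol of the block `Δ_{k-1}`. -/
noncomputable def symbol : ℕ → E3 → ℝ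
  | 0, ξ => P.low ξ
  | k + 1, ξ => P.shell ((2 : ℝ) ^ (-(k : ℤ)) • ξ)

theorem block_eq_fourierMultiplierCLM (k : ℕ) (f : 𝓢'(E3, ℂ)) :
    P.block (k - 1) f = fourierMultiplierCLM ℂ (fun ξ => (P.symbol k ξ : ℂ)) f := by
  rcases k with _ | k
  · simp [block, symbol]
  · have h1 : ¬ ((k + 1 : ℕ) : ℤ) - 1 ≤ -2 := by omega
    have h2 : ¬ ((k + 1 : ℕ) : ℤ) - 1 = -1 := by omega
    simp only [block, h1, h2, if_false, symbol]
    simp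

theorem block_eq_zero {j : ℤ} (hj : j ≤ -2) (f : 𝓢'(E3, ℂ)) : P.block j f = 0 := by
  simp [block, hj]

theorem symbol_nonneg (k : ℕ) (ξ : E3) : 0 ≤ P.symbol k ξ := by
  rcases k with _ | k
  · exact P.low_nonneg ξ
  · exact P.shell_nonneg _

theorem contDiff_symbol (k : ℕ) : ContDiff ℝ ∞ (P.symbol k) := by
  rcases k with _ | k
  · exact P.low_smooth
  · exact P.shell_smooth.comp (contDiff_const_smul _)

/-- The support radii are `4/3 ≤ 3/2` for the low block, where `k = 0`, and `(8/3) 2^j ≤ 3 · 2^j`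
for the block `j = k - 1 ≥ 0`; so `cutoff` at scale `2^{k-1}` equals `1` on the support. -/
theorem norm_le_of_symbol_ne_zero {k : ℕ} {ξ : E3} (h : P.symbol k ξ ≠ 0) :
    ‖ξ‖ ≤ 3 * 2 ^ ((k : ℤ) - 1) := by
  rcases k with _ | k
  · have : ‖ξ‖ ≤ 4 / 3 := P.low_support h
    refine this.trans ?_
    norm_num
  · have h1 : ‖(2 : ℝ) ^ (-(k : ℤ)) • ξ‖ ≤ 8 / 3 := (P.shell_support h).2
    rw [norm_smul, Real.norm_of_nonneg (by positivity), zpow_neg, inv_mul_le_iff₀ (by positivity)]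
      at h1
    refine h1.trans ?_
    have : (0 : ℝ) < 2 ^ (k : ℤ) := by positivity
    push_cast
    rw [add_sub_cancel_right]
    linarith

theorem hasCompactSupport_symbol (k : ℕ) : HasCompactSupport (P.symbol k) :=
  .of_support_subset_isCompact (isCompact_closedBall 0 (3 * 2 ^ ((k : ℤ) - 1)))
    fun _ hξ => mem_closedBall_zero_iff.2 (P.norm_le_of_symbol_ne_zero hξ)

theorem hasSum_symbol (ξ : E3) : HasSum (fun k => P.symbol k ξ) 1 := by
  refine (hasSum_nat_add_iff' 1).1 ?_
  simpa [symbol] using P.sum_inhomogeneous ξ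

end DyadicPartition

theorem hasTemperateGrowth_ofReal_comp {θ : E3 → ℝ} (hθ : ContDiff ℝ ∞ θ)
    (hθc : HasCompactSupport θ) : Function.HasTemperateGrowth (fun ξ => (θ ξ : ℂ)) := by
  obtain ⟨η, hη⟩ := exists_schwartzMap_ofReal_eq hθ hθc
  rw [← funext hη]
  exact η.hasTemperateGrowth

theorem DyadicPartition.fourierMultiplierCLM_cutoff_block (P : DyadicPartition) (k : ℕ)
    (f : 𝓢'(E3, ℂ)) :
    fourierMultiplierCLM ℂ (fun ξ => (cutoff (2 ^ ((k : ℤ) - 1)) ξ : ℂ)) (P.block (k - 1) f)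
      = P.block (k - 1) f := by
  have hl : (0 : ℝ) < 2 ^ ((k : ℤ) - 1) := by positivity
  rw [block_eq_fourierMultiplierCLM, fourierMultiplierCLM_fourierMultiplierCLM_apply
    (hasTemperateGrowth_ofReal_comp (P.contDiff_symbol k) (P.hasCompactSupport_symbol k))
    (hasTemperateGrowth_ofReal_comp (contDiff_cutoff _) (hasCompactSupport_cutoff hl))]
  congr 2
  ext ξ
  by_cases h : P.symbol k ξ = 0
  · simp [h]
  · simp [cutoff_eq_one hl (P.norm_le_of_symbol_ne_zero h)]

open FourierTransform in
/-- Littlewood–Paley reconstruction of square-integrable functions. -/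
theorem DyadicPartition.tendsto_sum_block (P : DyadicPartition) (f : Lp ℂ 2 (volume : Measure E3))
    (η : 𝓢(E3, ℂ)) :
    Tendsto (fun N => ∑ k ∈ Finset.range N, P.block ((k : ℤ) - 1) (f : 𝓢'(E3, ℂ)) η) atTop
      (𝓝 ((f : 𝓢'(E3, ℂ)) η)) := by
  -- By Plancherel the Fourier transform is a function, so the claim is dominated convergence: the
  -- partial sums of the symbols lie in `[0, 1]` and tend to `1`.
  obtain ⟨F, hF⟩ : ∃ F : Lp ℂ 2 (volume : Measure E3), 𝓕 (f : 𝓢'(E3, ℂ)) = F :=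
    ⟨_, Lp.fourier_toTemperedDistribution_eq f⟩
  have hint : Integrable (fun ξ => (𝓕⁻ η : 𝓢(E3, ℂ)) ξ * F ξ) :=
    ((𝓕⁻ η : 𝓢(E3, ℂ)).memLp 2 volume).integrable_mul (Lp.memLp F)
  have hterm : ∀ k : ℕ, P.block ((k : ℤ) - 1) (f : 𝓢'(E3, ℂ)) η
      = ∫ ξ, (P.symbol k ξ : ℂ) * ((𝓕⁻ η : 𝓢(E3, ℂ)) ξ * F ξ) := fun k => by
    rw [block_eq_fourierMultiplierCLM, fourierMultiplierCLM_apply,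
      TemperedDistribution.fourierInv_apply, TemperedDistribution.smulLeftCLM_apply_apply, hF,
      Lp.toTemperedDistribution_apply]
    refine integral_congr_ae (.of_forall fun ξ => ?_)
    simp only
    rw [SchwartzMap.smulLeftCLM_apply_apply
      (hasTemperateGrowth_ofReal_comp (P.contDiff_symbol k) (P.hasCompactSupport_symbol k)),
      smul_eq_mul, smul_eq_mul, mul_assoc]
  have hlim : (f : 𝓢'(E3, ℂ)) η = ∫ ξ, (𝓕⁻ η : 𝓢(E3, ℂ)) ξ * F ξ := by
    have h1 : (f : 𝓢'(E3, ℂ)) = 𝓕⁻ (F : 𝓢'(E3, ℂ)) := by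
      rw [← hF, FourierTransform.fourierInv_fourier_eq]
    rw [h1, TemperedDistribution.fourierInv_apply, Lp.toTemperedDistribution_apply]
    rfl
  have hsm : ∀ k, Continuous (P.symbol k) := fun k => (P.contDiff_symbol k).continuous
  have hs1 : ∀ N ξ, ∑ k ∈ Finset.range N, P.symbol k ξ ≤ 1 := fun N ξ =>
    sum_le_hasSum _ (fun k _ => P.symbol_nonneg k ξ) (P.hasSum_symbol ξ)
  have hs0 : ∀ N ξ, 0 ≤ ∑ k ∈ Finset.range N, P.symbol k ξ := fun N ξ =>
    Finset.sum_nonneg fun k _ => P.symbol_nonneg k ξ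
  have hti : ∀ k, Integrable (fun ξ => (P.symbol k ξ : ℂ) * ((𝓕⁻ η : 𝓢(E3, ℂ)) ξ * F ξ)) :=
    fun k => hint.bdd_mul (c := 1)
      (Complex.continuous_ofReal.comp (hsm k)).aestronglyMeasurable (.of_forall fun ξ => by
        rw [Complex.norm_real, Real.norm_of_nonneg (P.symbol_nonneg k ξ)]
        exact le_hasSum (P.hasSum_symbol ξ) k fun j _ => P.symbol_nonneg j ξ)
  simp_rw [hterm, hlim]
  have hsum : ∀ N, ∑ k ∈ Finset.range N, ∫ ξ, (P.symbol k ξ : ℂ) * ((𝓕⁻ η : 𝓢(E3, ℂ)) ξ * F ξ)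
      = ∫ ξ, ((∑ k ∈ Finset.range N, P.symbol k ξ : ℝ) : ℂ) * ((𝓕⁻ η : 𝓢(E3, ℂ)) ξ * F ξ) :=
    fun N => by
      rw [← integral_finsetSum _ fun k _ => hti k]
      simp_rw [← Finset.sum_mul, Complex.ofReal_sum]
  simp_rw [hsum]
  refine tendsto_integral_of_dominated_convergence _ (fun N => ?_) hint.norm
    (fun N => .of_forall fun ξ => ?_) (.of_forall fun ξ => ?_)
  · refine AEStronglyMeasurable.mul (Continuous.aestronglyMeasurable ?_) hint.1
    exact Complex.continuous_ofReal.comp (continuous_finsetSum _ fun k _ => hsm k)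
  · rw [norm_mul, Complex.norm_real, Real.norm_of_nonneg (hs0 N ξ)]
    exact mul_le_of_le_one_left (norm_nonneg _) (hs1 N ξ)
  · have := ((Complex.continuous_ofReal.tendsto 1).comp
      (P.hasSum_symbol ξ).tendsto_sum_nat).mul_const ((𝓕⁻ η : 𝓢(E3, ℂ)) ξ * F ξ)
    simpa using this

theorem toTemperedDistribution_injective (p : ℝ≥0∞) [Fact (1 ≤ p)] :
    Function.Injective (fun g : Lp ℂ p (volume : Measure E3) => (g : 𝓢'(E3, ℂ))) :=
  LinearMap.ker_eq_bot.1 (Lp.ker_toTemperedDistributionCLM_eq_bot (F := ℂ)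
    (μ := (volume : Measure E3)) (p := p))

/-- An `L^p` function is determined by its distribution, so the infimum runs over a single element.
-/
theorem distLpNorm_coe {p : ℝ≥0∞} [Fact (1 ≤ p)] (g : Lp ℂ p (volume : Measure E3)) :
    distLpNorm p (g : 𝓢'(E3, ℂ)) = ‖g‖ₑ := by
  refine le_antisymm (iInf₂_le (f := fun (g' : Lp ℂ p (volume : Measure E3))
    (_ : (g' : 𝓢'(E3, ℂ)) = (g : 𝓢'(E3, ℂ))) => ‖g'‖ₑ) g rfl) (le_iInf₂ fun g' h => ?_)
  rw [toTemperedDistribution_injective p h]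

theorem distLpNorm_zero {p : ℝ≥0∞} [Fact (1 ≤ p)] : distLpNorm p (0 : 𝓢'(E3, ℂ)) = 0 := by
  have h : ((0 : Lp ℂ p (volume : Measure E3)) : 𝓢'(E3, ℂ)) = 0 :=
    (Lp.toTemperedDistributionCLM ℂ (volume : Measure E3) p).map_zero
  rw [← h, distLpNorm_coe, enorm_zero]

theorem exists_coe_eq_of_distLpNorm_ne_top {p : ℝ≥0∞} [Fact (1 ≤ p)] {f : 𝓢'(E3, ℂ)}
    (h : distLpNorm p f ≠ ⊤) : ∃ g : Lp ℂ p (volume : Measure E3), (g : 𝓢'(E3, ℂ)) = f := by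
  by_contra! hg
  exact h (by simp [distLpNorm, hg])

/-- Allows different exponents: it identifies the `L²` component with the `L³` sum of its blocks. -/
theorem ae_eq_of_toTemperedDistribution_eq {p q : ℝ≥0∞} [Fact (1 ≤ p)] [Fact (1 ≤ q)]
    {f : Lp ℂ p (volume : Measure E3)} {g : Lp ℂ q (volume : Measure E3)}
    (h : (f : 𝓢'(E3, ℂ)) = g) : f =ᵐ[volume] g := by
  refine ae_eq_of_integral_contDiff_smul_eq ((Lp.memLp f).locallyIntegrable Fact.out)
    ((Lp.memLp g).locallyIntegrable Fact.out) fun θ hθ hθc => ?_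
  obtain ⟨η, hη⟩ := exists_schwartzMap_ofReal_eq hθ hθc
  have h1 : (f : 𝓢'(E3, ℂ)) η = (g : 𝓢'(E3, ℂ)) η := by rw [h]
  simpa [Lp.toTemperedDistribution_apply, hη] using h1

/-- Translation minus the identity is a bounded operator on `L^p`, so it commutes with the sum. -/
theorem eLpNorm_increment_tsum_le {p : ℝ≥0∞} [Fact (1 ≤ p)]
    {g : ℕ → Lp ℂ p (volume : Measure E3)} (hg : Summable g) (z : E3) :
    eLpNorm (fun x => (∑' k, g k : Lp ℂ p (volume : Measure E3)) (x - z)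
        - (∑' k, g k : Lp ℂ p (volume : Measure E3)) x) p volume
      ≤ ∑' k, eLpNorm (fun x => g k (x - z) - g k x) p volume := by
  let τ : Lp ℂ p (volume : Measure E3) →L[ℂ] Lp ℂ p (volume : Measure E3) :=
    (Lp.compMeasurePreservingₗᵢ ℂ (fun x : E3 => x - z)
      (measurePreserving_sub_right volume z)).toContinuousLinearMap
      - ContinuousLinearMap.id ℂ _
  have hτ : ∀ h : Lp ℂ p (volume : Measure E3),
      ‖τ h‖ₑ = eLpNorm (fun x => h (x - z) - h x) p volume := fun h => by
    rw [Lp.enorm_def]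
    refine eLpNorm_congr_ae ?_
    filter_upwards [Lp.coeFn_sub (Lp.compMeasurePreserving (fun x : E3 => x - z)
      (measurePreserving_sub_right volume z) h) h, Lp.coeFn_compMeasurePreserving h
      (measurePreserving_sub_right volume z)] with x h1 h2
    exact h1.trans (by rw [Pi.sub_apply, h2]; rfl)
  simp_rw [← hτ]
  rw [τ.map_tsum hg]
  exact enorm_tsum_le_tsum_enorm

/-- Increments of a square-integrable function, bounded block by block. -/
theorem exists_eLpNorm_increment_le_tsum : ∃ C : ℝ≥0∞, C ≠ ⊤ ∧ ∀ (P : DyadicPartition)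
    (f : Lp ℂ 2 (volume : Measure E3)),
    ∑' k : ℕ, distLpNorm 3 (P.block ((k : ℤ) - 1) (f : 𝓢'(E3, ℂ))) ≠ ⊤ → ∀ z : E3,
      eLpNorm (fun x => f (x - z) - f x) 3 volume
        ≤ C * ∑' k : ℕ, ENNReal.ofReal (min 1 (2 ^ ((k : ℤ) - 1) * ‖z‖))
            * distLpNorm 3 (P.block ((k : ℤ) - 1) (f : 𝓢'(E3, ℂ))) := by
  obtain ⟨C, hC, hCz⟩ := exists_eLpNorm_increment_le
  refine ⟨C, hC, fun P f hf z => ?_⟩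
  have hk := fun k => exists_coe_eq_of_distLpNorm_ne_top (ENNReal.ne_top_of_tsum_ne_top hf k)
  choose g hg using hk
  simp_rw [← hg, distLpNorm_coe] at hf ⊢
  have hs : Summable g := by
    refine Summable.of_norm ?_
    have := ENNReal.summable_toReal hf
    simpa [toReal_enorm] using this
  -- The partial sums of the blocks tend to `f` as distributions and to the `L³` sum in norm; limits
  -- are unique.
  have hfg : (f : 𝓢'(E3, ℂ)) = ((∑' k, g k : Lp ℂ 3 (volume : Measure E3)) : 𝓢'(E3, ℂ)) := by
    ext η
    have h1 := P.tendsto_sum_block f η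
    simp_rw [← hg] at h1
    have h2 := ((Lp.toTemperedDistributionCLM ℂ (volume : Measure E3) 3).hasSum hs.hasSum)
    have h3 := (((PointwiseConvergenceCLM.evalCLM (RingHom.id ℂ) ℂ η) :
      𝓢'(E3, ℂ) →L[ℂ] ℂ).hasSum h2).tendsto_sum_nat
    exact tendsto_nhds_unique h1 h3
  have hae := ae_eq_of_toTemperedDistribution_eq hfg
  have hae' := (measurePreserving_sub_right volume z).quasiMeasurePreserving.ae hae
  have h4 : (fun x => f (x - z) - f x) =ᵐ[volume]
      fun x => (∑' k, g k : Lp ℂ 3 (volume : Measure E3)) (x - z)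
        - (∑' k, g k : Lp ℂ 3 (volume : Measure E3)) x := by
    filter_upwards [hae, hae'] with x h5 h6
    rw [h5, h6]
  rw [eLpNorm_congr_ae h4, ← ENNReal.tsum_mul_left]
  refine (eLpNorm_increment_tsum_le hs z).trans (ENNReal.tsum_le_tsum fun k => ?_)
  rw [← mul_assoc, Lp.enorm_def]
  refine hCz _ (by positivity) (g k) ?_ z
  rw [hg k]
  exact P.fourierMultiplierCLM_cutoff_block k f

/-! ### Besov regularity at a dyadic scale -/

/-- The weight of the block at distance `m` from the scale of observation. -/
noncomputable def besovWeight (s : ℝ) (m : ℤ) : ℝ := min 1 ((2 : ℝ) ^ m) * (2 : ℝ) ^ (-((m : ℝ) * s))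

theorem besovWeight_nonneg (s : ℝ) (m : ℤ) : 0 ≤ besovWeight s m := by
  unfold besovWeight
  positivity

theorem summable_two_rpow_neg_mul {s : ℝ} (hs : 0 < s) :
    Summable (fun k : ℕ => (2 : ℝ) ^ (-((k : ℝ) * s))) := by
  have h : ∀ k : ℕ, (2 : ℝ) ^ (-((k : ℝ) * s)) = ((2 : ℝ) ^ (-s)) ^ k := fun k => by
    rw [← Real.rpow_natCast, ← Real.rpow_mul (by norm_num)]
    congr 1
    ring
  simp_rw [h]
  exact summable_geometric_of_lt_one (by positivity)
    (Real.rpow_lt_one_of_one_lt_of_neg (by norm_num) (by linarith))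

/-- The weights decay like `2^{-ms}` for `m ≥ 0` and like `2^{-|m|(1-s)}` for `m < 0`, so both `0 <
s` and `s < 1` are needed. -/
theorem summable_besovWeight {s : ℝ} (h0 : 0 < s) (h1 : s < 1) : Summable (besovWeight s) := by
  refine Summable.of_nat_of_neg ?_ ?_
  · refine (summable_two_rpow_neg_mul h0).of_nonneg_of_le (fun k => besovWeight_nonneg _ _)
      fun k => ?_
    unfold besovWeight
    rw [Int.cast_natCast]
    exact mul_le_of_le_one_left (by positivity) (min_le_left _ _)
  · refine (summable_two_rpow_neg_mul (sub_pos.2 h1)).of_nonneg_of_le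
      (fun k => besovWeight_nonneg _ _) fun k => ?_
    unfold besovWeight
    refine (mul_le_mul_of_nonneg_right (min_le_right _ _) (by positivity)).trans (le_of_eq ?_)
    rw [← Real.rpow_intCast, ← Real.rpow_add (by norm_num)]
    congr 1
    push_cast
    ring

namespace DyadicPartition

variable (P : DyadicPartition)

/-- The weighted average of the blocks of `f` around the scale `2⁻ⁿ`. -/
noncomputable def besovTail (s : ℝ) (f : 𝓢'(E3, ℂ)) (n : ℕ) : ℝ≥0∞ :=
  ∑' m : ℤ, ENNReal.ofReal (besovWeight s m) * P.weightedBlock s 3 f (n + m)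

theorem distLpNorm_block (s : ℝ) (f : 𝓢'(E3, ℂ)) (j : ℤ) :
    distLpNorm 3 (P.block j f)
      = ENNReal.ofReal ((2 : ℝ) ^ (-((j : ℝ) * s))) * P.weightedBlock s 3 f j := by
  rw [weightedBlock, ← mul_assoc, ← ENNReal.ofReal_mul (by positivity),
    ← Real.rpow_add (by norm_num)]
  simp

theorem besovTail_le (s : ℝ) (f : 𝓢'(E3, ℂ)) (n : ℕ) :
    P.besovTail s f n ≤ (∑' m, ENNReal.ofReal (besovWeight s m)) * P.besovNorm s 3 f := by
  rw [besovTail, ← ENNReal.tsum_mul_right]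
  exact ENNReal.tsum_le_tsum fun m => mul_le_mul_right (le_iSup (P.weightedBlock s 3 f) _) _

/-- Dominated convergence for the series over `m`, viewed as an integral for counting measure: for
fixed `m` the block index `n + m` tends to infinity. -/
theorem tendsto_besovTail {s : ℝ} (h0 : 0 < s) (h1 : s < 1) {f : 𝓢'(E3, ℂ)}
    (hf : f ∈ P.besovC s 3) : Tendsto (P.besovTail s f) atTop (𝓝 0) := by
  have hw : ∑' m, ENNReal.ofReal (besovWeight s m) ≠ ⊤ :=
    (summable_besovWeight h0 h1).tsum_ofReal_ne_top
  unfold besovTail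
  simp_rw [← lintegral_count]
  rw [show (0 : ℝ≥0∞) = ∫⁻ _ : ℤ, 0 ∂Measure.count by simp]
  refine tendsto_lintegral_of_dominated_convergence
    (fun m => ENNReal.ofReal (besovWeight s m) * P.besovNorm s 3 f)
    (fun n => measurable_of_countable _)
    (fun n => .of_forall fun m => mul_le_mul_right (le_iSup (P.weightedBlock s 3 f) _) _) ?_
    (.of_forall fun m => ?_)
  · rw [lintegral_count, ENNReal.tsum_mul_right]
    exact ENNReal.mul_ne_top hw hf.1.ne
  · have h2 : Tendsto (fun n : ℕ => (n : ℤ) + m) atTop atTop :=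
      tendsto_atTop_add_const_right _ _ tendsto_natCast_atTop_atTop
    simpa using ENNReal.Tendsto.const_mul (hf.2.comp h2) (.inr ENNReal.ofReal_ne_top)

theorem tsum_distLpNorm_block_ne_top {s : ℝ} (h0 : 0 < s) {f : 𝓢'(E3, ℂ)}
    (hf : P.besovNorm s 3 f < ⊤) : ∑' k : ℕ, distLpNorm 3 (P.block ((k : ℤ) - 1) f) ≠ ⊤ := by
  have h1 : Summable (fun k : ℕ => (2 : ℝ) ^ (-(((k : ℝ) - 1) * s))) := by
    have := (summable_two_rpow_neg_mul h0).mul_left ((2 : ℝ) ^ s)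
    refine this.congr fun k => ?_
    rw [← Real.rpow_add (by norm_num)]
    congr 1
    ring
  refine ne_top_of_le_ne_top (ENNReal.mul_ne_top h1.tsum_ofReal_ne_top hf.ne) ?_
  rw [← ENNReal.tsum_mul_right]
  refine ENNReal.tsum_le_tsum fun k => ?_
  rw [P.distLpNorm_block s]
  push_cast
  exact mul_le_mul_right (le_iSup (P.weightedBlock s 3 f) _) _

/-- Set `m = k - 1 - n`, the position of the block relative to the scale `2⁻ⁿ`. Extending the sum to
all integers `m` only adds nonnegative terms. -/
theorem tsum_min_mul_distLpNorm_block_le (s : ℝ) (f : 𝓢'(E3, ℂ)) (n : ℕ) {r : ℝ}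
    (hr : r ≤ (2 ^ n)⁻¹) :
    ∑' k : ℕ, ENNReal.ofReal (min 1 (2 ^ ((k : ℤ) - 1) * r)) * distLpNorm 3 (P.block ((k : ℤ) - 1) f)
      ≤ ENNReal.ofReal ((2 : ℝ) ^ (-((n : ℝ) * s))) * P.besovTail s f n := by
  have hinj : Function.Injective (fun k : ℕ => (k : ℤ) - 1 - n) := fun a b h => by
    simpa using h
  rw [besovTail, ← ENNReal.tsum_mul_left]
  refine le_trans (ENNReal.tsum_le_tsum fun k => ?_) (ENNReal.tsum_comp_le_tsum_of_injective hinj _)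
  rw [P.distLpNorm_block s, ← mul_assoc, ← mul_assoc, add_sub_cancel,
    ← ENNReal.ofReal_mul' (by positivity), ← ENNReal.ofReal_mul (by positivity)]
  refine mul_le_mul_left (ENNReal.ofReal_le_ofReal ?_) _
  have h1 : (2 : ℝ) ^ ((k : ℤ) - 1) * r ≤ (2 : ℝ) ^ ((k : ℤ) - 1 - n) := by
    rw [zpow_sub₀ (by norm_num : (2 : ℝ) ≠ 0) ((k : ℤ) - 1) n, div_eq_mul_inv, zpow_natCast]
    exact mul_le_mul_of_nonneg_left hr (by positivity)
  refine (mul_le_mul_of_nonneg_right (min_le_min_left 1 h1) (by positivity)).trans (le_of_eq ?_)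
  rw [besovWeight, mul_left_comm, ← Real.rpow_add (by norm_num)]
  congr 2
  push_cast
  ring

/-- Only blocks with `j ≥ -1` are nonzero; the constant is attained at `j = -1`, since `(r - s)(j +
1) ≥ 0`. -/
theorem besovNorm_le_of_le {s r : ℝ} (h : s ≤ r) (f : 𝓢'(E3, ℂ)) :
    P.besovNorm s 3 f ≤ ENNReal.ofReal ((2 : ℝ) ^ (r - s)) * P.besovNorm r 3 f := by
  refine iSup_le fun j => ?_
  rcases le_or_gt j (-2) with hj | hj
  · simp [weightedBlock, P.block_eq_zero hj, distLpNorm_zero]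
  · refine le_trans ?_ (mul_le_mul_right (le_iSup (P.weightedBlock r 3 f) j) _)
    rw [weightedBlock, weightedBlock, ← mul_assoc, ← ENNReal.ofReal_mul (by positivity),
      ← Real.rpow_add (by norm_num)]
    refine mul_le_mul_left (ENNReal.ofReal_le_ofReal
      (Real.rpow_le_rpow_of_exponent_le (by norm_num) ?_)) _
    have hj' : (-1 : ℝ) ≤ j := by exact_mod_cast (show (-1 : ℤ) ≤ j by omega)
    nlinarith

end DyadicPartition

/-! ### The flux bound at a fixed time -/

theorem eLpNorm_increment_coord {p : ℝ≥0∞} (i : Fin 3) (a : Lp E3 2 (volume : Measure E3)) (z : E3) :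
    eLpNorm (fun x => coord i a (x - z) - coord i a x) p volume
      = eLpNorm (fun x => ((Complex.ofRealCLM.comp (EuclideanSpace.proj i : E3 →L[ℝ] ℝ)).compLp a :
          Lp ℂ 2 (volume : Measure E3)) (x - z)
        - ((Complex.ofRealCLM.comp (EuclideanSpace.proj i : E3 →L[ℝ] ℝ)).compLp a :
          Lp ℂ 2 (volume : Measure E3)) x) p volume := by
  have h := ContinuousLinearMap.coeFn_compLp
    (Complex.ofRealCLM.comp (EuclideanSpace.proj i : E3 →L[ℝ] ℝ)) a
  have h' := (measurePreserving_sub_right volume z).quasiMeasurePreserving.ae h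
  refine eLpNorm_congr_norm_ae ?_
  filter_upwards [h, h'] with x h1 h2
  rw [h1, h2]
  simp only [ContinuousLinearMap.comp_apply, Complex.ofRealCLM_apply, ← Complex.ofReal_sub,
    Complex.norm_real]
  rfl

theorem exists_eLpNorm_increment_coord_le : ∃ C : ℝ≥0∞, C ≠ ⊤ ∧ ∀ (P : DyadicPartition) (s : ℝ),
    0 < s → ∀ (i : Fin 3) (a : Lp E3 2 (volume : Measure E3)),
    P.besovNorm s 3 (component i a) < ⊤ → ∀ (n : ℕ) (z : E3), ‖z‖ ≤ (2 ^ n)⁻¹ →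
      eLpNorm (fun x => coord i a (x - z) - coord i a x) 3 volume
        ≤ C * (ENNReal.ofReal ((2 : ℝ) ^ (-((n : ℝ) * s))) * P.besovTail s (component i a) n) := by
  obtain ⟨C, hC, h⟩ := exists_eLpNorm_increment_le_tsum
  refine ⟨C, hC, fun P s hs i a hf n z hz => ?_⟩
  rw [eLpNorm_increment_coord]
  exact (h P _ (P.tsum_distLpNorm_block_ne_top hs hf) z).trans
    (mul_le_mul_right (P.tsum_min_mul_distLpNorm_block_le s _ n hz) _)

theorem mul_triple_le {t e₁ e₂ e₃ C a₁ a₂ a₃ S M : ℝ≥0∞} (he : t * (e₁ * e₂ * e₃) ≤ 1)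
    (h₁ : a₁ ≤ S) (h₂ : a₂ ≤ M) (h₃ : a₃ ≤ M) :
    t * (C * (e₁ * a₁) * (C * (e₂ * a₂)) * (C * (e₃ * a₃))) ≤ C ^ 3 * (S * M ^ 2) :=
  calc t * (C * (e₁ * a₁) * (C * (e₂ * a₂)) * (C * (e₃ * a₃)))
      = t * (e₁ * e₂ * e₃) * (C ^ 3 * (a₁ * (a₂ * a₃))) := by ring
    _ ≤ 1 * (C ^ 3 * (S * (M * M))) := by gcongr
    _ = C ^ 3 * (S * M ^ 2) := by ring

/-- The trilinear bound for the flux: every term contains a horizontal factor. -/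
theorem flux_terms_le {t e f C M : ℝ≥0∞} {A : Fin 3 → ℝ≥0∞} (h₁ : t * (e * e * e) ≤ 1)
    (h₂ : t * (e * f * f) ≤ 1) (h₃ : t * (e * e * f) ≤ 1) (hA : ∀ i, A i ≤ M) {δ : Fin 3 → ℝ≥0∞}
    (hδ0 : δ 0 = C * (e * A 0)) (hδ1 : δ 1 = C * (e * A 1)) (hδ2 : δ 2 = C * (f * A 2)) :
    t * (δ 0 * δ 0 * δ 0 + δ 0 * δ 1 * δ 1 + δ 0 * δ 2 * δ 2
          + (δ 1 * δ 0 * δ 0 + δ 1 * δ 1 * δ 1 + δ 1 * δ 2 * δ 2)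
          + (δ 2 * δ 0 * δ 0 + δ 2 * δ 1 * δ 1 + (δ 2 * δ 2 * δ 0 + δ 2 * δ 2 * δ 1)))
      ≤ 10 * (C ^ 3 * ((A 0 + A 1) * M ^ 2)) := by
  have s0 : A 0 ≤ A 0 + A 1 := le_self_add
  have s1 : A 1 ≤ A 0 + A 1 := le_add_self
  have e1 : δ 2 * δ 0 * δ 0 = δ 0 * δ 0 * δ 2 := by ring
  have e2 : δ 2 * δ 1 * δ 1 = δ 1 * δ 1 * δ 2 := by ring
  have e3 : δ 2 * δ 2 * δ 0 = δ 0 * δ 2 * δ 2 := by ring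
  have e4 : δ 2 * δ 2 * δ 1 = δ 1 * δ 2 * δ 2 := by ring
  rw [e1, e2, e3, e4, hδ0, hδ1, hδ2]
  simp only [mul_add t]
  set B := C ^ 3 * ((A 0 + A 1) * M ^ 2) with hB
  have : 10 * B = B + B + B + (B + B + B) + (B + B + (B + B)) := by ring
  rw [this]
  gcongr
  · exact mul_triple_le h₁ s0 (hA 0) (hA 0)
  · exact mul_triple_le h₁ s0 (hA 1) (hA 1)
  · exact mul_triple_le h₂ s0 (hA 2) (hA 2)
  · exact mul_triple_le h₁ s1 (hA 0) (hA 0)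
  · exact mul_triple_le h₁ s1 (hA 1) (hA 1)
  · exact mul_triple_le h₂ s1 (hA 2) (hA 2)
  · exact mul_triple_le h₃ s0 (hA 0) (hA 2)
  · exact mul_triple_le h₃ s1 (hA 1) (hA 2)
  · exact mul_triple_le h₂ s0 (hA 2) (hA 2)
  · exact mul_triple_le h₂ s1 (hA 2) (hA 2)

/-- The gradient's factor `2ⁿ` is absorbed by three increments as soon as their regularities add up
to at least `1`. -/
theorem two_pow_mul_rpow_triple_le_one (n : ℕ) {a b c : ℝ} (h : 1 ≤ a + b + c) :
    (2 : ℝ≥0∞) ^ n * (ENNReal.ofReal ((2 : ℝ) ^ (-((n : ℝ) * a)))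
      * ENNReal.ofReal ((2 : ℝ) ^ (-((n : ℝ) * b))) * ENNReal.ofReal ((2 : ℝ) ^ (-((n : ℝ) * c)))) ≤ 1 := by
  have h2 : (2 : ℝ≥0∞) ^ n = ENNReal.ofReal ((2 : ℝ) ^ (n : ℝ)) := by
    rw [Real.rpow_natCast, ENNReal.ofReal_pow (by norm_num), ENNReal.ofReal_ofNat]
  rw [h2, ← ENNReal.ofReal_mul (by positivity), ← ENNReal.ofReal_mul (by positivity),
    ← ENNReal.ofReal_mul (by positivity), ← Real.rpow_add (by norm_num),
    ← Real.rpow_add (by norm_num), ← Real.rpow_add (by norm_num)]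
  refine ENNReal.ofReal_le_one.2 (Real.rpow_le_one_of_one_le_of_nonpos (by norm_num) ?_)
  nlinarith [(Nat.cast_nonneg n : (0 : ℝ) ≤ n)]

/-- The horizontal tails stay explicit because they tend to zero; the other two factors are absorbed
in a free bound `M`, which can be chosen independently of `n`. -/
theorem exists_enorm_fluxForm_le_besovTail : ∃ D : ℝ≥0∞, D ≠ ⊤ ∧ ∀ (P : DyadicPartition) (α β : ℝ),
    0 < α → 0 < β → 1 ≤ 3 * α → 1 ≤ α + 2 * β → 1 ≤ 2 * α + β →
    ∀ a : Lp E3 2 (volume : Measure E3), (∀ η : E3 → ℝ, ContDiff ℝ ∞ η →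
      HasCompactSupport η → ∫ x, fderiv ℝ η x (a x) = 0) →
    P.besovNorm α 3 (component 0 a) < ⊤ → P.besovNorm α 3 (component 1 a) < ⊤ →
    P.besovNorm β 3 (component 2 a) < ⊤ → ∀ (n : ℕ) (M : ℝ≥0∞),
    P.besovTail α (component 0 a) n ≤ M → P.besovTail α (component 1 a) n ≤ M →
    P.besovTail β (component 2 a) n ≤ M →
    ‖fluxForm (contDiff_mollifierSq n) (hasCompactSupport_mollifierSq n) a a a‖ₑ
      ≤ D * ((P.besovTail α (component 0 a) n + P.besovTail α (component 1 a) n) * M ^ 2) := by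
  obtain ⟨C, hC, h⟩ := exists_eLpNorm_increment_coord_le
  refine ⟨2 * gradConst * (10 * C ^ 3), ENNReal.mul_ne_top (ENNReal.mul_ne_top (by simp)
    gradConst_ne_top) (ENNReal.mul_ne_top (by simp) (ENNReal.pow_ne_top hC)), ?_⟩
  intro P α β hα hβ h1 h2 h3 a ha f0 f1 f2 n M m0 m1 m2
  obtain ⟨A, hA0, hA1, hA2⟩ : ∃ A : Fin 3 → ℝ≥0∞, A 0 = P.besovTail α (component 0 a) n
    ∧ A 1 = P.besovTail α (component 1 a) n ∧ A 2 = P.besovTail β (component 2 a) n :=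
    ⟨![_, _, _], rfl, rfl, rfl⟩
  obtain ⟨δ, hδ0, hδ1, hδ2⟩ : ∃ δ : Fin 3 → ℝ≥0∞,
    δ 0 = C * (ENNReal.ofReal ((2 : ℝ) ^ (-((n : ℝ) * α))) * A 0)
    ∧ δ 1 = C * (ENNReal.ofReal ((2 : ℝ) ^ (-((n : ℝ) * α))) * A 1)
    ∧ δ 2 = C * (ENNReal.ofReal ((2 : ℝ) ^ (-((n : ℝ) * β))) * A 2) :=
    ⟨![_, _, _], rfl, rfl, rfl⟩
  have hd : ∀ i, ∀ y : E3, ‖y‖ ≤ (2 ^ n)⁻¹ →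
      eLpNorm (fun x => coord i a (x - y) - coord i a x) 3 volume ≤ δ i := by
    intro i y hy
    match i with
    | 0 => rw [hδ0, hA0]; exact h P α hα 0 a f0 n y hy
    | 1 => rw [hδ1, hA1]; exact h P α hα 1 a f1 n y hy
    | 2 => rw [hδ2, hA2]; exact h P β hβ 2 a f2 n y hy
  have hA : ∀ i, A i ≤ M := by
    intro i
    match i with
    | 0 => rwa [hA0]
    | 1 => rwa [hA1]
    | 2 => rwa [hA2]
  have h4 := flux_terms_le
    (two_pow_mul_rpow_triple_le_one n (a := α) (b := α) (c := α) (by linarith))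
    (two_pow_mul_rpow_triple_le_one n (a := α) (b := β) (c := β) (by linarith))
    (two_pow_mul_rpow_triple_le_one n (a := α) (b := α) (c := β) (by linarith)) hA hδ0 hδ1 hδ2
  rw [← hA0, ← hA1]
  refine (enorm_fluxForm_le n ha hd).trans ?_
  calc _ = 2 * gradConst * (2 ^ n * (δ 0 * δ 0 * δ 0 + δ 0 * δ 1 * δ 1 + δ 0 * δ 2 * δ 2
          + (δ 1 * δ 0 * δ 0 + δ 1 * δ 1 * δ 1 + δ 1 * δ 2 * δ 2)
          + (δ 2 * δ 0 * δ 0 + δ 2 * δ 1 * δ 1 + (δ 2 * δ 2 * δ 0 + δ 2 * δ 2 * δ 1)))) := by ring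
    _ ≤ 2 * gradConst * (10 * (C ^ 3 * ((A 0 + A 1) * M ^ 2))) := mul_le_mul_right h4 _
    _ = _ := by ring

/-! ### Integration in time and conclusion -/

theorem ENNReal.add_pow_three_le (a b : ℝ≥0∞) : (a + b) ^ 3 ≤ 8 * (a ^ 3 + b ^ 3) := by
  rcases le_total a b with h | h
  · calc (a + b) ^ 3 ≤ (b + b) ^ 3 := by gcongr
      _ = 8 * b ^ 3 := by ring
      _ ≤ _ := by gcongr; exact le_add_self
  · calc (a + b) ^ 3 ≤ (a + a) ^ 3 := by gcongr
      _ = 8 * a ^ 3 := by ring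
      _ ≤ _ := by gcongr; exact le_self_add

theorem lintegral_pow_three_ne_top {μ : Measure ℝ} {N : ℝ → ℝ≥0∞} (h : MemLp N 3 μ) :
    ∫⁻ s, N s ^ 3 ∂μ ≠ ⊤ := by
  have := lintegral_rpow_enorm_lt_top_of_eLpNorm_lt_top (by norm_num) (by simp) h.2
  simpa using this.ne

theorem lintegral_add_pow_three_ne_top {μ : Measure ℝ} {N L : ℝ → ℝ≥0∞} (hN : AEMeasurable N μ)
    (h : ∫⁻ s, N s ^ 3 ∂μ ≠ ⊤) (h' : ∫⁻ s, L s ^ 3 ∂μ ≠ ⊤) :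
    ∫⁻ s, (N s + L s) ^ 3 ∂μ ≠ ⊤ := by
  refine ne_top_of_le_ne_top ?_ (lintegral_mono fun s => ENNReal.add_pow_three_le (N s) (L s))
  rw [lintegral_const_mul' _ _ (by simp), lintegral_add_left' (hN.pow_const 3)]
  exact ENNReal.mul_ne_top (by simp) (ENNReal.add_ne_top.2 ⟨h, h'⟩)

theorem lintegral_const_mul_pow_three_ne_top {μ : Measure ℝ} {N : ℝ → ℝ≥0∞} {c : ℝ≥0∞} (hc : c ≠ ⊤)
    (h : ∫⁻ s, N s ^ 3 ∂μ ≠ ⊤) : ∫⁻ s, (c * N s) ^ 3 ∂μ ≠ ⊤ := by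
  simp_rw [mul_pow]
  rw [lintegral_const_mul' _ _ (ENNReal.pow_ne_top hc)]
  exact ENNReal.mul_ne_top (ENNReal.pow_ne_top hc) h

/-- The flux through scale `2⁻ⁿ` vanishes in the limit. -/
theorem tendsto_lintegral_enorm_flux (P : DyadicPartition) {T : ℝ}
    {u₀ : Lp E3 2 (volume : Measure E3)} {u : ℝ → Lp E3 2 (volume : Measure E3)}
    (hu : IsWeakEulerSolution T u₀ u)
    {α β : ℝ} (hα : 1 / 3 ≤ α) (hα' : α < 1) (hβ : (1 - α) / 2 ≤ β)
    (hu1 : MemBochner 3 T (P.besovC α 3) (P.besovNorm α 3) (fun t => component 0 (u t)))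
    (hu2 : MemBochner 3 T (P.besovC α 3) (P.besovNorm α 3) (fun t => component 1 (u t)))
    (hu3 : MemBochner 3 T (P.besov β 3) (P.besovNorm β 3) (fun t => component 2 (u t))) :
    Tendsto (fun n => ∫⁻ s in Ioo 0 T,
      ‖fluxForm (contDiff_mollifierSq n) (hasCompactSupport_mollifierSq n) (u s) (u s) (u s)‖ₑ)
      atTop (𝓝 0) := by
  obtain ⟨D, hD, hflux⟩ := exists_enorm_fluxForm_le_besovTail
  obtain ⟨-, hX1, hL1⟩ := hu1
  obtain ⟨-, hX2, hL2⟩ := hu2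
  obtain ⟨-, hX3, hL3⟩ := hu3
  -- The vertical regularity is lowered from `β` to `γ`. This secures `γ < 1`, required by the
  -- weights, and still gives `α + 2γ = 1`; `2α + γ ≥ 1` follows from `α ≥ 1/3`.
  set γ := (1 - α) / 2 with hγ
  have hγ0 : 0 < γ := by linarith
  have hγ1 : γ < 1 := by linarith
  have hα0 : 0 < α := by linarith
  set μ := (volume : Measure ℝ).restrict (Ioo 0 T)
  let c := ENNReal.ofReal ((2 : ℝ) ^ (β - γ))
  let W := ∑' m, ENNReal.ofReal (besovWeight α m) + ∑' m, ENNReal.ofReal (besovWeight γ m)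
  have hW : W ≠ ⊤ := ENNReal.add_ne_top.2 ⟨(summable_besovWeight hα0 hα').tsum_ofReal_ne_top,
    (summable_besovWeight hγ0 hγ1).tsum_ofReal_ne_top⟩
  -- A bound for all three tails at every scale, with integrable cube in time; `c` is the constant
  -- of the embedding from regularity `β` into `γ`.
  let N := fun s => W * (P.besovNorm α 3 (component 0 (u s)) + (P.besovNorm α 3 (component 1 (u s))
    + c * P.besovNorm β 3 (component 2 (u s))))
  have hN3 : ∫⁻ s, N s ^ 3 ∂μ ≠ ⊤ :=
    lintegral_const_mul_pow_three_ne_top hW (lintegral_add_pow_three_ne_top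
      hL1.1.aemeasurable (lintegral_pow_three_ne_top hL1) (lintegral_add_pow_three_ne_top
        hL2.1.aemeasurable (lintegral_pow_three_ne_top hL2)
        (lintegral_const_mul_pow_three_ne_top ENNReal.ofReal_ne_top
          (lintegral_pow_three_ne_top hL3))))
  have hmem : ∀ᵐ s ∂μ, s ∈ Ioo 0 T := ae_restrict_mem measurableSet_Ioo
  let A := fun n s => P.besovTail α (component 0 (u s)) n + P.besovTail α (component 1 (u s)) n
  have hm0 : ∀ n s, P.besovTail α (component 0 (u s)) n ≤ N s := fun n s =>
    (P.besovTail_le _ _ _).trans (mul_le_mul' le_self_add le_self_add)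
  have hm1 : ∀ n s, P.besovTail α (component 1 (u s)) n ≤ N s := fun n s =>
    (P.besovTail_le _ _ _).trans (mul_le_mul' le_self_add (le_self_add.trans le_add_self))
  have hm2 : ∀ n s, P.besovTail γ (component 2 (u s)) n ≤ N s := fun n s =>
    (P.besovTail_le _ _ _).trans (mul_le_mul' le_add_self
      ((P.besovNorm_le_of_le hβ _).trans (le_add_self.trans le_add_self)))
  have hbound : ∀ n, ∀ᵐ s ∂μ,
      ‖fluxForm (contDiff_mollifierSq n) (hasCompactSupport_mollifierSq n) (u s) (u s) (u s)‖ₑ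
        ≤ D * (A n s * N s ^ 2) := fun n => by
    filter_upwards [hX1, hX2, hX3, hmem] with s h1 h2 h3 hs
    exact hflux P α γ hα0 hγ0 (by linarith) (by linarith) (by linarith) (u s)
      (hu.divergence_free s (Ioo_subset_Icc_self hs)) h1.1 h2.1
      ((P.besovNorm_le_of_le hβ _).trans_lt (ENNReal.mul_lt_top ENNReal.ofReal_lt_top h3)) n (N s)
      (hm0 n s) (hm1 n s) (hm2 n s)
  rw [show (0 : ℝ≥0∞) = ∫⁻ _ : ℝ, 0 ∂μ by simp]
  -- The horizontal tails are at most `2 N`, whence the majorant `D * (2 * N ^ 3)`; at almost every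
  -- time they tend to zero while `N` stays finite.
  refine tendsto_lintegral_of_dominated_convergence' (fun s => D * (2 * N s ^ 3)) (fun n => ?_)
    (fun n => ?_) ?_ ?_
  · exact ((aestronglyMeasurable_flux _ _ hu).mono_measure
      (Measure.restrict_mono Ioo_subset_Icc_self le_rfl)).enorm
  · filter_upwards [hbound n] with s hs
    refine hs.trans (mul_le_mul_right ?_ _)
    calc A n s * N s ^ 2 ≤ (N s + N s) * N s ^ 2 := by
          gcongr
          exact add_le_add (hm0 n s) (hm1 n s)
      _ = 2 * N s ^ 3 := by ring
  · rw [lintegral_const_mul' _ _ hD, lintegral_const_mul' _ _ (by simp)]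
    exact ENNReal.mul_ne_top hD (ENNReal.mul_ne_top (by simp) hN3)
  · filter_upwards [hX1, hX2, hX3, ae_all_iff.2 hbound] with s h1 h2 h3 hs
    have hNs : N s ≠ ⊤ := ENNReal.mul_ne_top hW (ENNReal.add_ne_top.2 ⟨h1.1.ne,
      ENNReal.add_ne_top.2 ⟨h2.1.ne, ENNReal.mul_ne_top ENNReal.ofReal_ne_top (ne_of_lt h3)⟩⟩)
    have hA : Tendsto (fun n => A n s) atTop (𝓝 0) := by
      simpa using (P.tendsto_besovTail hα0 hα' h1).add (P.tendsto_besovTail hα0 hα' h2)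
    have hAN : Tendsto (fun n => D * (A n s * N s ^ 2)) atTop (𝓝 0) := by
      simpa using ENNReal.Tendsto.const_mul (ENNReal.Tendsto.mul_const hA
        (.inr (ENNReal.pow_ne_top hNs))) (.inr hD)
    exact tendsto_of_tendsto_of_tendsto_of_le_of_le tendsto_const_nhds hAN (fun _ => zero_le) hs

theorem theorem1p1 (P : DyadicPartition) (T : ℝ) (hT : 0 < T)
    (u₀ : Lp E3 2 (volume : Measure E3)) (u : ℝ → Lp E3 2 (volume : Measure E3))
    (hu : IsWeakEulerSolution T u₀ u)
    (α β : ℝ) (hα : 1 / 3 ≤ α) (hα' : α < 1) (hβ : (1 - α) / 2 ≤ β)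
    (hu1 : MemBochner 3 T (P.besovC α 3) (P.besovNorm α 3) (fun t => component 0 (u t)))
    (hu2 : MemBochner 3 T (P.besovC α 3) (P.besovNorm α 3) (fun t => component 1 (u t)))
    (hu3 : MemBochner 3 T (P.besov β 3) (P.besovNorm β 3) (fun t => component 2 (u t))) :
    ∀ t ∈ Icc 0 T, kineticEnergy (u t) = kineticEnergy u₀ := by
  intro t ht
  have hflux : Tendsto (fun n => ∫ s in (0 : ℝ)..t,
      fluxForm (contDiff_mollifierSq n) (hasCompactSupport_mollifierSq n) (u s) (u s) (u s))
      atTop (𝓝 0) := by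
    rw [tendsto_zero_iff_enorm_tendsto_zero]
    refine tendsto_of_tendsto_of_tendsto_of_le_of_le tendsto_const_nhds
      (tendsto_lintegral_enorm_flux P hu hα hα' hβ hu1 hu2 hu3) (fun _ => zero_le) fun n => ?_
    simp only
    rw [intervalIntegral.integral_of_le ht.1]
    refine (enorm_integral_le_lintegral_enorm _).trans ?_
    rw [← restrict_Ioo_eq_restrict_Ioc]
    exact lintegral_mono_set (Ioo_subset_Ioo_right ht.2)
  have h1 := (tendsto_energyForm (u t)).sub (tendsto_energyForm (u 0))
  have h2 : Tendsto (fun n =>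
      energyForm (contDiff_mollifierSq n) (hasCompactSupport_mollifierSq n) (u t) (u t)
        - energyForm (contDiff_mollifierSq n) (hasCompactSupport_mollifierSq n) (u 0) (u 0))
      atTop (𝓝 0) := by
    -- The mollified energies differ by twice the integrated flux, which tends to zero, while they
    -- converge to the squared `L²` norms at times `t` and `0`.
    simp_rw [fun n => mollified_energy_balance (contDiff_mollifierSq n)
      (hasCompactSupport_mollifierSq n) (mollifierSq_neg n) hT hu ht]
    simpa using hflux.const_mul 2
  have h3 := tendsto_nhds_unique h1 h2
  rw [kineticEnergy, kineticEnergy, ← hu.initial, sub_eq_zero.1 h3]
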